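/- Let $k\ge 1$, let $\mathbb B^n=\{x\in\mathbb R^n:|x|\le 1\}$, and let $\Sigma$ be a $k$-dimensional smooth manifold (Hausdorff, second countable, not necessarily compact) with possibly empty boundary $\partial\Sigma$. Let $\varphi:\Sigma\to\mathbb B^n$ be a smooth immersion with $\varphi(\partial\Sigma)\subset\partial\mathbb B^n$. Assume that no connected component of $\Sigma$ that is disjoint from $\partial\Sigma$ is mapped entirely into $\partial\mathbb B^n$. (This holds, for example, if every component of $\Sigma$ has non-empty boundary, or if no interior point of $\Sigma$ is mapped to $\partial\mathbb B^n$.) Equip $\Sigma$ with the metric induced by $\varphi$. Let $\vec H=\operatorname{Tr}A$ be the mean curvature vector, where $A(u,v)=(D_uv)^N$ is the second fundamental form, let $\Delta_\Sigma$ be the Laplacian of the induced metric, and let $\nu$ be the outward unit conormal of $\partial\Sigma$ in $\Sigma$. Then the following statements are equivalent: 1. $\varphi$ is a free boundary minimal submanifold: $\vec H\equiv 0$ on $\Sigma$, and $\Sigma$ meets $\partial\mathbb B^n$ orthogonally, i.e. at every $p\in\partial\Sigma$ the vector $d\varphi_p(\nu)$ is orthogonal to $T_{\varphi(p)}\partial\mathbb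 B^n$. 2. $\varphi$ is a critical point of the area functional among $k$-dimensional immersed submanifolds of $\mathbb B^n$ with boundary on $\partial\mathbb B^n$: for every smooth one-parameter family of immersions $\varphi_t:\Sigma\to\mathbb B^n$, $t\in(-\epsilon,\epsilon)$, with $\varphi_0=\varphi$, with $\varphi_t(\partial\Sigma)\subset\partial\mathbb B^n$ for all $t$, and with $\varphi_t=\varphi$ outside a compact set $K\subset\Sigma$ for all $t$ (for compact $\Sigma$ one may take $K=\Sigma$), the area of $\varphi_t$ over $K$, i.e. the volume of $K$ for the metric induced by $\varphi_t$, is differentiable at $t=0$ with derivative $0$. 3. The coordinate functions $x_1,\dots,x_n$ of $\mathbb R^n$ restrict to harmonic functions on $\Sigma$, i.e. $\Delta_\Sigma(x_i\circ\varphi)=0$, and $\partial (x_i\circ\varphi)/\partial\nu=x_i\circ\varphi$ on $\partial\Sigma$ for $i=1,\dots,n$. -/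

import Mathlib

open scoped Manifold ContDiff
open Set Metric MeasureTheory

noncomputable section

namespace FreeBoundary

/-- Euclidean space `ℝᵐ`. -/
abbrev E (m : ℕ) : Type := EuclideanSpace ℝ (Fin m)

section

variable {k n : ℕ} [NeZero k] {M : Type*} [TopologicalSpace M]
  [ChartedSpace (EuclideanHalfSpace k) M]

/-- The half-space `{x ∈ ℝᵏ | 0 ≤ x₀}` in which the charts of a `k`-manifold with boundary take
their values. -/
abbrev halfSpace (k : ℕ) [NeZero k] : Set (E k) := range (𝓡∂ k)

/-- The expression `f ∘ c⁻¹` of a map `f` in the chart `c` centred at `c : M`. -/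
def inChart {X : Type*} (f : M → X) (c : M) : E k → X :=
  f ∘ (extChartAt (𝓡∂ k) c).symm

/-- The partial derivative `∂ᵢ h` of a function on the half-space. -/
def partialDeriv (i : Fin k) (h : E k → ℝ) (x : E k) : ℝ :=
  fderivWithin ℝ h (halfSpace k) x (EuclideanSpace.single i 1)

variable (k) in
/-- The differential `dφ_p : T_p Σ → ℝⁿ` (the tangent space is identified with `ℝᵏ` through the
preferred chart at `p`, as everywhere in Mathlib). -/
def differential (φ : M → E n) (p : M) : E k →L[ℝ] E n :=
  mfderiv (𝓡∂ k) 𝓘(ℝ, E n) φ p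

variable (k) in
/-- A smooth immersion of the manifold with boundary `M` in `ℝⁿ`: a smooth map with injective
differential at every point, boundary points included. -/
def IsSmoothImmersion (φ : M → E n) : Prop :=
  ContMDiff (𝓡∂ k) 𝓘(ℝ, E n) ∞ φ ∧ ∀ p, Function.Injective (differential k φ p)

variable (k) in
/-- The induced metric `g_p(u, v) = ⟨dφ_p u, dφ_p v⟩`. -/
def inducedMetric (φ : M → E n) (p : M) (u v : E k) : ℝ :=
  inner ℝ (differential k φ p u) (differential k φ p v)

/-- The matrix `g_ij = ⟨∂ᵢ(φ ∘ c⁻¹), ∂ⱼ(φ ∘ c⁻¹)⟩` of the induced metric in the chart at `c`. -/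
def gram (φ : M → E n) (c : M) (x : E k) : Matrix (Fin k) (Fin k) ℝ :=
  Matrix.of fun i j => inner ℝ
    (fderivWithin ℝ (inChart φ c) (halfSpace k) x (EuclideanSpace.single i 1))
    (fderivWithin ℝ (inChart φ c) (halfSpace k) x (EuclideanSpace.single j 1))

/-! ### Second fundamental form and mean curvature -/

variable (k) in
/-- The tangent plane `dφ_p(T_p Σ) ⊆ ℝⁿ`. -/
def tangentPlane (φ : M → E n) (p : M) : Submodule ℝ (E n) :=
  LinearMap.range (differential k φ p).toLinearMap

variable (k) in
/-- The component `w^N` of `w ∈ ℝⁿ` normal to the tangent plane at `p`. -/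
def normalPart (φ : M → E n) (p : M) (w : E n) : E n :=
  w - (tangentPlane k φ p).starProjection w

variable (k) in
/-- The second fundamental form `A_p(u, v) = (D_u v)^N`. Here `v` is extended near `p` to the
tangent field with constant coefficients in the preferred chart at `p`, so that `D_u v` is the
second derivative `D²(φ ∘ c⁻¹)(u, v)`; any other extension changes it by a tangential vector. -/
def secondFundamentalForm (φ : M → E n) (p : M) (u v : E k) : E n :=
  normalPart k φ p
    (fderivWithin ℝ (fderivWithin ℝ (inChart φ p) (halfSpace k)) (halfSpace k)
      (extChartAt (𝓡∂ k) p p) u v)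

variable (k) in
/-- The mean curvature vector `H(p) = Tr A_p = ∑ᵢⱼ gⁱʲ A_p(∂ᵢ, ∂ⱼ)`, the trace being taken with
respect to the induced metric. -/
def meanCurvature (φ : M → E n) (p : M) : E n :=
  ∑ i, ∑ j, (gram φ p (extChartAt (𝓡∂ k) p p))⁻¹ i j •
    secondFundamentalForm k φ p (EuclideanSpace.single i 1) (EuclideanSpace.single j 1)

/-! ### The outward conormal -/

variable (k) in
/-- `ν ∈ T_p Σ`, at a boundary point `p`, is the outward conormal: a unit vector for the induced
metric, orthogonal to `T_p ∂Σ` and pointing out of `Σ`. In the preferred chart at `p`, the space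
`T_p ∂Σ` is `{w | w₀ = 0}` and the vectors that point out of `Σ` are those with `w₀ < 0`. -/
structure IsOutwardConormal (φ : M → E n) (p : M) (ν : E k) : Prop where
  unit : inducedMetric k φ p ν ν = 1
  orthogonal : ∀ w : E k, w 0 = 0 → inducedMetric k φ p ν w = 0
  outward : ν 0 < 0

/-! ### The intrinsic Laplacian -/

variable (k) in
/-- The Laplacian of the induced metric,
`Δ_Σ f = (det g)^(-1/2) ∑ᵢⱼ ∂ᵢ((det g)^(1/2) gⁱʲ ∂ⱼ f)`, computed at `p` in the preferred chart
at `p`. -/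
def laplacian (φ : M → E n) (f : M → ℝ) (p : M) : ℝ :=
  (Real.sqrt (gram φ p (extChartAt (𝓡∂ k) p p)).det)⁻¹ *
    ∑ i, ∑ j, partialDeriv i
      (fun x => Real.sqrt (gram φ p x).det * (gram φ p x)⁻¹ i j * partialDeriv j (inChart f p) x)
      (extChartAt (𝓡∂ k) p p)

/-! ### Area -/

section Area

variable [IsManifold (𝓡∂ k) ∞ M] [T2Space M] [SigmaCompactSpace M]

variable (k M) in
/-- A smooth partition of unity on `M` subordinate to the domains of the preferred charts. -/
def partition : SmoothPartitionOfUnity M (𝓡∂ k) M univ :=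
  (SmoothPartitionOfUnity.exists_isSubordinate_chartAt_source (𝓡∂ k) M).choose

theorem partition_isSubordinate :
    (partition k M).IsSubordinate (fun c : M => (chartAt (EuclideanHalfSpace k) c).source) :=
  (SmoothPartitionOfUnity.exists_isSubordinate_chartAt_source (𝓡∂ k) M).choose_spec

variable (k) in
/-- The `k`-dimensional area of `φ` over `K ⊆ M` (counted with multiplicity), that is the volume
of `K` for the induced metric: the integrals of `√(det g)` over coordinate domains, put together
with a partition of unity. As usual the value does not depend on the partition. It is used for
compact sets `K`, for which all but finitely many terms of the sum vanish. -/
def area (φ : M → E n) (K : Set M) : ℝ :=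
  ∑ᶠ c : M, ∫ x in (extChartAt (𝓡∂ k) c).target ∩ (extChartAt (𝓡∂ k) c).symm ⁻¹' K,
    partition k M c ((extChartAt (𝓡∂ k) c).symm x) * Real.sqrt (gram φ c x).det

end Area

/-! ### The three conditions -/

variable (k) in
/-- `φ` is a free boundary minimal immersed submanifold of the unit ball: its mean curvature
vanishes identically, and along `∂Σ` the outward conormal is orthogonal to the tangent space
`{w | ⟨φ(p), w⟩ = 0}` of the unit sphere. -/
structure IsFreeBoundaryMinimal (φ : M → E n) : Prop where
  minimal : ∀ p, meanCurvature k φ p = 0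
  orthogonal : ∀ p ∈ (𝓡∂ k).boundary M, ∀ ν : E k, IsOutwardConormal k φ p ν →
    ∀ w : E n, inner ℝ (φ p) w = 0 → inner ℝ (differential k φ p ν) w = 0

variable (k) in
/-- A smooth one-parameter family `F t`, `-ε < t < ε`, of immersions of `M` in the closed unit
ball, with the boundary of `M` mapped to the unit sphere, such that `F 0 = φ` and every `F t`
agrees with `φ` outside the compact set `K`. -/
structure IsVariation (φ : M → E n) (ε : ℝ) (K : Set M) (F : ℝ → M → E n) : Prop where
  pos : 0 < ε
  compact : IsCompact K
  smooth : ContMDiffOn (𝓘(ℝ, ℝ).prod (𝓡∂ k)) 𝓘(ℝ, E n) ∞ (Function.uncurry F)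
    (Ioo (-ε) ε ×ˢ univ)
  immersion : ∀ t ∈ Ioo (-ε) ε, IsSmoothImmersion k (F t)
  mapsTo_ball : ∀ t ∈ Ioo (-ε) ε, ∀ p, F t p ∈ closedBall (0 : E n) 1
  mapsTo_sphere : ∀ t ∈ Ioo (-ε) ε, ∀ p ∈ (𝓡∂ k).boundary M, F t p ∈ sphere (0 : E n) 1
  zero : F 0 = φ
  eq_outside : ∀ t ∈ Ioo (-ε) ε, ∀ p ∉ K, F t p = φ p

variable (k) in
/-- `φ` is a critical point of the area functional among immersed submanifolds of the unit ball
with boundary on the unit sphere: the derivative at `t = 0` of the area vanishes along every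
smooth compactly supported variation through such submanifolds (the area over the complement of
`K` does not change; for compact `M` one may take `K = univ`). -/
def IsCriticalForArea [IsManifold (𝓡∂ k) ∞ M] [T2Space M] [SigmaCompactSpace M]
    (φ : M → E n) : Prop :=
  ∀ (ε : ℝ) (K : Set M) (F : ℝ → M → E n), IsVariation k φ ε K F →
    HasDerivAt (fun t => area k (F t) K) 0 0

variable (k) in
/-- The coordinate functions `xᵢ` of `ℝⁿ` restrict to harmonic functions on `Σ` and satisfy
`∂xᵢ/∂ν = xᵢ` along `∂Σ`. -/
structure CoordinatesHarmonicRobin (φ : M → E n) : Prop where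
  harmonic : ∀ i : Fin n, ∀ p, laplacian k φ (fun q => φ q i) p = 0
  robin : ∀ i : Fin n, ∀ p ∈ (𝓡∂ k).boundary M, ∀ ν : E k, IsOutwardConormal k φ p ν →
    mfderiv (𝓡∂ k) 𝓘(ℝ, ℝ) (fun q => φ q i) p ν = φ p i

end

end FreeBoundary

end

/-! In a chart let g be the Gram matrix of the ∂ᵢφ and Fⁱ = √(det g) ∑ⱼ gⁱʲ ∂ⱼφ, an ℝⁿ-valued field
(`flux`). Two computations carry the proof. First, the duality ⟨Fⁱ, ∂ₗφ⟩ = δⁱₗ √(det g)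
(`inner_flux_dirDeriv`), once differentiated, shows that ∑ᵢ ∂ᵢFⁱ is normal to the immersion; hence
it equals √(det g) H (`lapDensity_eq`), so the Laplacians of the coordinate functions are the
components of H. Second, the derivative of √(det g) along a velocity V is ∑ᵢ ⟨Fⁱ, ∂ᵢV⟩
(`hasDerivAt_density_slice`). By the divergence theorem its integral is -∫⟨H, V⟩ plus a boundary
term in ⟨F⁰, V⟩, and F⁰ spans the conormal line along ∂Σ.

1 ⇔ 3: orthogonality makes dφ(ν) a unit multiple of φ, and the multiple is +1 because |φ|² is
maximal on ∂Σ; conversely dφ(ν) = φ is normal to the sphere.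

1 ⇒ 2: H = 0 removes the interior term. Along ∂Σ the velocity is tangent to the sphere while F⁰ is
parallel to φ, so the boundary term vanishes.

2 ⇒ 1: the variations are cut-offs of two deformations that respect the ball. The field (1 - |x|²)w
gives H = 0 wherever |φ| < 1, hence on the closure of that set; rotations show that F⁰ is normal to
the sphere along ∂Σ. On the open set where φ is locally spherical, ⟨H, φ⟩ = -k. The two values of
⟨H, φ⟩ are incompatible in the limit, so the spherical set is open and closed. A component contained
in it either misses ∂Σ, which is excluded by assumption, or has a boundary point where F⁰ is both
normal and tangent to the sphere, hence zero, which is impossible. The assumption is needed here: a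
closed great sphere in the unit sphere is critical, because velocities of two-sided variations in
the ball are tangent to the sphere there, but it is not minimal in ℝⁿ. -/

noncomputable section

namespace FreeBoundary

open Filter Topology

/-! ### Determinants -/

/-- The determinant along the line through an invertible matrix. -/
theorem hasDerivAt_det_line {m : ℕ} (A H : Matrix (Fin m) (Fin m) ℝ) (hA : A.det ≠ 0) :
    HasDerivAt (fun t : ℝ => (A + t • H).det) (A.det * (A⁻¹ * H).trace) 0 := by
  have h1 : ∀ t : ℝ, (A + t • H).det = A.det * (1 + t • (A⁻¹ * H)).det := by
    intro t
    rw [← Matrix.det_mul, mul_add, mul_one, Matrix.mul_smul, ← mul_assoc,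
      Matrix.mul_nonsing_inv _ (isUnit_iff_ne_zero.2 hA), one_mul]
  have h2 := funext fun t => (h1 t).trans
    (congrArg (A.det * ·) (Matrix.det_one_add_smul t (A⁻¹ * H)))
  rw [h2]
  refine HasDerivAt.const_mul _ ?_
  have hp : ∀ p : Polynomial ℝ, HasDerivAt (fun t : ℝ => p.eval t * t ^ 2) 0 0 := by
    intro p
    have := (p.hasDerivAt 0).fun_mul (hasDerivAt_pow 2 (0 : ℝ))
    simpa using this
  exact ((((hasDerivAt_id' (0 : ℝ)).const_mul (A⁻¹ * H).trace).const_add 1).fun_add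
    (hp _)).congr_deriv (by simp)

theorem contDiff_det {m : ℕ} {r : ℕ∞ω} :
    ContDiff ℝ r (fun A : Fin m → Fin m → ℝ => Matrix.det (Matrix.of A)) := by
  simp only [Matrix.det_apply, Matrix.of_apply]
  fun_prop

/-- **Jacobi's formula** for the derivative of a determinant. -/
theorem hasFDerivWithinAt_det {V : Type*} [NormedAddCommGroup V] [NormedSpace ℝ V] {m : ℕ}
    {A : V → Matrix (Fin m) (Fin m) ℝ} {A' : Fin m → Fin m → V →L[ℝ] ℝ} {s : Set V} {x : V}
    (h : ∀ i j, HasFDerivWithinAt (fun y => A y i j) (A' i j) s x) (hA : (A x).det ≠ 0) :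
    HasFDerivWithinAt (fun y => (A y).det)
      ((A x).det • ∑ i, ∑ j, (A x)⁻¹ i j • A' j i) s x := by
  have hd : HasFDerivAt (fun A : Fin m → Fin m → ℝ => Matrix.det (Matrix.of A))
      (fderiv ℝ (fun A : Fin m → Fin m → ℝ => Matrix.det (Matrix.of A)) (A x)) (A x) :=
    ((contDiff_det (r := 1)).differentiable one_ne_zero _).hasFDerivAt
  have hc : HasFDerivWithinAt (fun y => (fun i j => A y i j))
      (ContinuousLinearMap.pi fun i => ContinuousLinearMap.pi fun j => A' i j) s x := by
    refine hasFDerivWithinAt_pi.2 fun i => hasFDerivWithinAt_pi.2 fun j => h i j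
  have := hd.comp_hasFDerivWithinAt x hc
  refine this.congr_fderiv ?_
  ext v
  -- The determinant is polynomial, so its Fréchet derivative exists; it is identified by its values
  -- along lines through `A x`, where `hasDerivAt_det_line` applies.
  have hline : HasDerivAt (fun t : ℝ => (fun i j => A x i j + t * A' i j v : Fin m → Fin m → ℝ))
      (fun i j => A' i j v) (0 : ℝ) := by
    refine hasDerivAt_pi.2 fun i => hasDerivAt_pi.2 fun j => ?_
    simpa using ((hasDerivAt_id (0 : ℝ)).mul_const (A' i j v)).const_add (A x i j)
  have h1 := HasFDerivAt.comp_hasDerivAt (0 : ℝ) (by simpa using hd) hline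
  have h2 := hasDerivAt_det_line (A x) (Matrix.of fun i j => A' i j v) hA
  have h3 := h1.unique h2
  simp only [ContinuousLinearMap.comp_apply, smul_apply,
    sum_apply]
  refine Eq.trans ?_ (h3.trans ?_)
  · rfl
  · simp [Matrix.trace, Matrix.mul_apply]

section Smoothness

variable {V : Type*} [NormedAddCommGroup V] [NormedSpace ℝ V] {m : ℕ}
  {A : V → Matrix (Fin m) (Fin m) ℝ} {s : Set V} {x : V} {r : ℕ∞ω}

theorem contDiffWithinAt_det (h : ∀ i j, ContDiffWithinAt ℝ r (fun y => A y i j) s x) :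
    ContDiffWithinAt ℝ r (fun y => (A y).det) s x :=
  contDiff_det.contDiffAt.comp_contDiffWithinAt x
    (contDiffWithinAt_pi.2 fun i => contDiffWithinAt_pi.2 fun j => h i j)

/-- Cramer's rule: each entry of the inverse is an adjugate entry divided by the determinant, and
the adjugate entry is itself the determinant of a matrix with one row replaced by a constant row. -/
theorem contDiffWithinAt_inv (h : ∀ i j, ContDiffWithinAt ℝ r (fun y => A y i j) s x)
    (hA : (A x).det ≠ 0) (i j : Fin m) :
    ContDiffWithinAt ℝ r (fun y => (A y)⁻¹ i j) s x := by
  have h1 : (fun y => (A y)⁻¹ i j) = fun y => ((A y).det)⁻¹ * (A y).adjugate i j := by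
    ext y
    rw [Matrix.inv_def, Matrix.smul_apply, Ring.inverse_eq_inv', smul_eq_mul]
  rw [h1]
  refine ((contDiffWithinAt_det h).inv hA).mul ?_
  simp only [Matrix.adjugate_apply]
  refine contDiffWithinAt_det fun a b => ?_
  by_cases hab : a = j
  · subst hab
    simp only [Matrix.updateRow_self]
    exact contDiffWithinAt_const
  · simpa only [Matrix.updateRow_ne hab] using h a b

end Smoothness

/-! ### Calculus in the half-space -/

section HalfSpace

variable {k : ℕ} [NeZero k] {F : Type*} [NormedAddCommGroup F] [NormedSpace ℝ F]

theorem mem_halfSpace {x : E k} : x ∈ halfSpace k ↔ 0 ≤ x 0 := by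
  rw [halfSpace, range_modelWithCornersEuclideanHalfSpace]; rfl

theorem uniqueDiffOn_halfSpace : UniqueDiffOn ℝ (halfSpace k) := (𝓡∂ k).uniqueDiffOn

theorem subset_closure_interior_halfSpace :
    halfSpace k ⊆ closure (interior (halfSpace k)) :=
  (𝓡∂ k).range_subset_closure_interior

/-- The `i`-th partial derivative of a vector-valued function on the half-space. -/
def dirDeriv (i : Fin k) (f : E k → F) (x : E k) : F :=
  fderivWithin ℝ f (halfSpace k) x (EuclideanSpace.single i 1)

variable {x : E k} {f : E k → F}

theorem contDiffWithinAt_fderivWithin (hf : ContDiffWithinAt ℝ ∞ f (halfSpace k) x)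
    (hx : x ∈ halfSpace k) :
    ContDiffWithinAt ℝ ∞ (fderivWithin ℝ f (halfSpace k)) (halfSpace k) x :=
  hf.fderivWithin_right uniqueDiffOn_halfSpace (by simp) hx

theorem contDiffWithinAt_dirDeriv (hf : ContDiffWithinAt ℝ ∞ f (halfSpace k) x)
    (hx : x ∈ halfSpace k) (i : Fin k) :
    ContDiffWithinAt ℝ ∞ (dirDeriv i f) (halfSpace k) x :=
  (contDiffWithinAt_fderivWithin hf hx).clm_apply contDiffWithinAt_const

theorem dirDeriv_congr {g : E k → F} (h : f =ᶠ[𝓝[halfSpace k] x] g) (hx : x ∈ halfSpace k)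
    (i : Fin k) : dirDeriv i f x = dirDeriv i g x := by
  rw [dirDeriv, dirDeriv, h.fderivWithin_eq_of_mem hx]

theorem dirDeriv_clm {G : Type*} [NormedAddCommGroup G] [NormedSpace ℝ G] (L : F →L[ℝ] G)
    (hf : DifferentiableWithinAt ℝ f (halfSpace k) x) (hx : x ∈ halfSpace k) (i : Fin k) :
    dirDeriv i (fun y => L (f y)) x = L (dirDeriv i f x) := by
  have := (L.hasFDerivAt.comp_hasFDerivWithinAt x hf.hasFDerivWithinAt).fderivWithin
    (uniqueDiffOn_halfSpace x hx)
  rw [dirDeriv, show (fun y => L (f y)) = L ∘ f from rfl, this]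
  rfl

theorem dirDeriv_sum {ι : Type*} {t : Finset ι} {g : ι → E k → F}
    (hg : ∀ a ∈ t, DifferentiableWithinAt ℝ (g a) (halfSpace k) x) (hx : x ∈ halfSpace k)
    (i : Fin k) : dirDeriv i (fun y => ∑ a ∈ t, g a y) x = ∑ a ∈ t, dirDeriv i (g a) x := by
  rw [dirDeriv, fderivWithin_fun_sum (uniqueDiffOn_halfSpace x hx) hg]
  simp [dirDeriv]

theorem dirDeriv_smul {c : E k → ℝ} (hc : DifferentiableWithinAt ℝ c (halfSpace k) x)
    (hf : DifferentiableWithinAt ℝ f (halfSpace k) x) (hx : x ∈ halfSpace k) (i : Fin k) :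
    dirDeriv i (fun y => c y • f y) x = c x • dirDeriv i f x + dirDeriv i c x • f x := by
  rw [dirDeriv, fderivWithin_fun_smul (uniqueDiffOn_halfSpace x hx) hc hf]
  simp [dirDeriv]

theorem dirDeriv_inner {n : ℕ} {f g : E k → E n}
    (hf : DifferentiableWithinAt ℝ f (halfSpace k) x)
    (hg : DifferentiableWithinAt ℝ g (halfSpace k) x) (hx : x ∈ halfSpace k) (i : Fin k) :
    dirDeriv i (fun y => inner ℝ (f y) (g y)) x
      = inner ℝ (f x) (dirDeriv i g x) + inner ℝ (dirDeriv i f x) (g x) := by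
  rw [dirDeriv, (hf.hasFDerivWithinAt.inner ℝ hg.hasFDerivWithinAt).fderivWithin
    (uniqueDiffOn_halfSpace x hx)]
  rfl

/-- Symmetry of second derivatives persists at boundary points because the half-space lies in the
closure of its interior. -/
theorem dirDeriv_comm {n : ℕ} {f : E k → E n} (hf : ContDiffWithinAt ℝ ∞ f (halfSpace k) x)
    (hx : x ∈ halfSpace k) (i j : Fin k) :
    dirDeriv i (dirDeriv j f) x = dirDeriv j (dirDeriv i f) x := by
  have key : ∀ a b : Fin k, dirDeriv a (dirDeriv b f) x =
      fderivWithin ℝ (fderivWithin ℝ f (halfSpace k)) (halfSpace k) x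
        (EuclideanSpace.single a 1) (EuclideanSpace.single b 1) := by
    intro a b
    exact dirDeriv_clm (ContinuousLinearMap.apply ℝ (E n) (EuclideanSpace.single b (1 : ℝ)))
      ((contDiffWithinAt_fderivWithin hf hx).differentiableWithinAt (by simp)) hx a
  rw [key, key]
  exact (hf.isSymmSndFDerivWithinAt (by simp; exact WithTop.coe_le_coe.2 le_top)
    uniqueDiffOn_halfSpace (subset_closure_interior_halfSpace hx) hx) _ _

end HalfSpace

/-! ### Immersions of the half-space -/

theorem sum_single {k : ℕ} (w : E k) : ∑ i, w i • (EuclideanSpace.single i 1 : E k) = w := by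
  simpa using (EuclideanSpace.basisFun (Fin k) ℝ).sum_repr w

theorem clm_apply_eq_sum {k : ℕ} {F : Type*} [NormedAddCommGroup F] [NormedSpace ℝ F]
    (L : E k →L[ℝ] F)
    (w : E k) : L w = ∑ i, w i • L (EuclideanSpace.single i 1) := by
  conv_lhs => rw [← sum_single w]
  simp

section Immersion

variable {k n : ℕ} [NeZero k]

/-- The Gram matrix of the partial derivatives of a map on the half-space. -/
def gramOf (ψ : E k → E n) (x : E k) : Matrix (Fin k) (Fin k) ℝ :=
  Matrix.of fun i j => inner ℝ (dirDeriv i ψ x) (dirDeriv j ψ x)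

/-- The area density `√(det g)`. -/
def density (ψ : E k → E n) (x : E k) : ℝ := Real.sqrt (gramOf ψ x).det

/-- The `ℝⁿ`-valued vector field `√(det g) ∑ⱼ gⁱʲ ∂ⱼψ`. -/
def flux (ψ : E k → E n) (i : Fin k) (x : E k) : E n :=
  density ψ x • ∑ j, (gramOf ψ x)⁻¹ i j • dirDeriv j ψ x

/-- The density `∑ᵢⱼ √(det g) gⁱʲ ⟨∂ᵢy, ∂ⱼψ⟩` of the divergence of the field `y` along `ψ`. -/
def divDensity (ψ y : E k → E n) (x : E k) : ℝ :=
  ∑ i, inner ℝ (flux ψ i x) (dirDeriv i y x)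

/-- The density `∑ᵢⱼ ∂ᵢ(√(det g) gⁱʲ ∂ⱼψ)` of the Laplacian of `ψ`. -/
def lapDensity (ψ : E k → E n) (x : E k) : E n := ∑ i, dirDeriv i (flux ψ i) x

/-- The plane spanned by the partial derivatives of `ψ`. -/
def tangentAt (ψ : E k → E n) (x : E k) : Submodule ℝ (E n) :=
  LinearMap.range (fderivWithin ℝ ψ (halfSpace k) x).toLinearMap

/-- The mean curvature vector of `ψ`. -/
def meanCurvatureOf (ψ : E k → E n) (x : E k) : E n :=
  ∑ i, ∑ j, (gramOf ψ x)⁻¹ i j •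
    (fderivWithin ℝ (fderivWithin ℝ ψ (halfSpace k)) (halfSpace k) x
        (EuclideanSpace.single i 1) (EuclideanSpace.single j 1) -
      (tangentAt ψ x).starProjection
      (fderivWithin ℝ (fderivWithin ℝ ψ (halfSpace k)) (halfSpace k) x
        (EuclideanSpace.single i 1) (EuclideanSpace.single j 1)))

variable {ψ y : E k → E n} {x : E k}

theorem dirDeriv_mem_tangentAt (i : Fin k) : dirDeriv i ψ x ∈ tangentAt ψ x := ⟨_, rfl⟩

theorem inner_eq_zero_of_forall_dirDeriv {u v : E n} (hu : ∀ l, inner ℝ u (dirDeriv l ψ x) = 0)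
    (hv : v ∈ tangentAt ψ x) : inner ℝ u v = 0 := by
  obtain ⟨w, rfl⟩ := hv
  rw [ContinuousLinearMap.coe_coe, clm_apply_eq_sum, inner_sum]
  refine Finset.sum_eq_zero fun l _ => ?_
  rw [inner_smul_right]
  simp [show inner ℝ u (fderivWithin ℝ ψ (halfSpace k) x (EuclideanSpace.single l 1)) = 0
    from hu l]

theorem linearIndependent_dirDeriv_iff :
    LinearIndependent ℝ (fun i => dirDeriv i ψ x) ↔
      Function.Injective (fderivWithin ℝ ψ (halfSpace k) x) := by
  have h := (EuclideanSpace.basisFun (Fin k) ℝ).toBasis.linearIndependent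
  constructor
  · intro hl u v huv
    rw [clm_apply_eq_sum, clm_apply_eq_sum _ v, ← sub_eq_zero, ← Finset.sum_sub_distrib] at huv
    simp_rw [← sub_smul] at huv
    have := Fintype.linearIndependent_iff.1 hl _ huv
    ext i
    simpa [sub_eq_zero] using this i
  · intro hi
    have := h.map' (fderivWithin ℝ ψ (halfSpace k) x).toLinearMap (LinearMap.ker_eq_bot.2 hi)
    have e : (fun i => dirDeriv i ψ x) = (fderivWithin ℝ ψ (halfSpace k) x).toLinearMap ∘
        (EuclideanSpace.basisFun (Fin k) ℝ).toBasis := by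
      ext i : 1
      simp [dirDeriv]
    rw [e]
    exact this

theorem det_gramOf_ne_zero_iff :
    (gramOf ψ x).det ≠ 0 ↔ Function.Injective (fderivWithin ℝ ψ (halfSpace k) x) := by
  rw [← linearIndependent_dirDeriv_iff]
  exact Matrix.det_gram_ne_zero_iff_linearIndependent

theorem det_gramOf_nonneg : 0 ≤ (gramOf ψ x).det :=
  (Matrix.posSemidef_gram ℝ fun i => dirDeriv i ψ x).det_nonneg

theorem density_pos (h : (gramOf ψ x).det ≠ 0) : 0 < density ψ x :=
  Real.sqrt_pos.2 (lt_of_le_of_ne det_gramOf_nonneg h.symm)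

/-- This is g⁻¹g = 1: up to the factor √(det g), the fluxes form the frame of the tangent plane dual
to the ∂ₗψ. Most later computations use this duality in place of the inverse metric. -/
theorem inner_flux_dirDeriv (h : (gramOf ψ x).det ≠ 0) (i l : Fin k) :
    inner ℝ (flux ψ i x) (dirDeriv l ψ x) = if i = l then density ψ x else 0 := by
  have h1 := congrFun (congrFun (Matrix.nonsing_inv_mul _ (isUnit_iff_ne_zero.2 h)) i) l
  rw [Matrix.mul_apply] at h1
  rw [flux, real_inner_smul_left, sum_inner]
  simp_rw [real_inner_smul_left]
  simp only [gramOf, Matrix.of_apply] at h1 ⊢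
  rw [h1, Matrix.one_apply]
  split_ifs <;> simp

theorem flux_mem_tangentAt (i : Fin k) : flux ψ i x ∈ tangentAt ψ x :=
  Submodule.smul_mem _ _ (Submodule.sum_mem _ fun j _ =>
    Submodule.smul_mem _ _ (dirDeriv_mem_tangentAt j))

/-- A tangent vector orthogonal to the boundary directions is a multiple of `∑ⱼ g⁰ʲ ∂ⱼψ`. -/
theorem density_smul_eq_flux (h : (gramOf ψ x).det ≠ 0) {v : E n} (hv : v ∈ tangentAt ψ x)
    (hl : ∀ l, l ≠ 0 → inner ℝ v (dirDeriv l ψ x) = 0) :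
    density ψ x • v = inner ℝ v (dirDeriv 0 ψ x) • flux ψ 0 x := by
  -- The difference of the two sides is tangent, so it vanishes as soon as it is orthogonal to every
  -- partial derivative.
  rw [← sub_eq_zero, ← inner_self_eq_zero (𝕜 := ℝ)]
  refine inner_eq_zero_of_forall_dirDeriv (ψ := ψ) (x := x) (fun l => ?_)
    (Submodule.sub_mem _ (Submodule.smul_mem _ _ hv)
      (Submodule.smul_mem _ _ (flux_mem_tangentAt 0)))
  rw [inner_sub_left, real_inner_smul_left, real_inner_smul_left, inner_flux_dirDeriv h]
  by_cases hl0 : l = 0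
  · subst hl0; simp; ring
  · simp [hl l hl0, Ne.symm hl0]

theorem contDiffWithinAt_gramOf (hψ : ContDiffWithinAt ℝ ∞ ψ (halfSpace k) x)
    (hx : x ∈ halfSpace k) (i j : Fin k) :
    ContDiffWithinAt ℝ ∞ (fun z => gramOf ψ z i j) (halfSpace k) x :=
  (contDiffWithinAt_dirDeriv hψ hx i).inner ℝ (contDiffWithinAt_dirDeriv hψ hx j)

theorem eventually_det_gramOf_ne_zero (hψ : ContDiffWithinAt ℝ ∞ ψ (halfSpace k) x)
    (hx : x ∈ halfSpace k) (h : (gramOf ψ x).det ≠ 0) :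
    ∀ᶠ z in 𝓝[halfSpace k] x, (gramOf ψ z).det ≠ 0 :=
  (contDiffWithinAt_det (contDiffWithinAt_gramOf hψ hx)).continuousWithinAt.eventually_ne h

theorem contDiffWithinAt_density (hψ : ContDiffWithinAt ℝ ∞ ψ (halfSpace k) x)
    (hx : x ∈ halfSpace k) (h : (gramOf ψ x).det ≠ 0) :
    ContDiffWithinAt ℝ ∞ (density ψ) (halfSpace k) x :=
  (contDiffWithinAt_det (contDiffWithinAt_gramOf hψ hx)).sqrt h

theorem contDiffWithinAt_flux (hψ : ContDiffWithinAt ℝ ∞ ψ (halfSpace k) x)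
    (hx : x ∈ halfSpace k) (h : (gramOf ψ x).det ≠ 0) (i : Fin k) :
    ContDiffWithinAt ℝ ∞ (flux ψ i) (halfSpace k) x :=
  (contDiffWithinAt_density hψ hx h).smul (ContDiffWithinAt.sum fun j _ =>
    (contDiffWithinAt_inv (contDiffWithinAt_gramOf hψ hx) h i j).smul
      (contDiffWithinAt_dirDeriv hψ hx j))

theorem contDiffWithinAt_divDensity (hψ : ContDiffWithinAt ℝ ∞ ψ (halfSpace k) x)
    (hx : x ∈ halfSpace k) (h : (gramOf ψ x).det ≠ 0)
    (hy : ContDiffWithinAt ℝ ∞ y (halfSpace k) x) :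
    ContDiffWithinAt ℝ ∞ (divDensity ψ y) (halfSpace k) x :=
  ContDiffWithinAt.sum fun i _ => (contDiffWithinAt_flux hψ hx h i).inner ℝ
    (contDiffWithinAt_dirDeriv hy hx i)

theorem contDiffWithinAt_lapDensity (hψ : ContDiffWithinAt ℝ ∞ ψ (halfSpace k) x)
    (hx : x ∈ halfSpace k) (h : (gramOf ψ x).det ≠ 0) :
    ContDiffWithinAt ℝ ∞ (lapDensity ψ) (halfSpace k) x :=
  ContDiffWithinAt.sum fun i _ => contDiffWithinAt_dirDeriv (contDiffWithinAt_flux hψ hx h i) hx i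

/-- Derivative of the square root of a Gram determinant. -/
theorem hasFDerivWithinAt_sqrt_det_gram {V : Type*} [NormedAddCommGroup V] [NormedSpace ℝ V]
    {m : ℕ} {v : Fin m → V → E n} {v' : Fin m → V →L[ℝ] E n} {s : Set V} {x : V}
    (hv : ∀ i, HasFDerivWithinAt (v i) (v' i) s x)
    (h : (Matrix.gram ℝ fun i => v i x).det ≠ 0) :
    HasFDerivWithinAt (fun z => Real.sqrt (Matrix.gram ℝ fun i => v i z).det)
      (∑ i, (innerSL ℝ (Real.sqrt (Matrix.gram ℝ fun i => v i x).det •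
        ∑ j, (Matrix.gram ℝ fun i => v i x)⁻¹ i j • v j x)).comp (v' i)) s x := by
  have h1 := (hasFDerivWithinAt_det (A := fun z => Matrix.gram ℝ fun i => v i z)
    (fun i j => (hv i).inner ℝ (hv j)) h).sqrt h
  refine h1.congr_fderiv ?_
  ext w
  set G := Matrix.gram ℝ fun i => v i x with hG
  have hsymm : ∀ i j, G⁻¹ i j = G⁻¹ j i := by
    intro i j
    have hGt : G.transpose = G := by
      ext a b; simp [hG, Matrix.gram_apply, real_inner_comm]
    conv_lhs => rw [← hGt, ← Matrix.transpose_nonsing_inv]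
    rfl
  -- The two terms of the product rule contribute equally by symmetry of G⁻¹; the resulting 2
  -- cancels the 1/2 from the square root.
  have h3 : ∑ i, ∑ j, G⁻¹ i j * (inner ℝ (v j x) (v' i w) + inner ℝ (v' j w) (v i x)) =
      2 * ∑ i, ∑ j, G⁻¹ i j * inner ℝ (v j x) (v' i w) := by
    simp_rw [mul_add, Finset.sum_add_distrib]
    rw [two_mul]
    congr 1
    rw [Finset.sum_comm]
    refine Finset.sum_congr rfl fun i _ => Finset.sum_congr rfl fun j _ => ?_
    rw [hsymm, real_inner_comm]
  have hnn : 0 ≤ G.det := (Matrix.posSemidef_gram ℝ fun i => v i x).det_nonneg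
  have hs : 0 < Real.sqrt G.det := Real.sqrt_pos.2 (lt_of_le_of_ne hnn h.symm)
  have hs2 : Real.sqrt G.det * Real.sqrt G.det = G.det := Real.mul_self_sqrt hnn
  simp only [smul_apply, sum_apply, smul_eq_mul, ContinuousLinearMap.comp_apply,
    ContinuousLinearMap.prod_apply, fderivInnerCLM_apply, innerSL_apply_apply,
    real_inner_smul_left, sum_inner]
  rw [h3, ← Finset.mul_sum]
  nth_rewrite 2 [← hs2]
  field_simp

/-- Derivative of the area density in terms of the second derivatives. -/
theorem dirDeriv_density (hψ : ContDiffWithinAt ℝ ∞ ψ (halfSpace k) x)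
    (hx : x ∈ halfSpace k) (h : (gramOf ψ x).det ≠ 0) (l : Fin k) :
    dirDeriv l (density ψ) x = ∑ i, inner ℝ (flux ψ i x) (dirDeriv l (dirDeriv i ψ) x) := by
  have h1 := hasFDerivWithinAt_sqrt_det_gram (v := fun i => dirDeriv i ψ) (fun i =>
    ((contDiffWithinAt_dirDeriv hψ hx i).differentiableWithinAt (by simp)).hasFDerivWithinAt) h
  have h2 := congrArg (fun L : E k →L[ℝ] ℝ => L (EuclideanSpace.single l 1))
    (h1.fderivWithin (uniqueDiffOn_halfSpace x hx))
  refine h2.trans ?_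
  simp only [sum_apply]
  rfl

/-- Differentiating the duality ⟨Fⁱ, ∂ₗψ⟩ = δⁱₗ √(det g) along ∂ᵢ and summing leaves ∂ₗ√(det g) - ∑ᵢ
⟨Fⁱ, ∂ᵢ∂ₗψ⟩, which is zero by `dirDeriv_density` and the symmetry of second derivatives. Normality
of the Laplacian thus needs no Christoffel symbols. -/
theorem inner_lapDensity_dirDeriv (hψ : ContDiffWithinAt ℝ ∞ ψ (halfSpace k) x)
    (hx : x ∈ halfSpace k) (h : (gramOf ψ x).det ≠ 0) (l : Fin k) :
    inner ℝ (lapDensity ψ x) (dirDeriv l ψ x) = 0 := by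
  have hd : ∀ i, DifferentiableWithinAt ℝ (dirDeriv i ψ) (halfSpace k) x := fun i =>
    (contDiffWithinAt_dirDeriv hψ hx i).differentiableWithinAt (by simp)
  have h1 : ∀ i, inner ℝ (dirDeriv i (flux ψ i) x) (dirDeriv l ψ x) =
      (if i = l then dirDeriv l (density ψ) x else 0)
        - inner ℝ (flux ψ i x) (dirDeriv i (dirDeriv l ψ) x) := by
    intro i
    rw [eq_sub_iff_add_eq', ← dirDeriv_inner
      ((contDiffWithinAt_flux hψ hx h i).differentiableWithinAt (by simp)) (hd l) hx i]
    have : (fun z => inner ℝ (flux ψ i z) (dirDeriv l ψ z)) =ᶠ[𝓝[halfSpace k] x]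
        fun z => if i = l then density ψ z else 0 := by
      filter_upwards [eventually_det_gramOf_ne_zero hψ hx h] with z hz
      exact inner_flux_dirDeriv hz i l
    rw [dirDeriv_congr this hx]
    split_ifs with hil
    · rw [hil]
    · simp [dirDeriv]
  rw [lapDensity, sum_inner, Finset.sum_congr rfl fun i _ => h1 i, Finset.sum_sub_distrib,
    Finset.sum_ite_eq' Finset.univ l, if_pos (Finset.mem_univ l), dirDeriv_density hψ hx h,
    sub_eq_zero]
  exact Finset.sum_congr rfl fun i _ => by rw [dirDeriv_comm hψ hx]

theorem fderivWithin_fderivWithin_single (hψ : ContDiffWithinAt ℝ ∞ ψ (halfSpace k) x)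
    (hx : x ∈ halfSpace k) (i j : Fin k) :
    fderivWithin ℝ (fderivWithin ℝ ψ (halfSpace k)) (halfSpace k) x
        (EuclideanSpace.single i 1) (EuclideanSpace.single j 1) = dirDeriv i (dirDeriv j ψ) x :=
  (dirDeriv_clm (ContinuousLinearMap.apply ℝ (E n) (EuclideanSpace.single j (1 : ℝ)))
      ((contDiffWithinAt_fderivWithin hψ hx).differentiableWithinAt (by simp)) hx i).symm

/-- The Laplacian of an isometric immersion is its mean curvature vector. -/
theorem lapDensity_eq (hψ : ContDiffWithinAt ℝ ∞ ψ (halfSpace k) x)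
    (hx : x ∈ halfSpace k) (h : (gramOf ψ x).det ≠ 0) :
    lapDensity ψ x = density ψ x • meanCurvatureOf ψ x := by
  have hd : ∀ i, DifferentiableWithinAt ℝ (dirDeriv i ψ) (halfSpace k) x := fun i =>
    (contDiffWithinAt_dirDeriv hψ hx i).differentiableWithinAt (by simp)
  have hds := (contDiffWithinAt_density hψ hx h).differentiableWithinAt (by simp)
  have hdi := fun i j => (contDiffWithinAt_inv (contDiffWithinAt_gramOf hψ hx) h i
    j).differentiableWithinAt (show (∞ : ℕ∞ω) ≠ 0 by simp)
  -- The normal projection N fixes the Laplacian. In the product rule it annihilates every term in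
  -- which a coefficient is differentiated, because such terms are multiples of ∂ⱼψ; only the second
  -- derivatives survive.
  set N : E n →L[ℝ] E n := ContinuousLinearMap.id ℝ (E n) - (tangentAt ψ x).starProjection with hN
  have hNt : ∀ v ∈ tangentAt ψ x, N v = 0 := fun v hv => by
    simp [hN, Submodule.starProjection_eq_self_iff.2 hv]
  have hNl : N (lapDensity ψ x) = lapDensity ψ x := by
    have : (tangentAt ψ x).starProjection (lapDensity ψ x) = 0 := by
      rw [Submodule.starProjection_apply_eq_zero_iff, Submodule.mem_orthogonal']
      exact fun v hv => inner_eq_zero_of_forall_dirDeriv (inner_lapDensity_dirDeriv hψ hx h) hv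
    simp [hN, this]
  rw [← hNl, lapDensity, map_sum, meanCurvatureOf, Finset.smul_sum]
  refine Finset.sum_congr rfl fun i _ => ?_
  have e1 : dirDeriv i (flux ψ i) x = density ψ x • dirDeriv i (fun z =>
      ∑ j, (gramOf ψ z)⁻¹ i j • dirDeriv j ψ z) x + dirDeriv i (density ψ) x •
      ∑ j, (gramOf ψ x)⁻¹ i j • dirDeriv j ψ x :=
    dirDeriv_smul hds (DifferentiableWithinAt.fun_sum fun j _ => (hdi i j).smul (hd j)) hx i
  rw [e1, map_add, map_smul, map_smul, dirDeriv_sum (fun j _ => (hdi i j).fun_smul (hd j)) hx,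
    hNt _ (Submodule.sum_mem _ fun j _ => Submodule.smul_mem _ _ (dirDeriv_mem_tangentAt j)),
    smul_zero, add_zero, map_sum]
  congr 1
  refine Finset.sum_congr rfl fun j _ => ?_
  rw [dirDeriv_smul (hdi i j) (hd j) hx, map_add, map_smul, map_smul,
    hNt _ (dirDeriv_mem_tangentAt j), smul_zero, add_zero,
    fderivWithin_fderivWithin_single hψ hx]
  rfl

/-- The product rule for ⟨Fⁱ, y⟩, the pointwise form of integration by parts. -/
theorem divDensity_eq (hψ : ContDiffWithinAt ℝ ∞ ψ (halfSpace k) x)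
    (hx : x ∈ halfSpace k) (h : (gramOf ψ x).det ≠ 0)
    (hy : ContDiffWithinAt ℝ ∞ y (halfSpace k) x) :
    divDensity ψ y x = ∑ i, dirDeriv i (fun z => inner ℝ (flux ψ i z) (y z)) x
      - inner ℝ (lapDensity ψ x) (y x) := by
  rw [eq_sub_iff_add_eq, lapDensity, sum_inner, divDensity, ← Finset.sum_add_distrib]
  refine Finset.sum_congr rfl fun i _ => ?_
  rw [dirDeriv_inner ((contDiffWithinAt_flux hψ hx h i).differentiableWithinAt (by simp))
    (hy.differentiableWithinAt (by simp)) hx]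

theorem divDensity_self (h : (gramOf ψ x).det ≠ 0) : divDensity ψ ψ x = k * density ψ x := by
  rw [divDensity]
  simp [inner_flux_dirDeriv h]

theorem divDensity_congr {y' : E k → E n} (hy : y =ᶠ[𝓝[halfSpace k] x] y') (hx : x ∈ halfSpace k) :
    divDensity ψ y x = divDensity ψ y' x :=
  Finset.sum_congr rfl fun i _ => by rw [dirDeriv_congr hy hx]

end Immersion

/-! ### The divergence theorem in the half-space -/

section Divergence

theorem isClosed_halfSpace {k : ℕ} [NeZero k] : IsClosed (halfSpace k) := (𝓡∂ k).isClosed_range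

theorem halfSpace_mem_nhds {k : ℕ} [NeZero k] {x : E k} (hx : 0 < x 0) : halfSpace k ∈ 𝓝 x := by
  have : IsOpen {y : E k | 0 < y 0} := isOpen_lt continuous_const (by fun_prop)
  exact mem_of_superset (this.mem_nhds hx) fun y hy => mem_halfSpace.2 (le_of_lt hy)

theorem dirDeriv_eq_zero_of_notMem {k : ℕ} [NeZero k] {F : Type*} [NormedAddCommGroup F]
    [NormedSpace ℝ F] {f : E k → F} {Q : Set (E k)} (hQ : IsClosed Q)
    (hf : ∀ x ∈ halfSpace k, x ∉ Q → f x = 0) {x : E k} (hx : x ∈ halfSpace k) (hxQ : x ∉ Q)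
    (i : Fin k) : dirDeriv i f x = 0 := by
  have : f =ᶠ[𝓝[halfSpace k] x] fun _ => 0 := by
    filter_upwards [self_mem_nhdsWithin, mem_nhdsWithin_of_mem_nhds (hQ.isOpen_compl.mem_nhds hxQ)]
      with y hy hyQ using hf y hy hyQ
  rw [dirDeriv_congr this hx]
  simp [dirDeriv]

/-- Apply the divergence theorem on a box whose bottom face lies in {x₀ = 0} and whose other faces
lie outside the support. Only the bottom face contributes, and its outward normal -e₀ gives the
sign. In the open box x₀ > 0, so derivatives within the half-space are genuine derivatives. -/
theorem integral_divergence_halfSpace_succ {m : ℕ} (W : Fin (m + 1) → E (m + 1) → ℝ)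
    (hW : ∀ i, ContDiffOn ℝ 1 (W i) (halfSpace (m + 1))) {Q : Set (E (m + 1))} (hQ : IsCompact Q)
    (h0 : ∀ i, ∀ x ∈ halfSpace (m + 1), x ∉ Q → W i x = 0) :
    ∫ x in halfSpace (m + 1), ∑ i, dirDeriv i (W i) x =
      - ∫ y : Fin m → ℝ, W 0 (WithLp.toLp 2 (Fin.insertNth 0 0 y)) := by
  obtain ⟨R, hR0, hR⟩ : ∃ R : ℝ, 0 < R ∧ ∀ x ∈ Q, ∀ i, |x i| < R := by
    obtain ⟨R, hR⟩ := hQ.isBounded.exists_norm_le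
    -- The added 1 makes the bound strict, so that the faces |xⱼ| = R miss Q.
    refine ⟨max R 0 + 1, by positivity, fun x hx i => ?_⟩
    have h1 : |x i| ≤ ‖x‖ := PiLp.norm_apply_le x i
    have := hR x hx
    have := le_max_left R 0
    linarith
  set a : Fin (m + 1) → ℝ := fun i => if i = 0 then 0 else -R with ha
  set b : Fin (m + 1) → ℝ := fun _ => R with hb
  have ha0 : a 0 = 0 := by simp [ha]
  have hai : ∀ i, -R ≤ a i := fun i => by simp only [ha]; split_ifs <;> linarith
  have hle : a ≤ b := fun i => by simp only [ha, hb]; split_ifs <;> linarith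
  let ι : (Fin (m + 1) → ℝ) → E (m + 1) := WithLp.toLp 2
  let ιL : (Fin (m + 1) → ℝ) →L[ℝ] E (m + 1) :=
    (EuclideanSpace.equiv (Fin (m + 1)) ℝ).symm.toContinuousLinearMap
  have hιc : Continuous ι := ιL.continuous
  have hbox : ∀ x ∈ Icc a b, ι x ∈ halfSpace (m + 1) := fun x hx =>
    mem_halfSpace.2 (by simpa [ha0] using hx.1 0)
  have hfd : ∀ i, ContinuousOn (fderivWithin ℝ (W i) (halfSpace (m + 1))) (halfSpace (m + 1)) :=
    fun i => (hW i).continuousOn_fderivWithin uniqueDiffOn_halfSpace le_rfl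
  have key := integral_divergence_of_hasFDerivAt_off_countable' a b hle
    (fun i x => W i (ι x))
    (fun i x => (fderivWithin ℝ (W i) (halfSpace (m + 1)) (ι x)).comp ιL) ∅ countable_empty
    (fun i => (hW i).continuousOn.comp hιc.continuousOn hbox) ?_ ?_
  rotate_left
  · rintro x ⟨hx, -⟩ i
    have hx0 : 0 < (ι x) 0 := by simpa [ha0] using (hx 0 (mem_univ _)).1
    have hn := halfSpace_mem_nhds hx0
    have hd := ((hW i).differentiableOn one_ne_zero (ι x)
      (mem_of_mem_nhds hn)).hasFDerivWithinAt.hasFDerivAt hn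
    exact hd.comp x ιL.hasFDerivAt
  · refine ContinuousOn.integrableOn_compact isCompact_Icc ?_
    refine continuousOn_finsetSum _ fun i _ => ?_
    exact ((hfd i).comp hιc.continuousOn hbox).clm_apply continuousOn_const
  have hι : MeasurePreserving ι volume volume := PiLp.volume_preserving_toLp (Fin (m + 1))
  have hemb : MeasurableEmbedding ι :=
    (MeasurableEquiv.toLp 2 (Fin (m + 1) → ℝ)).measurableEmbedding
  have hz : ∀ i, ∀ x : E (m + 1), x ∈ halfSpace (m + 1) → (∃ j, R ≤ |x j|) → W i x = 0 := by
    rintro i x hx ⟨j, hj⟩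
    exact h0 i x hx fun hxQ => absurd (hR x hxQ j) (not_lt.2 hj)
  have hz' : ∀ i, ∀ x : E (m + 1), x ∈ halfSpace (m + 1) → (∃ j, R ≤ |x j|) →
      dirDeriv i (W i) x = 0 := by
    rintro i x hx ⟨j, hj⟩
    exact dirDeriv_eq_zero_of_notMem hQ.isClosed (h0 i) hx
      (fun hxQ => absurd (hR x hxQ j) (not_lt.2 hj)) i
  have hL : ∫ x in halfSpace (m + 1), ∑ i, dirDeriv i (W i) x =
      ∫ x in Icc a b, ∑ i, ((fderivWithin ℝ (W i) (halfSpace (m + 1)) (ι x)).comp ιL)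
        (Pi.single i 1) := by
    rw [← hι.setIntegral_preimage_emb hemb]
    rw [← setIntegral_eq_of_subset_of_forall_sdiff_eq_zero (s := Icc a b)
      (isClosed_halfSpace.preimage hιc).measurableSet hbox]
    · rfl
    · rintro x ⟨hxS, hxb⟩
      refine Finset.sum_eq_zero fun i _ => hz' i _ hxS ?_
      by_contra! hcon
      refine hxb ⟨fun j => ?_, fun j => (abs_lt.1 (hcon j)).2.le⟩
      by_cases hj : j = 0
      · subst hj
        rw [ha0]
        exact mem_halfSpace.1 hxS
      · simp only [ha, if_neg hj]
        exact (abs_lt.1 (hcon j)).1.le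
  rw [hL, key, Fin.sum_univ_succAbove _ 0]
  have hfront : ∀ i : Fin (m + 1), ∀ x ∈ Icc (a ∘ i.succAbove) (b ∘ i.succAbove),
      W i (ι (i.insertNth (b i) x)) = 0 := by
    intro i x hx
    refine hz i _ (hbox _ ⟨?_, ?_⟩) ⟨i, ?_⟩
    · rw [Fin.le_insertNth_iff]; exact ⟨hle i, hx.1⟩
    · rw [Fin.insertNth_le_iff]; exact ⟨le_rfl, hx.2⟩
    · simp [ι, hb, le_abs_self]
  have hback : ∀ i : Fin (m + 1), i ≠ 0 → ∀ x ∈ Icc (a ∘ i.succAbove) (b ∘ i.succAbove),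
      W i (ι (i.insertNth (a i) x)) = 0 := by
    intro i hi x hx
    refine hz i _ (hbox _ ⟨?_, ?_⟩) ⟨i, ?_⟩
    · rw [Fin.le_insertNth_iff]; exact ⟨le_rfl, hx.1⟩
    · rw [Fin.insertNth_le_iff]; exact ⟨hle i, hx.2⟩
    · simp [ι, ha, hi, le_abs_self]
  rw [setIntegral_eq_zero_of_forall_eq_zero (hfront 0), Finset.sum_eq_zero, add_zero, zero_sub, ha0]
  · congr 1
    refine setIntegral_eq_integral_of_forall_compl_eq_zero fun y hy => ?_
    refine hz 0 _ (mem_halfSpace.2 (by simp [ι])) ?_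
    by_contra! hcon
    refine hy ⟨fun j => ?_, fun j => ?_⟩
    · have := (abs_lt.1 (hcon j.succ)).1.le
      simpa [ha, ι] using this
    · have := (abs_lt.1 (hcon j.succ)).2.le
      simpa [hb, ι] using this
  · intro i _
    rw [setIntegral_eq_zero_of_forall_eq_zero (hfront _),
      setIntegral_eq_zero_of_forall_eq_zero (hback _ (Fin.succAbove_ne _ _)), sub_zero]

variable {k : ℕ} [NeZero k] {W : Fin k → E k → ℝ} {Q : Set (E k)}

theorem integral_divergence_halfSpace_eq_zero
    (hW : ∀ i, ContDiffOn ℝ 1 (W i) (halfSpace k)) (hQ : IsCompact Q)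
    (h0 : ∀ i, ∀ x ∈ halfSpace k, x ∉ Q → W i x = 0) (hbd : ∀ x : E k, x 0 = 0 → W 0 x = 0) :
    ∫ x in halfSpace k, ∑ i, dirDeriv i (W i) x = 0 := by
  obtain ⟨m, rfl⟩ := Nat.exists_eq_succ_of_ne_zero (NeZero.ne k)
  refine (integral_divergence_halfSpace_succ W hW hQ h0).trans ?_
  rw [neg_eq_zero]
  exact integral_eq_zero_of_ae (ae_of_all _ fun y => hbd _ (by simp))

/-- The trace of W₀ on the boundary hyperplane is continuous, nonnegative, compactly supported and
not identically zero, so its integral is positive. This strict sign is what yields the natural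
boundary condition for critical points. -/
theorem integral_divergence_halfSpace_neg
    (hW : ∀ i, ContDiffOn ℝ 1 (W i) (halfSpace k)) (hQ : IsCompact Q)
    (h0 : ∀ i, ∀ x ∈ halfSpace k, x ∉ Q → W i x = 0) (hbd : ∀ x : E k, x 0 = 0 → 0 ≤ W 0 x)
    {x₀ : E k} (hx₀ : x₀ 0 = 0) (hne : W 0 x₀ ≠ 0) :
    ∫ x in halfSpace k, ∑ i, dirDeriv i (W i) x < 0 := by
  obtain ⟨m, rfl⟩ := Nat.exists_eq_succ_of_ne_zero (NeZero.ne k)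
  refine (integral_divergence_halfSpace_succ W hW hQ h0).trans_lt ?_
  rw [neg_lt_zero]
  let j : (Fin m → ℝ) → E (m + 1) := fun y => WithLp.toLp 2 (Fin.insertNth 0 0 y)
  have hjc : Continuous j := by
    refine (PiLp.continuous_toLp 2 _).comp ?_
    fun_prop
  have hj : ∀ y, j y ∈ halfSpace (m + 1) := fun y => mem_halfSpace.2 (by simp [j])
  have hcont : Continuous fun y => W 0 (j y) :=
    (hW 0).continuousOn.comp_continuous hjc hj
  let p : E (m + 1) → (Fin m → ℝ) := fun x i => x i.succ
  have hpc : Continuous p := by fun_prop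
  refine Continuous.integral_pos_of_hasCompactSupport_nonneg_nonzero hcont ?_
    (fun y => hbd _ (by simp)) (x := p x₀) ?_
  · refine HasCompactSupport.intro (hQ.image hpc) fun y hy => h0 0 _ (hj y) fun hyQ => hy ?_
    exact ⟨_, hyQ, by ext i; simp [p]⟩
  · have : j (p x₀) = x₀ := by
      ext i
      refine Fin.cases ?_ (fun i => ?_) i
      · simpa [j] using hx₀.symm
      · simp [j, p]
    simpa [j] using (this ▸ hne : W 0 (j (p x₀)) ≠ 0)

end Divergence

/-! ### Change of coordinates -/

section CoordChange

variable {k n : ℕ} [NeZero k]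

/-- `ψ = ψ' ∘ τ` near `x` in the half-space, for a smooth change of coordinates `τ` with
invertible derivative at `x`. -/
structure IsReparam (τ : E k → E k) (x : E k) : Prop where
  mem : x ∈ halfSpace k
  smooth : ContDiffWithinAt ℝ ∞ τ (halfSpace k) x
  maps : ∀ᶠ z in 𝓝[halfSpace k] x, τ z ∈ halfSpace k
  det_ne_zero : (fderivWithin ℝ τ (halfSpace k) x).det ≠ 0

/-- The Jacobian matrix of a map of the half-space. -/
def jacobian (τ : E k → E k) (x : E k) : Matrix (Fin k) (Fin k) ℝ :=
  Matrix.of fun a i => dirDeriv i τ x a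

theorem det_jacobian (τ : E k → E k) (x : E k) :
    (jacobian τ x).det = (fderivWithin ℝ τ (halfSpace k) x).det := by
  have : jacobian τ x = LinearMap.toMatrix (EuclideanSpace.basisFun (Fin k) ℝ).toBasis
      (EuclideanSpace.basisFun (Fin k) ℝ).toBasis
      (fderivWithin ℝ τ (halfSpace k) x).toLinearMap := by
    ext a i
    simp [LinearMap.toMatrix_apply, jacobian, dirDeriv]
  rw [this, LinearMap.det_toMatrix]

variable {τ : E k → E k} {x : E k}

namespace IsReparam

theorem det_jacobian_ne_zero (h : IsReparam τ x) : (jacobian τ x).det ≠ 0 := by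
  rw [det_jacobian]; exact h.det_ne_zero

theorem target_mem (h : IsReparam τ x) : τ x ∈ halfSpace k := h.maps.self_of_nhdsWithin h.mem

theorem tendsto (h : IsReparam τ x) : Tendsto τ (𝓝[halfSpace k] x) (𝓝[halfSpace k] (τ x)) :=
  tendsto_nhdsWithin_iff.2 ⟨h.smooth.continuousWithinAt, h.maps⟩

/-- A reparametrization may be replaced by a map that preserves the whole half-space. -/
theorem fderivWithin_eq {F : Type*} [NormedAddCommGroup F] [NormedSpace ℝ F] {f f' : E k → F}
    (hx : x ∈ halfSpace k) (hτ : DifferentiableWithinAt ℝ τ (halfSpace k) x)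
    (hm : ∀ᶠ z in 𝓝[halfSpace k] x, τ z ∈ halfSpace k)
    (hf : f =ᶠ[𝓝[halfSpace k] x] f' ∘ τ)
    (hd : DifferentiableWithinAt ℝ f' (halfSpace k) (τ x)) :
    fderivWithin ℝ f (halfSpace k) x =
      (fderivWithin ℝ f' (halfSpace k) (τ x)).comp (fderivWithin ℝ τ (halfSpace k) x) := by
  have ht : Tendsto τ (𝓝[halfSpace k] x) (𝓝[halfSpace k] (τ x)) :=
    tendsto_nhdsWithin_iff.2 ⟨hτ.continuousWithinAt, hm⟩
  rw [hf.fderivWithin_eq_of_mem hx]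
  exact (hd.hasFDerivWithinAt.comp_of_tendsto x hτ.hasFDerivWithinAt ht).fderivWithin
    (uniqueDiffOn_halfSpace x hx)

variable {F : Type*} [NormedAddCommGroup F] [NormedSpace ℝ F] {f f' : E k → F}

theorem dirDeriv_eq (h : IsReparam τ x) (hf : f =ᶠ[𝓝[halfSpace k] x] f' ∘ τ)
    (hd : DifferentiableWithinAt ℝ f' (halfSpace k) (τ x)) (i : Fin k) :
    dirDeriv i f x = ∑ a, jacobian τ x a i • dirDeriv a f' (τ x) := by
  rw [dirDeriv, fderivWithin_eq h.mem (h.smooth.differentiableWithinAt (by simp)) h.maps hf hd,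
    ContinuousLinearMap.comp_apply, clm_apply_eq_sum]
  rfl

/-- The mixed Gram matrix transforms as a bilinear form. -/
theorem inner_dirDeriv_eq (h : IsReparam τ x) {f f' g g' : E k → E n}
    (hf : f =ᶠ[𝓝[halfSpace k] x] f' ∘ τ)
    (hfd : DifferentiableWithinAt ℝ f' (halfSpace k) (τ x))
    (hg : g =ᶠ[𝓝[halfSpace k] x] g' ∘ τ)
    (hgd : DifferentiableWithinAt ℝ g' (halfSpace k) (τ x)) :
    (Matrix.of fun i j => inner ℝ (dirDeriv i f x) (dirDeriv j g x)) =
      (jacobian τ x).transpose *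
        (Matrix.of fun i j => inner ℝ (dirDeriv i f' (τ x)) (dirDeriv j g' (τ x))) *
        jacobian τ x := by
  ext i j
  rw [Matrix.mul_apply, Matrix.of_apply, h.dirDeriv_eq hf hfd, h.dirDeriv_eq hg hgd, inner_sum]
  refine Finset.sum_congr rfl fun b _ => ?_
  rw [inner_smul_right, sum_inner, Matrix.mul_apply, mul_comm]
  congr 1
  refine Finset.sum_congr rfl fun a _ => ?_
  rw [real_inner_smul_left]
  rfl

variable {ψ ψ' y y' : E k → E n}

theorem gramOf_eq (h : IsReparam τ x) (hψ : ψ =ᶠ[𝓝[halfSpace k] x] ψ' ∘ τ)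
    (hd : DifferentiableWithinAt ℝ ψ' (halfSpace k) (τ x)) :
    gramOf ψ x = (jacobian τ x).transpose * gramOf ψ' (τ x) * jacobian τ x :=
  h.inner_dirDeriv_eq hψ hd hψ hd

/-- The Gram determinant acquires the square of the Jacobian determinant; its root is exactly the
factor in the change of variables formula. -/
theorem density_eq (h : IsReparam τ x) (hψ : ψ =ᶠ[𝓝[halfSpace k] x] ψ' ∘ τ)
    (hd : DifferentiableWithinAt ℝ ψ' (halfSpace k) (τ x)) :
    density ψ x = |(fderivWithin ℝ τ (halfSpace k) x).det| * density ψ' (τ x) := by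
  rw [density, h.gramOf_eq hψ hd, Matrix.det_mul, Matrix.det_mul, Matrix.det_transpose,
    det_jacobian, mul_right_comm, Real.sqrt_mul (mul_self_nonneg _), Real.sqrt_mul_self_eq_abs]
  rfl

/-- Written as a trace, the divergence is visibly invariant: the inverse Gram matrix and the mixed
Gram matrix transform by opposite Jacobians, which cancel under cyclic permutation. -/
theorem divDensity_eq_trace (ψ y : E k → E n) (x : E k) :
    divDensity ψ y x = density ψ x * ((gramOf ψ x)⁻¹ *
      (Matrix.of fun i j => inner ℝ (dirDeriv i ψ x) (dirDeriv j y x))).trace := by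
  simp only [divDensity, Matrix.trace, Matrix.diag, Matrix.mul_apply, Finset.mul_sum, flux,
    real_inner_smul_left, sum_inner, Matrix.of_apply]

theorem jacobian_mul_inv_gramOf (h : IsReparam τ x) (hψ : ψ =ᶠ[𝓝[halfSpace k] x] ψ' ∘ τ)
    (hd : DifferentiableWithinAt ℝ ψ' (halfSpace k) (τ x)) :
    jacobian τ x * (gramOf ψ x)⁻¹ * (jacobian τ x).transpose = (gramOf ψ' (τ x))⁻¹ := by
  have hu := isUnit_iff_ne_zero.2 h.det_jacobian_ne_zero
  rw [h.gramOf_eq hψ hd, Matrix.mul_inv_rev, Matrix.mul_inv_rev, ← mul_assoc,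
    Matrix.mul_nonsing_inv _ hu, one_mul, mul_assoc,
    Matrix.nonsing_inv_mul _ (by rwa [Matrix.det_transpose]), mul_one]

theorem divDensity_eq (h : IsReparam τ x) (hψ : ψ =ᶠ[𝓝[halfSpace k] x] ψ' ∘ τ)
    (hd : DifferentiableWithinAt ℝ ψ' (halfSpace k) (τ x))
    (hy : y =ᶠ[𝓝[halfSpace k] x] y' ∘ τ)
    (hyd : DifferentiableWithinAt ℝ y' (halfSpace k) (τ x)) :
    divDensity ψ y x = |(fderivWithin ℝ τ (halfSpace k) x).det| * divDensity ψ' y' (τ x) := by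
  rw [divDensity_eq_trace, divDensity_eq_trace, h.density_eq hψ hd,
    h.inner_dirDeriv_eq hψ hd hy hyd, ← h.jacobian_mul_inv_gramOf hψ hd, ← mul_assoc, ← mul_assoc,
    Matrix.trace_mul_comm, ← mul_assoc, ← mul_assoc, mul_assoc]

theorem tangentAt_eq (h : IsReparam τ x) (hψ : ψ =ᶠ[𝓝[halfSpace k] x] ψ' ∘ τ)
    (hd : DifferentiableWithinAt ℝ ψ' (halfSpace k) (τ x)) :
    tangentAt ψ x = tangentAt ψ' (τ x) := by
  rw [tangentAt, tangentAt,
    fderivWithin_eq h.mem (h.smooth.differentiableWithinAt (by simp)) h.maps hψ hd,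
    ContinuousLinearMap.toLinearMap_comp, LinearMap.range_comp_of_range_eq_top]
  rw [LinearMap.range_eq_top, ← LinearMap.injective_iff_surjective, ← LinearMap.ker_eq_bot]
  by_contra hker
  exact h.det_ne_zero (LinearMap.det_eq_zero_iff_ker_ne_bot.2 hker)

/-- The chain rule used twice. The term containing D²τ is the obstruction to tensoriality; it lies
in the tangent plane, so the second fundamental form does not see it. -/
theorem fderivWithin_fderivWithin_eq (h : IsReparam τ x) (hψ : ψ =ᶠ[𝓝[halfSpace k] x] ψ' ∘ τ)
    (hd : ContDiffWithinAt ℝ ∞ ψ' (halfSpace k) (τ x)) (u v : E k) :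
    fderivWithin ℝ (fderivWithin ℝ ψ (halfSpace k)) (halfSpace k) x u v =
      fderivWithin ℝ (fderivWithin ℝ ψ' (halfSpace k)) (halfSpace k) (τ x)
        (fderivWithin ℝ τ (halfSpace k) x u) (fderivWithin ℝ τ (halfSpace k) x v) +
      fderivWithin ℝ ψ' (halfSpace k) (τ x)
        (fderivWithin ℝ (fderivWithin ℝ τ (halfSpace k)) (halfSpace k) x u v) := by
  have hev : fderivWithin ℝ ψ (halfSpace k) =ᶠ[𝓝[halfSpace k] x] fun z =>
      (fderivWithin ℝ ψ' (halfSpace k) (τ z)).comp (fderivWithin ℝ τ (halfSpace k) z) := by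
    have h1 : ∀ᶠ z in 𝓝[halfSpace k] x, DifferentiableWithinAt ℝ τ (halfSpace k) z := by
      filter_upwards [(h.smooth.of_le (m := 1) (by simp)).eventually (by simp)
        |>.filter_mono (nhdsWithin_mono x (subset_insert _ _))] with z hz
      exact hz.differentiableWithinAt one_ne_zero
    have h2 : ∀ᶠ z in 𝓝[halfSpace k] (τ x), DifferentiableWithinAt ℝ ψ' (halfSpace k) z := by
      filter_upwards [(hd.of_le (m := 1) (by simp)).eventually (by simp)
        |>.filter_mono (nhdsWithin_mono _ (subset_insert _ _))] with z hz
      exact hz.differentiableWithinAt one_ne_zero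
    filter_upwards [self_mem_nhdsWithin, eventually_eventually_nhdsWithin.2 h.maps,
      eventually_eventually_nhdsWithin.2 hψ, h1, h.tendsto.eventually h2] with z hz hz1 hz2 hz3 hz4
    exact fderivWithin_eq hz hz3 hz1 hz2 hz4
  have hD := ((contDiffWithinAt_fderivWithin hd h.target_mem).differentiableWithinAt
    (by simp)).hasFDerivWithinAt.comp_of_tendsto x
      (h.smooth.differentiableWithinAt (by simp)).hasFDerivWithinAt h.tendsto
  have hT := ((contDiffWithinAt_fderivWithin h.smooth h.mem).differentiableWithinAt
    (by simp)).hasFDerivWithinAt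
  have := (hD.clm_comp hT).fderivWithin (uniqueDiffOn_halfSpace x h.mem)
  rw [hev.fderivWithin_eq_of_mem h.mem]
  erw [this]
  simp [add_comm]

/-- Once N has removed the D²τ term, the second fundamental form is a bilinear form in Dτ, and the
Jacobians are absorbed by `jacobian_mul_inv_gramOf`. -/
theorem meanCurvatureOf_eq (h : IsReparam τ x) (hψ : ψ =ᶠ[𝓝[halfSpace k] x] ψ' ∘ τ)
    (hd : ContDiffWithinAt ℝ ∞ ψ' (halfSpace k) (τ x)) :
    meanCurvatureOf ψ x = meanCurvatureOf ψ' (τ x) := by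
  have hd' := hd.differentiableWithinAt (by simp)
  set N : E n →L[ℝ] E n :=
    ContinuousLinearMap.id ℝ (E n) - (tangentAt ψ' (τ x)).starProjection with hN
  set B : E k → E k → E n := fun u v =>
    N (fderivWithin ℝ (fderivWithin ℝ ψ' (halfSpace k)) (halfSpace k) (τ x) u v) with hB
  have h1 : meanCurvatureOf ψ' (τ x) = ∑ a, ∑ b, (gramOf ψ' (τ x))⁻¹ a b •
      B (EuclideanSpace.single a 1) (EuclideanSpace.single b 1) := rfl
  have hNt : ∀ v, N (fderivWithin ℝ ψ' (halfSpace k) (τ x) v) = 0 := fun v => by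
    have : fderivWithin ℝ ψ' (halfSpace k) (τ x) v ∈ tangentAt ψ' (τ x) := ⟨v, rfl⟩
    simp [hN, Submodule.starProjection_eq_self_iff.2 this]
  have h2 : meanCurvatureOf ψ x = ∑ i, ∑ j, (gramOf ψ x)⁻¹ i j •
      B (dirDeriv i τ x) (dirDeriv j τ x) := by
    refine Finset.sum_congr rfl fun i _ => Finset.sum_congr rfl fun j _ => ?_
    simp only [h.tangentAt_eq hψ hd', h.fderivWithin_fderivWithin_eq hψ hd]
    congr 1
    refine (map_add N _ _).trans ?_
    rw [hNt, add_zero]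
    rfl
  have h3 : ∀ i j, B (dirDeriv i τ x) (dirDeriv j τ x) = ∑ a, ∑ b,
      (jacobian τ x a i * jacobian τ x b j) •
        B (EuclideanSpace.single a 1) (EuclideanSpace.single b 1) := by
    intro i j
    simp only [hB]
    rw [clm_apply_eq_sum _ (dirDeriv i τ x), sum_apply, map_sum]
    refine Finset.sum_congr rfl fun a _ => ?_
    rw [smul_apply, clm_apply_eq_sum _ (dirDeriv j τ x), map_smul, map_sum, Finset.smul_sum]
    refine Finset.sum_congr rfl fun b _ => ?_
    rw [map_smul, smul_smul]
    rfl
  rw [h1, h2, ← h.jacobian_mul_inv_gramOf hψ hd']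
  simp_rw [h3, Finset.smul_sum, smul_smul]
  have h4 : ∀ a b, (jacobian τ x * (gramOf ψ x)⁻¹ * (jacobian τ x).transpose) a b =
      ∑ i, ∑ j, (gramOf ψ x)⁻¹ i j * (jacobian τ x a i * jacobian τ x b j) := by
    intro a b
    rw [Matrix.mul_apply, Finset.sum_comm]
    refine Finset.sum_congr rfl fun j _ => ?_
    rw [Matrix.mul_apply, Finset.sum_mul]
    refine Finset.sum_congr rfl fun i _ => ?_
    rw [Matrix.transpose_apply]
    ring
  simp_rw [h4, Finset.sum_smul]
  calc _ = ∑ i, ∑ a, ∑ j, ∑ b, ((gramOf ψ x)⁻¹ i j * (jacobian τ x a i * jacobian τ x b j)) •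
        B (EuclideanSpace.single a 1) (EuclideanSpace.single b 1) :=
        Finset.sum_congr rfl fun i _ => Finset.sum_comm
    _ = ∑ a, ∑ i, ∑ j, ∑ b, ((gramOf ψ x)⁻¹ i j * (jacobian τ x a i * jacobian τ x b j)) •
        B (EuclideanSpace.single a 1) (EuclideanSpace.single b 1) := Finset.sum_comm
    _ = ∑ a, ∑ i, ∑ b, ∑ j, ((gramOf ψ x)⁻¹ i j * (jacobian τ x a i * jacobian τ x b j)) •
        B (EuclideanSpace.single a 1) (EuclideanSpace.single b 1) :=
        Finset.sum_congr rfl fun a _ => Finset.sum_congr rfl fun i _ => Finset.sum_comm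
    _ = _ := Finset.sum_congr rfl fun a _ => Finset.sum_comm

end IsReparam

end CoordChange

/-! ### Maps in charts -/

section Charts

variable {k n : ℕ} [NeZero k] {M : Type*} [TopologicalSpace M]
  [ChartedSpace (EuclideanHalfSpace k) M]

theorem target_subset_halfSpace (c : M) : (extChartAt (𝓡∂ k) c).target ⊆ halfSpace k :=
  extChartAt_target_subset_range c

theorem target_mem_nhdsWithin {c : M} {x : E k} (hx : x ∈ (extChartAt (𝓡∂ k) c).target) :
    (extChartAt (𝓡∂ k) c).target ∈ 𝓝[halfSpace k] x :=
  extChartAt_target_mem_nhdsWithin_of_mem hx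

theorem exists_isOpen_target_eq (c : M) :
    ∃ O : Set (E k), IsOpen O ∧ (extChartAt (𝓡∂ k) c).target = halfSpace k ∩ O := by
  refine ⟨(𝓡∂ k).symm ⁻¹' (chartAt _ c).target,
    (chartAt _ c).open_target.preimage (𝓡∂ k).continuous_symm, ?_⟩
  rw [extChartAt_target, inter_comm]

theorem inChart_apply {X : Type*} (f : M → X) (c : M) (x : E k) :
    inChart f c x = f ((extChartAt (𝓡∂ k) c).symm x) := rfl

theorem inChart_center {X : Type*} (f : M → X) (p : M) :
    inChart f p (extChartAt (𝓡∂ k) p p) = f p := by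
  rw [inChart_apply, extChartAt_to_inv]

section

variable {F : Type*} [NormedAddCommGroup F] [NormedSpace ℝ F]

theorem fderivWithin_inChart_center {f : M → F} {p : M}
    (hf : MDifferentiableAt (𝓡∂ k) 𝓘(ℝ, F) f p) :
    fderivWithin ℝ (inChart f p) (halfSpace k) (extChartAt (𝓡∂ k) p p) =
      (mfderiv (𝓡∂ k) 𝓘(ℝ, F) f p : E k →L[ℝ] F) := by
  unfold mfderiv
  exact (if_pos hf).symm

/-- The change of coordinates from the chart at `c` to the chart at `d`. -/
def transition (c d : M) : E k → E k := extChartAt (𝓡∂ k) d ∘ (extChartAt (𝓡∂ k) c).symm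

theorem transition_mem_target {c d : M} {x : E k}
    (hd : (extChartAt (𝓡∂ k) c).symm x ∈ (extChartAt (𝓡∂ k) d).source) :
    transition c d x ∈ (extChartAt (𝓡∂ k) d).target :=
  (extChartAt (𝓡∂ k) d).map_source hd

theorem symm_transition {c d : M} {x : E k}
    (hd : (extChartAt (𝓡∂ k) c).symm x ∈ (extChartAt (𝓡∂ k) d).source) :
    (extChartAt (𝓡∂ k) d).symm (transition c d x) = (extChartAt (𝓡∂ k) c).symm x :=
  (extChartAt (𝓡∂ k) d).left_inv hd

theorem inChart_eventuallyEq {X : Type*} (f : M → X) {c d : M} {x : E k}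
    (hx : x ∈ (extChartAt (𝓡∂ k) c).target)
    (hd : (extChartAt (𝓡∂ k) c).symm x ∈ (extChartAt (𝓡∂ k) d).source) :
    inChart f c =ᶠ[𝓝[halfSpace k] x] inChart f d ∘ transition c d := by
  have h1 : ContinuousWithinAt (extChartAt (𝓡∂ k) c).symm (halfSpace k) x :=
    ((continuousOn_extChartAt_symm c) x hx).mono_of_mem_nhdsWithin (target_mem_nhdsWithin hx)
  filter_upwards [h1.eventually ((isOpen_extChartAt_source d).mem_nhds hd)] with z hz
  rw [Function.comp_apply, inChart_apply, inChart_apply, symm_transition hz]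

variable [IsManifold (𝓡∂ k) ∞ M]

theorem contDiffWithinAt_inChart {f : M → F} (hf : ContMDiff (𝓡∂ k) 𝓘(ℝ, F) ∞ f) {c : M} {x : E k}
    (hx : x ∈ (extChartAt (𝓡∂ k) c).target) :
    ContDiffWithinAt ℝ ∞ (inChart f c) (halfSpace k) x :=
  ((hf.comp_contMDiffOn (contMDiffOn_extChartAt_symm c)).contDiffOn x hx).mono_of_mem_nhdsWithin
    (target_mem_nhdsWithin hx)

/-- Invertibility is known for the derivative within the overlap of the two charts; unique
differentiability there identifies it with the derivative within the half-space. -/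
theorem isReparam_transition {c d : M} {x : E k} (hx : x ∈ (extChartAt (𝓡∂ k) c).target)
    (hd : (extChartAt (𝓡∂ k) c).symm x ∈ (extChartAt (𝓡∂ k) d).source) :
    IsReparam (transition c d) x := by
  have hx' : x ∈ ((𝓡∂ k).extendCoordChange (chartAt (EuclideanHalfSpace k) c)
      (chartAt (EuclideanHalfSpace k) d)).source := by
    change x ∈ ((extChartAt (𝓡∂ k) c).symm.trans (extChartAt (𝓡∂ k) d)).source
    rw [PartialEquiv.trans_source]
    exact ⟨hx, hd⟩
  refine ⟨target_subset_halfSpace c hx, contDiffWithinAt_ext_coord_change d c hx',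
    Eventually.of_forall fun z => mem_range_self _, ?_⟩
  have hinv := ModelWithCorners.isInvertible_fderivWithin_extendCoordChange (I := 𝓡∂ k)
    (n := ∞) (by simp) (IsManifold.chart_mem_maximalAtlas c) (IsManifold.chart_mem_maximalAtlas d)
    hx'
  have hs : ((𝓡∂ k).extendCoordChange (chartAt (EuclideanHalfSpace k) c)
      (chartAt (EuclideanHalfSpace k) d)).source ⊆ halfSpace k := fun z hz =>
    target_subset_halfSpace c hz.1
  have hsm : ContDiffWithinAt ℝ ∞ (transition c d) (halfSpace k) x :=
    contDiffWithinAt_ext_coord_change d c hx'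
  obtain ⟨e, he⟩ := hinv
  have : fderivWithin ℝ (transition c d) (halfSpace k) x = e := by
    rw [he]
    exact (fderivWithin_subset hs (ModelWithCorners.uniqueDiffOn_extendCoordChange_source x hx')
      (hsm.differentiableWithinAt (by simp))).symm
  rw [this]
  exact (LinearEquiv.isUnit_det' e.toLinearEquiv).ne_zero

variable {φ : M → E n}

/-- The differential at q is expressed in the preferred chart at q, whereas integrals use a fixed
chart c. Here and below the two are compared through the transition from c to the chart centred at
q. -/
theorem range_differential (hφ : ContMDiff (𝓡∂ k) 𝓘(ℝ, E n) ∞ φ) {c : M} {x : E k}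
    (hx : x ∈ (extChartAt (𝓡∂ k) c).target) :
    tangentAt (inChart φ c) x = tangentPlane k φ ((extChartAt (𝓡∂ k) c).symm x) := by
  set q := (extChartAt (𝓡∂ k) c).symm x with hq
  have hd := mem_extChartAt_source (I := 𝓡∂ k) q
  have ht := transition_mem_target (c := c) (x := x) hd
  rw [(isReparam_transition hx hd).tangentAt_eq (inChart_eventuallyEq φ hx hd)
    ((contDiffWithinAt_inChart hφ ht).differentiableWithinAt (by simp))]
  rw [tangentAt, tangentPlane, differential,
    ← fderivWithin_inChart_center ((hφ q).mdifferentiableAt (by simp))]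
  rfl

theorem det_gramOf_ne_zero (hφ : IsSmoothImmersion k φ) {c : M} {x : E k}
    (hx : x ∈ (extChartAt (𝓡∂ k) c).target) : (gramOf (inChart φ c) x).det ≠ 0 := by
  set q := (extChartAt (𝓡∂ k) c).symm x with hq
  have hd := mem_extChartAt_source (I := 𝓡∂ k) q
  have ht := transition_mem_target (c := c) (x := x) hd
  have hr := isReparam_transition hx hd
  rw [hr.gramOf_eq (inChart_eventuallyEq φ hx hd)
    ((contDiffWithinAt_inChart hφ.1 ht).differentiableWithinAt (by simp)),
    Matrix.det_mul, Matrix.det_mul, Matrix.det_transpose]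
  refine mul_ne_zero (mul_ne_zero hr.det_jacobian_ne_zero ?_) hr.det_jacobian_ne_zero
  rw [det_gramOf_ne_zero_iff]
  have := hφ.2 q
  rwa [differential, ← fderivWithin_inChart_center ((hφ.1 q).mdifferentiableAt (by simp))] at this

/-- The differential is injective at points where the Gram determinant does not vanish. -/
theorem injective_differential_of_det_ne_zero (hφ : ContMDiff (𝓡∂ k) 𝓘(ℝ, E n) ∞ φ) {c : M}
    {x : E k} (hx : x ∈ (extChartAt (𝓡∂ k) c).target) (h : (gramOf (inChart φ c) x).det ≠ 0) :
    Function.Injective (differential k φ ((extChartAt (𝓡∂ k) c).symm x)) := by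
  set q := (extChartAt (𝓡∂ k) c).symm x with hq
  have hd := mem_extChartAt_source (I := 𝓡∂ k) q
  have ht := transition_mem_target (c := c) (x := x) hd
  have hr := isReparam_transition hx hd
  rw [hr.gramOf_eq (inChart_eventuallyEq φ hx hd)
    ((contDiffWithinAt_inChart hφ ht).differentiableWithinAt (by simp)),
    Matrix.det_mul, Matrix.det_mul, Matrix.det_transpose] at h
  have := det_gramOf_ne_zero_iff.1 (right_ne_zero_of_mul (left_ne_zero_of_mul h))
  rwa [differential, ← fderivWithin_inChart_center ((hφ q).mdifferentiableAt (by simp))]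

theorem meanCurvature_center (hφ : ContMDiff (𝓡∂ k) 𝓘(ℝ, E n) ∞ φ) (p : M) :
    meanCurvature k φ p = meanCurvatureOf (inChart φ p) (extChartAt (𝓡∂ k) p p) := by
  have h := range_differential hφ (mem_extChartAt_target (I := 𝓡∂ k) p)
  rw [extChartAt_to_inv] at h
  simp only [meanCurvature, meanCurvatureOf, secondFundamentalForm, normalPart, h]
  rfl

/-- The mean curvature vector may be computed in any chart. -/
theorem meanCurvatureOf_inChart (hφ : ContMDiff (𝓡∂ k) 𝓘(ℝ, E n) ∞ φ) {c : M} {x : E k}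
    (hx : x ∈ (extChartAt (𝓡∂ k) c).target) :
    meanCurvatureOf (inChart φ c) x = meanCurvature k φ ((extChartAt (𝓡∂ k) c).symm x) := by
  set q := (extChartAt (𝓡∂ k) c).symm x with hq
  have hd := mem_extChartAt_source (I := 𝓡∂ k) q
  rw [(isReparam_transition hx hd).meanCurvatureOf_eq (inChart_eventuallyEq φ hx hd)
    (contDiffWithinAt_inChart hφ (transition_mem_target hd)), meanCurvature_center hφ]
  rfl

/-- The bridge between the Euler-Lagrange expression in an arbitrary chart and the mean curvature
vector, which is defined pointwise in varying charts. -/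
theorem lapDensity_inChart (hφ : IsSmoothImmersion k φ) {c : M} {x : E k}
    (hx : x ∈ (extChartAt (𝓡∂ k) c).target) :
    lapDensity (inChart φ c) x = density (inChart φ c) x •
      meanCurvature k φ ((extChartAt (𝓡∂ k) c).symm x) := by
  rw [lapDensity_eq (contDiffWithinAt_inChart hφ.1 hx) (target_subset_halfSpace c hx)
    (det_gramOf_ne_zero hφ hx), meanCurvatureOf_inChart hφ.1 hx]

/-- The Laplacian of the coordinate functions is the mean curvature vector. -/
theorem laplacian_coordinate (hφ : IsSmoothImmersion k φ) (i : Fin n) (p : M) :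
    laplacian k φ (fun q => φ q i) p = meanCurvature k φ p i := by
  set x := extChartAt (𝓡∂ k) p p with hx
  have hxt := mem_extChartAt_target (I := 𝓡∂ k) p
  have hxS := target_subset_halfSpace p hxt
  have hψ := contDiffWithinAt_inChart hφ.1 hxt
  have hdet := det_gramOf_ne_zero hφ hxt
  have hL := congrArg (fun v : E n => v i) (lapDensity_inChart hφ hxt)
  rw [extChartAt_to_inv] at hL
  have hpos := density_pos hdet
  have hds := (contDiffWithinAt_density hψ hxS hdet).differentiableWithinAt (by simp)
  have hdi := fun a b => (contDiffWithinAt_inv (contDiffWithinAt_gramOf hψ hxS) hdet a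
    b).differentiableWithinAt (show (∞ : ℕ∞ω) ≠ 0 by simp)
  have hd : ∀ a, DifferentiableWithinAt ℝ (dirDeriv a (inChart φ p)) (halfSpace k) x := fun a =>
    (contDiffWithinAt_dirDeriv hψ hxS a).differentiableWithinAt (by simp)
  let π : E n →L[ℝ] ℝ := EuclideanSpace.proj i
  -- Taking the i-th coordinate is linear and continuous, so it commutes with both partial
  -- derivatives. The inner commutation is available only on the chart target, which is a
  -- neighbourhood within the half-space.
  have key : ∀ a, π (dirDeriv a (flux (inChart φ p) a) x) = ∑ b, partialDeriv a
      (fun x => Real.sqrt (gram φ p x).det * (gram φ p x)⁻¹ a b *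
        partialDeriv b (inChart (fun q => φ q i) p) x) x := by
    intro a
    have e1 : flux (inChart φ p) a = fun z => ∑ b, (density (inChart φ p) z *
        (gramOf (inChart φ p) z)⁻¹ a b) • dirDeriv b (inChart φ p) z := by
      ext1 z
      rw [flux, Finset.smul_sum]
      simp_rw [smul_smul]
    have e2 : ∀ b, DifferentiableWithinAt ℝ (fun z => (density (inChart φ p) z *
        (gramOf (inChart φ p) z)⁻¹ a b) • dirDeriv b (inChart φ p) z) (halfSpace k) x :=
      fun b => (hds.mul (hdi a b)).smul (hd b)
    rw [e1, dirDeriv_sum (fun b _ => e2 b) hxS, map_sum]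
    refine Finset.sum_congr rfl fun b _ => ?_
    rw [← dirDeriv_clm π (e2 b) hxS]
    refine dirDeriv_congr ?_ hxS a
    filter_upwards [target_mem_nhdsWithin hxt] with z hz
    rw [map_smul, ← dirDeriv_clm π ((contDiffWithinAt_inChart hφ.1 hz).differentiableWithinAt
      (by simp)) (target_subset_halfSpace p hz)]
    rfl
  rw [laplacian, ← hx, ← Finset.sum_congr rfl fun a _ => key a, ← map_sum]
  change (density (inChart φ p) x)⁻¹ * (lapDensity (inChart φ p) x) i = _
  rw [hL]
  simp only [PiLp.smul_apply, smul_eq_mul]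
  rw [← mul_assoc, inv_mul_cancel₀ hpos.ne', one_mul]

/-- Being a boundary point can be tested in any chart of the atlas. The target is relatively open in
the half-space, so its points with x₀ > 0 are interior in ℝᵏ, while interior points of the
half-space have x₀ > 0. -/
theorem mem_boundary_iff {c : M} {x : E k} (hx : x ∈ (extChartAt (𝓡∂ k) c).target) :
    (extChartAt (𝓡∂ k) c).symm x ∈ (𝓡∂ k).boundary M ↔ x 0 = 0 := by
  have h := ModelWithCorners.isBoundaryPoint_iff_of_mem_atlas (I := 𝓡∂ k) (n := ∞)
    (x := (extChartAt (𝓡∂ k) c).symm x) (by simp) (chart_mem_atlas (EuclideanHalfSpace k) c)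
    (by rw [← extChartAt_source (𝓡∂ k)]; exact (extChartAt (𝓡∂ k) c).map_target hx)
  have e : ((chartAt (EuclideanHalfSpace k) c).extend (𝓡∂ k)) ((extChartAt (𝓡∂ k) c).symm x) = x :=
    (extChartAt (𝓡∂ k) c).right_inv hx
  rw [e] at h
  refine h.trans ?_
  change x ∈ frontier (extChartAt (𝓡∂ k) c).target ↔ _
  have h0 := mem_halfSpace.1 (target_subset_halfSpace c hx)
  rw [frontier, Set.mem_sdiff, and_iff_right (subset_closure hx)]
  constructor
  · intro hni
    by_contra hne
    refine hni (mem_interior_iff_mem_nhds.2 ?_)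
    have := target_mem_nhdsWithin hx
    rwa [nhdsWithin_eq_nhds.2 (halfSpace_mem_nhds (lt_of_le_of_ne h0 (Ne.symm hne)))] at this
  · intro h0 hi
    have := interior_mono (target_subset_halfSpace c) hi
    rw [interior_range_modelWithCornersEuclideanHalfSpace] at this
    exact (ne_of_gt this) h0

theorem center_zero_of_mem_boundary {p : M} (hp : p ∈ (𝓡∂ k).boundary M) :
    extChartAt (𝓡∂ k) p p 0 = 0 := by
  rw [← mem_boundary_iff (mem_extChartAt_target p), extChartAt_to_inv]
  exact hp

end

end Charts

/-! ### The conormal and the equivalence of the differential conditions -/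

section Conormal

variable {k n : ℕ} [NeZero k] {M : Type*} [TopologicalSpace M]
  [ChartedSpace (EuclideanHalfSpace k) M] {φ : M → E n} {p : M}

theorem differential_eq (hφ : ContMDiff (𝓡∂ k) 𝓘(ℝ, E n) ∞ φ) (p : M) :
    differential k φ p =
      fderivWithin ℝ (inChart φ p) (halfSpace k) (extChartAt (𝓡∂ k) p p) :=
  (fderivWithin_inChart_center ((hφ p).mdifferentiableAt (by simp))).symm

variable [IsManifold (𝓡∂ k) ∞ M]

/-- The conormal is -F⁰ normalized: by duality F⁰ is orthogonal to ∂ₗφ for l ≠ 0. -/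
theorem exists_isOutwardConormal (hφ : IsSmoothImmersion k φ) (p : M) :
    ∃ ν : E k, IsOutwardConormal k φ p ν := by
  set x := extChartAt (𝓡∂ k) p p with hx
  have hdet : (gramOf (inChart φ p) x).det ≠ 0 :=
    det_gramOf_ne_zero hφ (mem_extChartAt_target (I := 𝓡∂ k) p)
  have hpos := density_pos hdet
  obtain ⟨w, hw⟩ := flux_mem_tangentAt (ψ := inChart φ p) (x := x) 0
  have hin : ∀ v : E k, inner ℝ (flux (inChart φ p) 0 x)
      (fderivWithin ℝ (inChart φ p) (halfSpace k) x v) = v 0 * density (inChart φ p) x := by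
    intro v
    have := inner_flux_dirDeriv hdet (0 : Fin k)
    rw [clm_apply_eq_sum, inner_sum]
    simp_rw [inner_smul_right]
    refine (Finset.sum_congr rfl fun l _ => congrArg (v l * ·) (this l)).trans ?_
    simp
  have hw' : fderivWithin ℝ (inChart φ p) (halfSpace k) x w = flux (inChart φ p) 0 x := hw
  have hne : flux (inChart φ p) 0 x ≠ 0 := fun h0 => by
    have := inner_flux_dirDeriv hdet (0 : Fin k) 0
    rw [if_pos rfl, h0, inner_zero_left] at this
    exact hpos.ne this
  -- Pairing F⁰ with itself gives |F⁰|² = w₀ √(det g), so w points into Σ and -w points outward.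
  have hself := hin w
  rw [hw', real_inner_self_eq_norm_sq] at hself
  have hn : 0 < ‖flux (inChart φ p) 0 x‖ := norm_pos_iff.2 hne
  have hw0 : 0 < w 0 := by
    by_contra! hle
    have := mul_nonpos_of_nonpos_of_nonneg hle hpos.le
    have := pow_pos hn 2
    linarith
  refine ⟨-‖flux (inChart φ p) 0 x‖⁻¹ • w, ?_, fun v hv => ?_, ?_⟩
  · rw [inducedMetric, differential_eq hφ.1, ← hx, map_smul, hw', real_inner_smul_left,
      inner_smul_right, real_inner_self_eq_norm_sq]
    field_simp
  · rw [inducedMetric, differential_eq hφ.1, ← hx, map_smul, hw', real_inner_smul_left, hin, hv,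
      zero_mul, mul_zero]
  · simp only [PiLp.smul_apply, smul_eq_mul, neg_mul, Left.neg_neg_iff]
    positivity

/-- Tangent vectors orthogonal to the boundary directions form a line spanned by F⁰; the natural
boundary condition on the flux thereby becomes a condition on ν. -/
theorem IsOutwardConormal.exists_eq_smul_flux (hφ : IsSmoothImmersion k φ) {ν : E k}
    (hν : IsOutwardConormal k φ p ν) :
    ∃ a : ℝ, differential k φ p ν = a • flux (inChart φ p) 0 (extChartAt (𝓡∂ k) p p) := by
  have hdet := det_gramOf_ne_zero hφ (mem_extChartAt_target (I := 𝓡∂ k) p)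
  have hpos := density_pos hdet
  have h := density_smul_eq_flux hdet (v := differential k φ p ν)
    (by rw [differential_eq hφ.1]; exact ⟨ν, rfl⟩) (fun l hl => by
      have := hν.orthogonal (EuclideanSpace.single l 1) (by simp [Ne.symm hl])
      rw [inducedMetric, differential_eq hφ.1] at this
      rw [differential_eq hφ.1]
      exact this)
  refine ⟨(density (inChart φ p) (extChartAt (𝓡∂ k) p p))⁻¹ *
    inner ℝ (differential k φ p ν)
      (dirDeriv 0 (inChart φ p) (extChartAt (𝓡∂ k) p p)), ?_⟩
  rw [mul_smul, ← h, smul_smul, inv_mul_cancel₀ hpos.ne', one_smul]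

theorem hasFDerivWithinAt_inChart_center (hφ : ContMDiff (𝓡∂ k) 𝓘(ℝ, E n) ∞ φ) (p : M) :
    HasFDerivWithinAt (inChart φ p) (differential k φ p) (halfSpace k)
      (extChartAt (𝓡∂ k) p p) := by
  rw [differential_eq hφ]
  exact ((contDiffWithinAt_inChart hφ (mem_extChartAt_target p)).differentiableWithinAt
    (by simp)).hasFDerivWithinAt

theorem mfderiv_coordinate (hφ : ContMDiff (𝓡∂ k) 𝓘(ℝ, E n) ∞ φ) (p : M) (i : Fin n) (v : E k) :
    mfderiv (𝓡∂ k) 𝓘(ℝ, ℝ) (fun q => φ q i) p v = differential k φ p v i := by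
  have hπ : ContMDiff (𝓡∂ k) 𝓘(ℝ, ℝ) ∞ (fun q => φ q i) :=
    (EuclideanSpace.proj i : E n →L[ℝ] ℝ).contDiff.contMDiff.comp hφ
  have h1 := fderivWithin_inChart_center ((hπ p).mdifferentiableAt (by simp))
  have h2 := ((EuclideanSpace.proj i : E n →L[ℝ] ℝ).hasFDerivAt.comp_hasFDerivWithinAt _
    (hasFDerivWithinAt_inChart_center hφ p)).fderivWithin
      (uniqueDiffOn_halfSpace _ (target_subset_halfSpace p (mem_extChartAt_target p)))
  exact (congrArg (fun L : E k →L[ℝ] ℝ => L v) (h1.symm.trans h2) :)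

/-- The conormal of a map into the ball points out of the ball. -/
theorem IsOutwardConormal.inner_nonneg (hφ : ContMDiff (𝓡∂ k) 𝓘(ℝ, E n) ∞ φ)
    (hball : ∀ q, φ q ∈ closedBall (0 : E n) 1) (hp : ‖φ p‖ = 1) {ν : E k}
    (hν : IsOutwardConormal k φ p ν) : 0 ≤ inner ℝ (differential k φ p ν) (φ p) := by
  set x := extChartAt (𝓡∂ k) p p with hx
  have hD := (hasFDerivWithinAt_inChart_center hφ p).norm_sq
  have hxS : x ∈ halfSpace k := target_subset_halfSpace p (mem_extChartAt_target p)
  have hmax : IsLocalMaxOn (fun z => ‖inChart φ p z‖ ^ 2) (halfSpace k) x := by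
    refine Eventually.of_forall fun z => ?_
    change ‖inChart φ p z‖ ^ 2 ≤ ‖inChart φ p x‖ ^ 2
    rw [hx, inChart_center, hp]
    have : ‖inChart φ p z‖ ≤ 1 := mem_closedBall_zero_iff.1 (hball _)
    gcongr
  -- The direction -ν points into the half-space, and |φ|² has its maximum 1 at p, so its derivative
  -- along -ν is nonpositive.
  have hcone : -ν ∈ posTangentConeAt (halfSpace k) x := by
    refine mem_posTangentConeAt_of_segment_subset ?_
    refine (((𝓡∂ k).convex_range).segment_subset hxS ?_)
    rw [mem_halfSpace] at hxS ⊢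
    have := hν.outward
    simp only [PiLp.add_apply, PiLp.neg_apply]
    linarith
  have := hmax.hasFDerivWithinAt_nonpos hD hcone
  rw [inChart_center] at this
  simp only [map_neg] at this
  have h2 : 0 ≤ 2 * inner ℝ (φ p) (differential k φ p ν) := by
    have h3 : (2 • (innerSL ℝ (φ p)).comp (differential k φ p)) ν =
        2 * inner ℝ (φ p) (differential k φ p ν) := by simp
    linarith [h3]
  rw [real_inner_comm]
  linarith

theorem isFreeBoundaryMinimal_iff_coordinatesHarmonicRobin (hφ : IsSmoothImmersion k φ)
    (hball : ∀ p, φ p ∈ closedBall (0 : E n) 1)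
    (hsphere : ∀ p ∈ (𝓡∂ k).boundary M, φ p ∈ sphere (0 : E n) 1) :
    IsFreeBoundaryMinimal k φ ↔ CoordinatesHarmonicRobin k φ := by
  constructor
  · rintro ⟨hH, ho⟩
    refine ⟨fun i p => by rw [laplacian_coordinate hφ, hH]; rfl, fun i p hp ν hν => ?_⟩
    rw [mfderiv_coordinate hφ.1]
    have hn : ‖φ p‖ = 1 := mem_sphere_zero_iff_norm.1 (hsphere p hp)
    have h0 := hν.inner_nonneg hφ.1 hball hn
    set d := differential k φ p ν with hd
    set c := inner ℝ d (φ p) with hc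
    -- The component of d tangent to the sphere is an admissible test vector and gives 1 - c² = 0.
    -- Since c ≥ 0, c = 1, and two unit vectors with inner product 1 coincide.
    have hw := ho p hp ν hν (d - c • φ p) (by
      rw [inner_sub_right, inner_smul_right, real_inner_self_eq_norm_sq, hn, real_inner_comm]
      ring)
    rw [inner_sub_right, inner_smul_right, ← hd, ← hc] at hw
    have hu : inner ℝ d d = 1 := hν.unit
    have hc1 : c = 1 := by nlinarith
    have : ‖d - φ p‖ ^ 2 = 0 := by
      rw [← real_inner_self_eq_norm_sq, inner_sub_left, inner_sub_right, inner_sub_right, hu,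
        real_inner_comm d (φ p), ← hc, hc1, real_inner_self_eq_norm_sq, hn]
      ring
    rw [sub_eq_zero.1 (norm_eq_zero.1 (pow_eq_zero_iff two_ne_zero |>.1 this))]
  · rintro ⟨hH, hr⟩
    refine ⟨fun p => ?_, fun p hp ν hν w hw => ?_⟩
    · ext i
      rw [← laplacian_coordinate hφ, hH]
      rfl
    · have : differential k φ p ν = φ p := by
        ext i
        rw [← mfderiv_coordinate hφ.1, hr i p hp ν hν]
      rw [this, hw]

end Conormal

/-! ### Integration of the divergence of a vector field along an immersion -/

section Integration

variable {k n : ℕ} [NeZero k] {M : Type*} [TopologicalSpace M]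
  [ChartedSpace (EuclideanHalfSpace k) M]

theorem measurableSet_target (c : M) : MeasurableSet (extChartAt (𝓡∂ k) c).target := by
  obtain ⟨O, hO, h⟩ := exists_isOpen_target_eq (k := k) c
  rw [h]
  exact isClosed_halfSpace.measurableSet.inter hO.measurableSet

/-- The divergence density, in the chart at `c`, of a vector field `Y` along `φ`. -/
def chartDiv (φ Y : M → E n) (c : M) (x : E k) : ℝ := divDensity (inChart φ c) (inChart Y c) x

theorem inChart_eventuallyEq_zero {F : Type*} [Zero F] {Y : M → F} {K : Set M} (hK : IsClosed K)
    (hY : ∀ q ∉ K, Y q = 0) {c : M} {x : E k} (hx : x ∈ (extChartAt (𝓡∂ k) c).target)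
    (hxK : (extChartAt (𝓡∂ k) c).symm x ∉ K) :
    inChart Y c =ᶠ[𝓝[halfSpace k] x] fun _ => 0 := by
  have h1 : ContinuousWithinAt (extChartAt (𝓡∂ k) c).symm (halfSpace k) x :=
    ((continuousOn_extChartAt_symm c) x hx).mono_of_mem_nhdsWithin (target_mem_nhdsWithin hx)
  filter_upwards [h1.eventually (hK.isOpen_compl.mem_nhds hxK)] with z hz using hY _ hz

theorem chartDiv_eq_zero {φ Y : M → E n} {K : Set M} (hK : IsClosed K)
    (hY : ∀ q ∉ K, Y q = 0) {c : M} {x : E k} (hx : x ∈ (extChartAt (𝓡∂ k) c).target)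
    (hxK : (extChartAt (𝓡∂ k) c).symm x ∉ K) : chartDiv φ Y c x = 0 := by
  rw [chartDiv, divDensity_congr (inChart_eventuallyEq_zero hK hY hx hxK)
    (target_subset_halfSpace c hx)]
  simp [divDensity, dirDeriv]

/-- The image in a chart of a compact subset of its domain. -/
theorem isCompact_image_chart {c : M} {K : Set M} (hK : IsCompact K)
    (hKc : K ⊆ (extChartAt (𝓡∂ k) c).source) : IsCompact (extChartAt (𝓡∂ k) c '' K) :=
  hK.image_of_continuousOn ((continuousOn_extChartAt c).mono hKc)

theorem image_chart_subset_target {c : M} {K : Set M} (hKc : K ⊆ (extChartAt (𝓡∂ k) c).source) :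
    extChartAt (𝓡∂ k) c '' K ⊆ (extChartAt (𝓡∂ k) c).target :=
  image_subset_iff.2 fun _ hq => (extChartAt (𝓡∂ k) c).map_source (hKc hq)

theorem symm_notMem_of_notMem_image {c : M} {K : Set M} {x : E k}
    (hx : x ∈ (extChartAt (𝓡∂ k) c).target) (h : x ∉ extChartAt (𝓡∂ k) c '' K) :
    (extChartAt (𝓡∂ k) c).symm x ∉ K := fun hK =>
  h ⟨_, hK, (extChartAt (𝓡∂ k) c).right_inv hx⟩

theorem integrableOn_target {c : M} {f : E k → ℝ}
    (hf : ContinuousOn f (extChartAt (𝓡∂ k) c).target) {K : Set M} (hK : IsCompact K)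
    (hKc : K ⊆ (extChartAt (𝓡∂ k) c).source)
    (h0 : ∀ x ∈ (extChartAt (𝓡∂ k) c).target, (extChartAt (𝓡∂ k) c).symm x ∉ K → f x = 0) :
    IntegrableOn f (extChartAt (𝓡∂ k) c).target := by
  have hQ := isCompact_image_chart hK hKc
  have h1 := (hf.mono (image_chart_subset_target hKc)).integrableOn_compact (μ := volume) hQ
  exact h1.of_forall_sdiff_eq_zero (measurableSet_target c)
    fun x hx => h0 x hx.1 (symm_notMem_of_notMem_image hx.1 hx.2)

theorem measurableSet_overlap (c d : M) : MeasurableSet ((extChartAt (𝓡∂ k) c).target ∩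
    (extChartAt (𝓡∂ k) c).symm ⁻¹' (extChartAt (𝓡∂ k) d).source) := by
  obtain ⟨u, hu, h⟩ := continuousOn_iff'.1 (continuousOn_extChartAt_symm (I := 𝓡∂ k) c) _
    (isOpen_extChartAt_source (I := 𝓡∂ k) d)
  rw [inter_comm, h]
  exact hu.measurableSet.inter (measurableSet_target c)

/-- The components, in the chart at `c`, of the flux of the vector field `Y`, extended by zero. -/
def chartFlux (φ Y : M → E n) (c : M) (i : Fin k) : E k → ℝ :=
  (extChartAt (𝓡∂ k) c).target.indicator
    fun z => inner ℝ (flux (inChart φ c) i z) (inChart Y c z)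

theorem chartFlux_eq_zero {φ Y : M → E n} {c : M} {K : Set M} (hYK : ∀ q ∉ K, Y q = 0)
    (i : Fin k) {x : E k}
    (hx : x ∉ extChartAt (𝓡∂ k) c '' K) : chartFlux φ Y c i x = 0 := by
  rw [chartFlux]
  by_cases h : x ∈ (extChartAt (𝓡∂ k) c).target
  · rw [indicator_of_mem h, inChart_apply, hYK _ (symm_notMem_of_notMem_image h hx),
      inner_zero_right]
  · rw [indicator_of_notMem h]

variable [IsManifold (𝓡∂ k) ∞ M] {φ Y : M → E n}

theorem continuousOn_chartDiv (hφ : IsSmoothImmersion k φ)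
    (hY : ContMDiff (𝓡∂ k) 𝓘(ℝ, E n) ∞ Y) (c : M) :
    ContinuousOn (chartDiv φ Y c) (extChartAt (𝓡∂ k) c).target := fun _ hx =>
  ((contDiffWithinAt_divDensity (contDiffWithinAt_inChart hφ.1 hx) (target_subset_halfSpace c hx)
    (det_gramOf_ne_zero hφ hx) (contDiffWithinAt_inChart hY hx)).continuousWithinAt).mono
    (target_subset_halfSpace c)

theorem chartDiv_transition (hφ : IsSmoothImmersion k φ)
    (hY : ContMDiff (𝓡∂ k) 𝓘(ℝ, E n) ∞ Y) {c d : M} {x : E k}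
    (hx : x ∈ (extChartAt (𝓡∂ k) c).target)
    (hd : (extChartAt (𝓡∂ k) c).symm x ∈ (extChartAt (𝓡∂ k) d).source) :
    chartDiv φ Y c x = |(fderivWithin ℝ (transition c d) (halfSpace k) x).det| *
      chartDiv φ Y d (transition c d x) :=
  (isReparam_transition hx hd).divDensity_eq (inChart_eventuallyEq φ hx hd)
    ((contDiffWithinAt_inChart hφ.1 (transition_mem_target hd)).differentiableWithinAt (by simp))
    (inChart_eventuallyEq Y hx hd)
    ((contDiffWithinAt_inChart hY (transition_mem_target hd)).differentiableWithinAt (by simp))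

/-- Change of variables between two charts. -/
theorem integral_chartDiv_eq (hφ : IsSmoothImmersion k φ) (hY : ContMDiff (𝓡∂ k) 𝓘(ℝ, E n) ∞ Y)
    {c d : M} {K : Set M} (hK : IsClosed K) (hKd : K ⊆ (extChartAt (𝓡∂ k) d).source)
    (hYK : ∀ q ∉ K, Y q = 0) {ρ : M → ℝ} (hρ : ∀ q ∉ (extChartAt (𝓡∂ k) c).source, ρ q = 0) :
    ∫ x in (extChartAt (𝓡∂ k) c).target, inChart ρ c x * chartDiv φ Y c x =
      ∫ x in (extChartAt (𝓡∂ k) d).target, inChart ρ d x * chartDiv φ Y d x := by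
  set A := (extChartAt (𝓡∂ k) c).target ∩
    (extChartAt (𝓡∂ k) c).symm ⁻¹' (extChartAt (𝓡∂ k) d).source with hA
  set B := (extChartAt (𝓡∂ k) d).target ∩
    (extChartAt (𝓡∂ k) d).symm ⁻¹' (extChartAt (𝓡∂ k) c).source with hB
  have hAB : transition c d '' A = B := by
    ext z
    constructor
    · rintro ⟨x, ⟨hx, hxd⟩, rfl⟩
      refine ⟨transition_mem_target hxd, ?_⟩
      rw [mem_preimage, symm_transition hxd]
      exact (extChartAt (𝓡∂ k) c).map_target hx
    · rintro ⟨hz, hzc⟩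
      refine ⟨transition d c z, ⟨transition_mem_target hzc, ?_⟩, ?_⟩
      · rw [mem_preimage, symm_transition hzc]
        exact (extChartAt (𝓡∂ k) d).map_target hz
      · rw [transition, Function.comp_apply, symm_transition hzc,
          (extChartAt (𝓡∂ k) d).right_inv hz]
  -- Both integrals live on the overlap of the charts, for different reasons: in the chart at c the
  -- field vanishes off the domain of d, and in the chart at d the weight ρ vanishes off the domain
  -- of c.
  have h1 : ∫ x in (extChartAt (𝓡∂ k) c).target, inChart ρ c x * chartDiv φ Y c x =
      ∫ x in A, inChart ρ c x * chartDiv φ Y c x := by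
    refine setIntegral_eq_of_subset_of_forall_sdiff_eq_zero (measurableSet_target c)
      inter_subset_left fun x hx => ?_
    rw [chartDiv_eq_zero hK hYK hx.1 fun h => hx.2 ⟨hx.1, hKd h⟩, mul_zero]
  have h2 : ∫ x in (extChartAt (𝓡∂ k) d).target, inChart ρ d x * chartDiv φ Y d x =
      ∫ x in B, inChart ρ d x * chartDiv φ Y d x := by
    refine setIntegral_eq_of_subset_of_forall_sdiff_eq_zero (measurableSet_target d)
      inter_subset_left fun x hx => ?_
    rw [inChart_apply, hρ _ fun h => hx.2 ⟨hx.1, h⟩, zero_mul]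
  rw [h1, h2, ← hAB, integral_image_eq_integral_abs_det_fderiv_smul volume
    (measurableSet_overlap c d) (f' := fderivWithin ℝ (transition c d) (halfSpace k))]
  · refine setIntegral_congr_fun (measurableSet_overlap c d) fun x hx => ?_
    rw [chartDiv_transition hφ hY hx.1 hx.2, inChart_apply, inChart_apply, symm_transition hx.2,
      smul_eq_mul]
    ring
  · intro x hx
    exact (((isReparam_transition hx.1 hx.2).smooth.differentiableWithinAt
      (by simp)).hasFDerivWithinAt).mono (inter_subset_left.trans (target_subset_halfSpace c))
  · intro x hx z hz hxz
    have := congrArg (extChartAt (𝓡∂ k) d).symm hxz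
    rw [symm_transition hx.2, symm_transition hz.2] at this
    exact (extChartAt (𝓡∂ k) c).symm.injOn hx.1 hz.1 this

/-! ### Localization by the partition of unity -/

section PartitionOfUnity

variable [T2Space M] [SigmaCompactSpace M]

theorem partition_eq_zero {c q : M} (hq : q ∉ (extChartAt (𝓡∂ k) c).source) :
    partition k M c q = 0 := by
  rw [extChartAt_source] at hq
  by_contra h
  exact hq (partition_isSubordinate c (subset_tsupport _ h))

variable (k) in
theorem exists_finset_partition {K : Set M} (hK : IsCompact K) :
    ∃ s : Finset M, ∀ c ∉ s, ∀ q ∈ K, partition k M c q = 0 := by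
  have h := (partition k M).locallyFinite.finite_nonempty_inter_compact hK
  refine ⟨h.toFinset, fun c hc q hq => ?_⟩
  by_contra hne
  exact hc (h.mem_toFinset.2 ⟨q, hne, hq⟩)

theorem sum_partition_eq_one {s : Finset M} {q : M} (hs : ∀ c ∉ s, partition k M c q = 0) :
    ∑ c ∈ s, partition k M c q = 1 := by
  rw [← (partition k M).sum_eq_one (mem_univ q)]
  refine (finsum_eq_sum_of_support_subset _ fun c hc => ?_).symm
  by_contra h
  exact hc (hs c h)

theorem continuousOn_inChart_partition (c d : M) :
    ContinuousOn (inChart (partition k M c) d) (extChartAt (𝓡∂ k) d).target :=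
  (partition k M c).contMDiff.continuous.comp_continuousOn (continuousOn_extChartAt_symm d)

/-- For a field supported in one chart domain, every term can be moved to that chart, where the
weights add up to 1 on the support. -/
theorem sum_integral_chartDiv (hφ : IsSmoothImmersion k φ)
    (hY : ContMDiff (𝓡∂ k) 𝓘(ℝ, E n) ∞ Y) {d : M} {K : Set M} (hK : IsCompact K)
    (hKd : K ⊆ (extChartAt (𝓡∂ k) d).source) (hYK : ∀ q ∉ K, Y q = 0) {s : Finset M}
    (hs : ∀ c ∉ s, ∀ q ∈ K, partition k M c q = 0) :
    ∑ c ∈ s, ∫ x in (extChartAt (𝓡∂ k) c).target,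
      inChart (partition k M c) c x * chartDiv φ Y c x =
      ∫ x in (extChartAt (𝓡∂ k) d).target, chartDiv φ Y d x := by
  rw [Finset.sum_congr rfl fun c _ => integral_chartDiv_eq hφ hY hK.isClosed hKd hYK
    fun q hq => partition_eq_zero hq, ← integral_finsetSum]
  · refine setIntegral_congr_fun (measurableSet_target d) fun x hx => ?_
    change ∑ c ∈ s, _ * _ = _
    rw [← Finset.sum_mul]
    by_cases hxK : (extChartAt (𝓡∂ k) d).symm x ∈ K
    · have := sum_partition_eq_one (k := k) (s := s) fun c hc => hs c hc _ hxK
      simp only [inChart_apply]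
      rw [this, one_mul]
    · rw [chartDiv_eq_zero hK.isClosed hYK hx hxK, mul_zero]
  · intro c _
    refine integrableOn_target (K := K) ((continuousOn_inChart_partition c d).mul
      (continuousOn_chartDiv hφ hY d)) hK hKd fun x hx hxK => ?_
    rw [chartDiv_eq_zero hK.isClosed hYK hx hxK, mul_zero]

theorem contMDiff_partition_smul (hY : ContMDiff (𝓡∂ k) 𝓘(ℝ, E n) ∞ Y) (d : M) :
    ContMDiff (𝓡∂ k) 𝓘(ℝ, E n) ∞ (fun q => partition k M d q • Y q) :=
  (partition k M d).contMDiff.smul hY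

/-- Localization of the integral of the divergence to the domains of the charts. -/
theorem sum_integral_chartDiv_eq_sum (hφ : IsSmoothImmersion k φ)
    (hY : ContMDiff (𝓡∂ k) 𝓘(ℝ, E n) ∞ Y) {K : Set M} (hK : IsCompact K)
    (hYK : ∀ q ∉ K, Y q = 0) {s : Finset M} (hs : ∀ c ∉ s, ∀ q ∈ K, partition k M c q = 0) :
    ∑ c ∈ s, ∫ x in (extChartAt (𝓡∂ k) c).target,
      inChart (partition k M c) c x * chartDiv φ Y c x =
      ∑ d ∈ s, ∫ x in (extChartAt (𝓡∂ k) d).target,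
        chartDiv φ (fun q => partition k M d q • Y q) d x := by
  have hKd : ∀ d, IsCompact (K ∩ tsupport (partition k M d)) := fun d =>
    hK.inter_right (isClosed_tsupport _)
  have hsub : ∀ d, K ∩ tsupport (partition k M d) ⊆ (extChartAt (𝓡∂ k) d).source := fun d => by
    rw [extChartAt_source]
    exact inter_subset_right.trans (partition_isSubordinate d)
  have hzero : ∀ d, ∀ q ∉ K ∩ tsupport (partition k M d), partition k M d q • Y q = 0 := by
    intro d q hq
    by_cases hqK : q ∈ K
    · rw [image_eq_zero_of_notMem_tsupport fun h => hq ⟨hqK, h⟩, zero_smul]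
    · rw [hYK q hqK, smul_zero]
  have hzeroK : ∀ d, ∀ q ∉ K, partition k M d q • Y q = 0 := fun d q hq =>
    hzero d q fun h => hq h.1
  -- Each localized field is spread back over all charts by `sum_integral_chartDiv`. After
  -- exchanging the sums, linearity of the divergence in Y = ∑ ρ_d Y closes the argument; no
  -- derivative of the weights has to be computed.
  rw [Finset.sum_congr rfl fun d _ => (sum_integral_chartDiv hφ (contMDiff_partition_smul hY d)
    (hKd d) (hsub d) (hzero d) fun c hc q hq => hs c hc q hq.1).symm, Finset.sum_comm]
  refine Finset.sum_congr rfl fun c _ => ?_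
  rw [← integral_finsetSum]
  · refine setIntegral_congr_fun (measurableSet_target c) fun x hx => ?_
    change _ * _ = ∑ d ∈ s, _ * _
    rw [← Finset.mul_sum]
    congr 1
    have hxS := target_subset_halfSpace c hx
    have e : inChart Y c = fun z => ∑ d ∈ s,
        inChart (k := k) (fun q => partition k M d q • Y q) c z := by
      ext1 z
      simp only [inChart_apply]
      rw [← Finset.sum_smul]
      by_cases hq : (extChartAt (𝓡∂ k) c).symm z ∈ K
      · rw [sum_partition_eq_one (k := k) fun c hc => hs c hc _ hq, one_smul]
      · rw [hYK _ hq, smul_zero]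
    simp only [chartDiv, divDensity]
    rw [Finset.sum_comm]
    refine Finset.sum_congr rfl fun i _ => ?_
    rw [e, dirDeriv_sum (fun d _ => (contDiffWithinAt_inChart (contMDiff_partition_smul hY d)
      hx).differentiableWithinAt (by simp)) hxS, inner_sum]
  · intro d _
    refine integrableOn_target ((continuousOn_inChart_partition c c).mul
      (continuousOn_chartDiv hφ (contMDiff_partition_smul hY d) c)) (hKd c) (hsub c)
      fun x hx hxK => ?_
    by_cases hq : (extChartAt (𝓡∂ k) c).symm x ∈ K
    · rw [inChart_apply, image_eq_zero_of_notMem_tsupport fun h => hxK ⟨hq, h⟩, zero_mul]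
    · rw [chartDiv_eq_zero hK.isClosed (hzeroK d) hx hq, mul_zero]

end PartitionOfUnity

/-! ### Integration by parts in a chart -/

variable {c : M} {K : Set M}

theorem continuousOn_inner_lapDensity (hφ : IsSmoothImmersion k φ)
    (hY : ContMDiff (𝓡∂ k) 𝓘(ℝ, E n) ∞ Y) :
    ContinuousOn (fun x => inner ℝ (lapDensity (inChart φ c) x) (inChart Y c x))
      (extChartAt (𝓡∂ k) c).target := fun _ hx =>
  (((contDiffWithinAt_lapDensity (contDiffWithinAt_inChart hφ.1 hx)
    (target_subset_halfSpace c hx) (det_gramOf_ne_zero hφ hx)).inner ℝ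
      (contDiffWithinAt_inChart hY hx)).continuousWithinAt).mono (target_subset_halfSpace c)

/-- The support is compact inside the chart target, hence closed in ℝᵏ, so extension by zero keeps
the regularity up to the boundary of the half-space. -/
theorem contDiffOn_chartFlux (hφ : IsSmoothImmersion k φ)
    (hY : ContMDiff (𝓡∂ k) 𝓘(ℝ, E n) ∞ Y) (hK : IsCompact K)
    (hKc : K ⊆ (extChartAt (𝓡∂ k) c).source) (hYK : ∀ q ∉ K, Y q = 0) (i : Fin k) :
    ContDiffOn ℝ 1 (chartFlux φ Y c i) (halfSpace k) := by
  intro x hxS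
  by_cases hx : x ∈ (extChartAt (𝓡∂ k) c).target
  · have h1 := (contDiffWithinAt_flux (contDiffWithinAt_inChart hφ.1 hx) hxS
      (det_gramOf_ne_zero hφ hx) i).inner ℝ (contDiffWithinAt_inChart hY hx)
    refine (h1.of_le (by simp)).congr_of_eventuallyEq ?_ (indicator_of_mem hx _)
    filter_upwards [target_mem_nhdsWithin hx] with z hz using indicator_of_mem hz _
  · have hQ := (isCompact_image_chart hK hKc).isClosed
    have hxQ : x ∉ extChartAt (𝓡∂ k) c '' K := fun h => hx (image_chart_subset_target hKc h)
    refine (contDiffWithinAt_const (c := (0 : ℝ))).congr_of_eventuallyEq ?_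
      (chartFlux_eq_zero hYK i hxQ)
    filter_upwards [mem_nhdsWithin_of_mem_nhds (hQ.isOpen_compl.mem_nhds hxQ)] with z hz
      using chartFlux_eq_zero hYK i hz

/-- The boundary term is kept as the integral of a total divergence, so that it may later be
evaluated as zero or given a strict sign. -/
theorem integral_chartDiv (hφ : IsSmoothImmersion k φ)
    (hY : ContMDiff (𝓡∂ k) 𝓘(ℝ, E n) ∞ Y) (hK : IsCompact K)
    (hKc : K ⊆ (extChartAt (𝓡∂ k) c).source) (hYK : ∀ q ∉ K, Y q = 0) :
    ∫ x in (extChartAt (𝓡∂ k) c).target, chartDiv φ Y c x =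
      (∫ x in halfSpace k, ∑ i, dirDeriv i (chartFlux φ Y c i) x) -
      ∫ x in (extChartAt (𝓡∂ k) c).target,
        inner ℝ (lapDensity (inChart φ c) x) (inChart Y c x) := by
  have hz : ∀ x ∈ halfSpace k, x ∉ extChartAt (𝓡∂ k) c '' K →
      ∑ i, dirDeriv i (chartFlux φ Y c i) x = 0 := fun x hxS hx =>
    Finset.sum_eq_zero fun i _ => dirDeriv_eq_zero_of_notMem
      (isCompact_image_chart hK hKc).isClosed (fun y _ hy => chartFlux_eq_zero hYK i hy) hxS hx i
  have h1 : ∫ x in halfSpace k, ∑ i, dirDeriv i (chartFlux φ Y c i) x =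
      ∫ x in (extChartAt (𝓡∂ k) c).target, ∑ i, dirDeriv i (chartFlux φ Y c i) x :=
    setIntegral_eq_of_subset_of_forall_sdiff_eq_zero isClosed_halfSpace.measurableSet
      (target_subset_halfSpace c) fun x hx => hz x hx.1 fun h =>
        hx.2 (image_chart_subset_target hKc h)
  rw [h1, ← integral_sub]
  · refine setIntegral_congr_fun (measurableSet_target c) fun x hx => ?_
    refine (divDensity_eq (contDiffWithinAt_inChart hφ.1 hx) (target_subset_halfSpace c hx)
      (det_gramOf_ne_zero hφ hx) (contDiffWithinAt_inChart hY hx)).trans ?_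
    congr 1
    refine Finset.sum_congr rfl fun i _ => dirDeriv_congr ?_ (target_subset_halfSpace c hx) i
    filter_upwards [target_mem_nhdsWithin hx] with z hz
    rw [chartFlux, indicator_of_mem hz]
  · refine integrableOn_target ?_ hK hKc fun x hx hxK => hz x (target_subset_halfSpace c hx) ?_
    · refine continuousOn_finsetSum _ fun i _ => ContinuousOn.mono ?_ (target_subset_halfSpace c)
      exact ((contDiffOn_chartFlux hφ hY hK hKc hYK i).continuousOn_fderivWithin
        uniqueDiffOn_halfSpace le_rfl).clm_apply continuousOn_const
    · rintro ⟨q, hq, rfl⟩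
      rw [(extChartAt (𝓡∂ k) c).left_inv (hKc hq)] at hxK
      exact hxK hq
  · refine integrableOn_target (continuousOn_inner_lapDensity hφ hY) hK hKc fun x hx hxK => ?_
    rw [inChart_apply Y, hYK _ hxK, inner_zero_right]

end Integration

/-! ### One-parameter families of maps of the half-space -/

section Family

variable {k n : ℕ} [NeZero k] {F : Type*} [NormedAddCommGroup F] [NormedSpace ℝ F]

/-- The domain `(-ε, ε) × {x ∈ ℝᵏ | 0 ≤ x₀}` of a one-parameter family. -/
def timeDomain (k : ℕ) [NeZero k] (ε : ℝ) : Set (ℝ × E k) := Ioo (-ε) ε ×ˢ halfSpace k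

theorem uniqueDiffOn_timeDomain (ε : ℝ) : UniqueDiffOn ℝ (timeDomain k ε) :=
  isOpen_Ioo.uniqueDiffOn.prod uniqueDiffOn_halfSpace

theorem timeDomain_subset_closure_interior (ε : ℝ) :
    timeDomain k ε ⊆ closure (interior (timeDomain k ε)) := by
  rw [timeDomain, interior_prod_eq, closure_prod_eq, isOpen_Ioo.interior_eq]
  exact prod_mono subset_closure subset_closure_interior_halfSpace

variable {ε t : ℝ} {x : E k} {Ψ : ℝ × E k → F}

theorem tendsto_slice (ht : t ∈ Ioo (-ε) ε) :
    Tendsto (fun z => (t, z)) (𝓝[halfSpace k] x) (𝓝[timeDomain k ε] (t, x)) := by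
  refine tendsto_nhdsWithin_iff.2 ⟨?_, ?_⟩
  · exact (Continuous.prodMk_right t).continuousWithinAt
  · filter_upwards [self_mem_nhdsWithin] with z hz using ⟨ht, hz⟩

theorem fderivWithin_slice (ht : t ∈ Ioo (-ε) ε) (hx : x ∈ halfSpace k)
    (hΨ : DifferentiableWithinAt ℝ Ψ (timeDomain k ε) (t, x)) (v : E k) :
    fderivWithin ℝ (fun z => Ψ (t, z)) (halfSpace k) x v =
      fderivWithin ℝ Ψ (timeDomain k ε) (t, x) (0, v) := by
  have h1 : HasFDerivWithinAt (fun z : E k => (t, z)) (ContinuousLinearMap.inr ℝ ℝ (E k))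
      (halfSpace k) x := hasFDerivAt_prodMk_right t x |>.hasFDerivWithinAt
  have h2 := hΨ.hasFDerivWithinAt.comp_of_tendsto x h1 (tendsto_slice ht)
  have h3 := h2.fderivWithin (uniqueDiffOn_halfSpace x hx)
  exact congrArg (fun L : E k →L[ℝ] F => L v) h3

theorem hasDerivAt_slice (ht : t ∈ Ioo (-ε) ε) (hx : x ∈ halfSpace k)
    (hΨ : DifferentiableWithinAt ℝ Ψ (timeDomain k ε) (t, x)) :
    HasDerivAt (fun r => Ψ (r, x)) (fderivWithin ℝ Ψ (timeDomain k ε) (t, x) (1, 0)) t := by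
  have h1 : HasFDerivWithinAt (fun r : ℝ => (r, x)) (ContinuousLinearMap.inl ℝ ℝ (E k))
      (Ioo (-ε) ε) t := hasFDerivAt_prodMk_left t x |>.hasFDerivWithinAt
  have hm : MapsTo (fun r : ℝ => (r, x)) (Ioo (-ε) ε) (timeDomain k ε) := fun r hr => ⟨hr, hx⟩
  have h2 := hΨ.hasFDerivWithinAt.comp t h1 hm
  exact (h2.hasFDerivAt (isOpen_Ioo.mem_nhds ht)).hasDerivAt

theorem contDiffWithinAt_fderivWithin_time (ht : t ∈ Ioo (-ε) ε) (hx : x ∈ halfSpace k)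
    (hΨ : ContDiffWithinAt ℝ ∞ Ψ (timeDomain k ε) (t, x)) (v : ℝ × E k) :
    ContDiffWithinAt ℝ ∞ (fun z => fderivWithin ℝ Ψ (timeDomain k ε) z v) (timeDomain k ε)
      (t, x) :=
  (hΨ.fderivWithin_right (uniqueDiffOn_timeDomain ε) (by simp) ⟨ht, hx⟩).clm_apply
    contDiffWithinAt_const

theorem ContDiffWithinAt.eventually_differentiableWithinAt {V : Type*} [NormedAddCommGroup V]
    [NormedSpace ℝ V] {s : Set V} {f : V → F} {z : V} (hf : ContDiffWithinAt ℝ ∞ f s z) :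
    ∀ᶠ y in 𝓝[s] z, DifferentiableWithinAt ℝ f s y := by
  filter_upwards [(hf.of_le (m := 1) (by simp)).eventually (by simp)
    |>.filter_mono (nhdsWithin_mono _ (subset_insert _ _))] with y hy
  exact hy.differentiableWithinAt one_ne_zero

theorem dirDeriv_slice_eventuallyEq (hΨ : ContDiffWithinAt ℝ ∞ Ψ (timeDomain k ε) (t, x))
    (i : Fin k) :
    (fun z : ℝ × E k => dirDeriv i (fun y => Ψ (z.1, y)) z.2) =ᶠ[𝓝[timeDomain k ε] (t, x)]
      fun z => fderivWithin ℝ Ψ (timeDomain k ε) z (0, EuclideanSpace.single i 1) := by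
  filter_upwards [ContDiffWithinAt.eventually_differentiableWithinAt hΨ, self_mem_nhdsWithin]
    with z hz hzU
  exact fderivWithin_slice hzU.1 hzU.2 hz _

theorem contDiffWithinAt_dirDeriv_slice (ht : t ∈ Ioo (-ε) ε) (hx : x ∈ halfSpace k)
    (hΨ : ContDiffWithinAt ℝ ∞ Ψ (timeDomain k ε) (t, x)) (i : Fin k) :
    ContDiffWithinAt ℝ ∞ (fun z : ℝ × E k => dirDeriv i (fun y => Ψ (z.1, y)) z.2)
      (timeDomain k ε) (t, x) :=
  (contDiffWithinAt_fderivWithin_time ht hx hΨ _).congr_of_eventuallyEq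
    (dirDeriv_slice_eventuallyEq hΨ i) (fderivWithin_slice ht hx
      (hΨ.differentiableWithinAt (by simp)) _)

/-- The velocity of a one-parameter family. -/
def velocityOf (ε t : ℝ) (Ψ : ℝ × E k → F) (x : E k) : F :=
  fderivWithin ℝ Ψ (timeDomain k ε) (t, x) (1, 0)

theorem contDiffWithinAt_velocityOf (ht : t ∈ Ioo (-ε) ε) (hx : x ∈ halfSpace k)
    (hΨ : ContDiffWithinAt ℝ ∞ Ψ (timeDomain k ε) (t, x)) :
    ContDiffWithinAt ℝ ∞ (velocityOf ε t Ψ) (halfSpace k) x :=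
  ContDiffWithinAt.comp x (contDiffWithinAt_fderivWithin_time ht hx hΨ (1, 0))
    (contDiff_prodMk_right t).contDiffWithinAt (fun _ hz => ⟨ht, hz⟩)

/-- The time derivative of the partial derivatives is given by the velocity. -/
theorem hasDerivAt_dirDeriv_slice (ht : t ∈ Ioo (-ε) ε) (hx : x ∈ halfSpace k)
    (hΨ : ContDiffWithinAt ℝ ∞ Ψ (timeDomain k ε) (t, x)) (i : Fin k) :
    HasDerivAt (fun r => dirDeriv i (fun y => Ψ (r, y)) x)
      (dirDeriv i (velocityOf ε t Ψ) x) t := by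
  have hU : (t, x) ∈ timeDomain k ε := ⟨ht, hx⟩
  have hD : DifferentiableWithinAt ℝ (fderivWithin ℝ Ψ (timeDomain k ε)) (timeDomain k ε) (t, x) :=
    (hΨ.fderivWithin_right (m := 1) (uniqueDiffOn_timeDomain ε)
      (by norm_cast) hU).differentiableWithinAt one_ne_zero
  have hsymm : IsSymmSndFDerivWithinAt ℝ Ψ (timeDomain k ε) (t, x) :=
    hΨ.isSymmSndFDerivWithinAt (by simp; exact WithTop.coe_le_coe.2 le_top)
      (uniqueDiffOn_timeDomain ε) (timeDomain_subset_closure_interior ε hU) hU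
  have happ : ∀ v w : ℝ × E k,
      fderivWithin ℝ (fun z => fderivWithin ℝ Ψ (timeDomain k ε) z v) (timeDomain k ε) (t, x) w =
        fderivWithin ℝ (fderivWithin ℝ Ψ (timeDomain k ε)) (timeDomain k ε) (t, x) w v := by
    intro v w
    have := ((ContinuousLinearMap.apply ℝ F v).hasFDerivAt.comp_hasFDerivWithinAt (t, x)
      hD.hasFDerivWithinAt).fderivWithin (uniqueDiffOn_timeDomain ε _ hU)
    exact congrArg (fun L : (ℝ × E k) →L[ℝ] F => L w) this
  have h1 := hasDerivAt_slice ht hx ((contDiffWithinAt_fderivWithin_time ht hx hΨ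
    (0, EuclideanSpace.single i 1)).differentiableWithinAt (by simp))
  have h2 := fderivWithin_slice ht hx ((contDiffWithinAt_fderivWithin_time ht hx hΨ
    (1, 0)).differentiableWithinAt (by simp)) (EuclideanSpace.single i 1)
  -- Symmetry of the second derivative on the space-time domain exchanges ∂ₜ with ∂ᵢ.
  rw [happ, hsymm, ← happ, ← h2] at h1
  refine h1.congr_of_eventuallyEq ?_
  have hline : Tendsto (fun r => (r, x)) (𝓝 t) (𝓝[timeDomain k ε] (t, x)) := by
    refine tendsto_nhdsWithin_iff.2 ⟨(Continuous.prodMk_left x).continuousAt, ?_⟩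
    filter_upwards [isOpen_Ioo.mem_nhds ht] with r hr using ⟨hr, hx⟩
  exact hline.eventually (dirDeriv_slice_eventuallyEq hΨ i)

variable {Ψ : ℝ × E k → E n}

theorem contDiffWithinAt_density_slice (ht : t ∈ Ioo (-ε) ε) (hx : x ∈ halfSpace k)
    (hΨ : ContDiffWithinAt ℝ ∞ Ψ (timeDomain k ε) (t, x))
    (h : (gramOf (fun y => Ψ (t, y)) x).det ≠ 0) :
    ContDiffWithinAt ℝ ∞ (fun z : ℝ × E k => density (fun y => Ψ (z.1, y)) z.2)
      (timeDomain k ε) (t, x) :=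
  (contDiffWithinAt_det fun i j => (contDiffWithinAt_dirDeriv_slice ht hx hΨ i).inner ℝ
    (contDiffWithinAt_dirDeriv_slice ht hx hΨ j)).sqrt h

/-- The first variation of the area density. -/
theorem hasDerivAt_density_slice (ht : t ∈ Ioo (-ε) ε) (hx : x ∈ halfSpace k)
    (hΨ : ContDiffWithinAt ℝ ∞ Ψ (timeDomain k ε) (t, x))
    (h : (gramOf (fun y => Ψ (t, y)) x).det ≠ 0) :
    HasDerivAt (fun r => density (fun y => Ψ (r, y)) x)
      (divDensity (fun y => Ψ (t, y)) (velocityOf ε t Ψ) x) t := by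
  have h1 := hasFDerivWithinAt_sqrt_det_gram (s := univ) (x := t)
    (v := fun i r => dirDeriv i (fun y => Ψ (r, y)) x)
    (fun i => (hasDerivAt_dirDeriv_slice ht hx hΨ i).hasFDerivAt.hasFDerivWithinAt) h
  rw [hasFDerivWithinAt_univ] at h1
  refine h1.hasDerivAt.congr_deriv ?_
  simp only [sum_apply, ContinuousLinearMap.comp_apply, ContinuousLinearMap.toSpanSingleton_apply,
    one_smul]
  rfl

end Family

/-- A map on a manifold is smooth if its expressions in the preferred charts are. -/
theorem contMDiff_of_inChart {k : ℕ} [NeZero k] {M : Type*} [TopologicalSpace M]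
    [ChartedSpace (EuclideanHalfSpace k) M] [IsManifold (𝓡∂ k) ∞ M] {F : Type*}
    [NormedAddCommGroup F] [NormedSpace ℝ F] {f : M → F}
    (h : ∀ p, ContDiffWithinAt ℝ ∞ (inChart f p) (halfSpace k) (extChartAt (𝓡∂ k) p p)) :
    ContMDiff (𝓡∂ k) 𝓘(ℝ, F) ∞ f := by
  intro p
  have h1 := (h p).contMDiffWithinAt.comp p
    (contMDiffAt_extChartAt (I := 𝓡∂ k) (n := ∞) (x := p)).contMDiffWithinAt
    (fun q _ => mem_range_self _ : MapsTo _ univ _)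
  refine (contMDiffWithinAt_univ.1 h1).congr_of_eventuallyEq ?_
  filter_upwards [extChartAt_source_mem_nhds (I := 𝓡∂ k) p] with q hq
  rw [Function.comp_apply, inChart_apply, (extChartAt (𝓡∂ k) p).left_inv hq]

/-! ### The first variation of area -/

section FirstVariation

variable {k n : ℕ} [NeZero k] {M : Type*} [TopologicalSpace M]
  [ChartedSpace (EuclideanHalfSpace k) M]

/-- The velocity at time `0` of a family of maps. -/
def velocity (F : ℝ → M → E n) (q : M) : E n := deriv (fun t => F t q) 0

/-- The expression of a one-parameter family in a chart. -/
def familyInChart (F : ℝ → M → E n) (c : M) (z : ℝ × E k) : E n := inChart (F z.1) c z.2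

variable {φ : M → E n} {ε : ℝ} {K : Set M} {F : ℝ → M → E n}

theorem IsVariation.zero_mem (hF : IsVariation k φ ε K F) : (0 : ℝ) ∈ Ioo (-ε) ε :=
  ⟨neg_lt_zero.2 hF.pos, hF.pos⟩

theorem IsVariation.velocity_eq_zero (hF : IsVariation k φ ε K F) : ∀ q ∉ K, velocity F q = 0 := by
  intro q hq
  have : (fun t => F t q) =ᶠ[𝓝 0] fun _ => φ q := by
    filter_upwards [isOpen_Ioo.mem_nhds hF.zero_mem] with t ht using hF.eq_outside t ht q hq
  rw [velocity, this.deriv_eq, deriv_const]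

variable [IsManifold (𝓡∂ k) ∞ M]

theorem contDiffWithinAt_familyInChart
    (hF : ContMDiffOn (𝓘(ℝ, ℝ).prod (𝓡∂ k)) 𝓘(ℝ, E n) ∞ (Function.uncurry F)
      (Ioo (-ε) ε ×ˢ univ)) {t : ℝ} (ht : t ∈ Ioo (-ε) ε) {c : M} {x : E k}
    (hx : x ∈ (extChartAt (𝓡∂ k) c).target) :
    ContDiffWithinAt ℝ ∞ (familyInChart F c) (timeDomain k ε) (t, x) := by
  have h1 : ContMDiffOn 𝓘(ℝ, ℝ × E k) (𝓘(ℝ, ℝ).prod (𝓡∂ k)) ∞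
      (fun z : ℝ × E k => (z.1, (extChartAt (𝓡∂ k) c).symm z.2))
      (Ioo (-ε) ε ×ˢ (extChartAt (𝓡∂ k) c).target) := by
    refine ContMDiffOn.prodMk contDiff_fst.contMDiff.contMDiffOn ?_
    exact (contMDiffOn_extChartAt_symm c).comp contDiff_snd.contMDiff.contMDiffOn
      fun z hz => hz.2
  have h2 : ContMDiffOn 𝓘(ℝ, ℝ × E k) 𝓘(ℝ, E n) ∞ (familyInChart F c)
      (Ioo (-ε) ε ×ˢ (extChartAt (𝓡∂ k) c).target) :=
    hF.comp h1 fun z hz => ⟨hz.1, mem_univ _⟩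
  refine (h2.contDiffOn (t, x) ⟨ht, hx⟩).mono_of_mem_nhdsWithin ?_
  rw [timeDomain, nhdsWithin_prod_eq]
  exact prod_mem_prod self_mem_nhdsWithin (target_mem_nhdsWithin hx)

namespace IsVariation

theorem hasDerivAt_familyInChart (hF : IsVariation k φ ε K F) {c : M} {x : E k}
    (hx : x ∈ (extChartAt (𝓡∂ k) c).target) :
    HasDerivAt (fun t => F t ((extChartAt (𝓡∂ k) c).symm x))
      (velocityOf ε 0 (familyInChart F c) x) 0 :=
  hasDerivAt_slice hF.zero_mem (target_subset_halfSpace c hx)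
    ((contDiffWithinAt_familyInChart hF.smooth hF.zero_mem hx).differentiableWithinAt (by simp))

theorem inChart_velocity (hF : IsVariation k φ ε K F) {c : M} {x : E k}
    (hx : x ∈ (extChartAt (𝓡∂ k) c).target) :
    inChart (velocity F) c x = velocityOf ε 0 (familyInChart F c) x :=
  (hF.hasDerivAt_familyInChart hx).deriv

theorem contMDiff_velocity (hF : IsVariation k φ ε K F) :
    ContMDiff (𝓡∂ k) 𝓘(ℝ, E n) ∞ (velocity F) := by
  refine contMDiff_of_inChart fun p => ?_
  have hx := mem_extChartAt_target (I := 𝓡∂ k) p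
  refine (contDiffWithinAt_velocityOf hF.zero_mem (target_subset_halfSpace p hx)
    (contDiffWithinAt_familyInChart hF.smooth hF.zero_mem hx)).congr_of_eventuallyEq ?_
    (hF.inChart_velocity hx)
  filter_upwards [target_mem_nhdsWithin hx] with z hz using hF.inChart_velocity hz

theorem hasDerivAt (hF : IsVariation k φ ε K F) (q : M) :
    HasDerivAt (fun t => F t q) (velocity F q) 0 := by
  have := hF.hasDerivAt_familyInChart (mem_extChartAt_target (I := 𝓡∂ k) q)
  rw [extChartAt_to_inv] at this
  exact this.differentiableAt.hasDerivAt

/-- Boundary points stay on the sphere, so |F t q|² is constant in t. -/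
theorem inner_velocity (hF : IsVariation k φ ε K F) {q : M} (hq : q ∈ (𝓡∂ k).boundary M) :
    inner ℝ (velocity F q) (φ q) = 0 := by
  have h1 := (hF.hasDerivAt q).norm_sq
  have h2 : (fun t => ‖F t q‖ ^ 2) =ᶠ[𝓝 0] fun _ => 1 := by
    filter_upwards [isOpen_Ioo.mem_nhds hF.zero_mem] with t ht
    rw [mem_sphere_zero_iff_norm.1 (hF.mapsTo_sphere t ht q hq), one_pow]
  have h3 := h1.unique ((hasDerivAt_const (0 : ℝ) (1 : ℝ)).congr_of_eventuallyEq h2)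
  rw [hF.zero] at h3
  rw [real_inner_comm]
  linarith

theorem contDiffWithinAt_density (hF : IsVariation k φ ε K F) {t : ℝ} (ht : t ∈ Ioo (-ε) ε)
    {c : M} {x : E k} (hx : x ∈ (extChartAt (𝓡∂ k) c).target) :
    ContDiffWithinAt ℝ ∞ (fun z : ℝ × E k => density (inChart (F z.1) c) z.2)
      (timeDomain k ε) (t, x) :=
  contDiffWithinAt_density_slice (Ψ := familyInChart F c) ht (target_subset_halfSpace c hx)
    (contDiffWithinAt_familyInChart hF.smooth ht hx) (det_gramOf_ne_zero (hF.immersion t ht) hx)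

theorem hasDerivAt_density (hF : IsVariation k φ ε K F) {c : M} {x : E k}
    (hx : x ∈ (extChartAt (𝓡∂ k) c).target) :
    HasDerivAt (fun t => density (inChart (F t) c) x) (chartDiv φ (velocity F) c x) 0 := by
  have h1 := hasDerivAt_density_slice (Ψ := familyInChart F c) hF.zero_mem
    (target_subset_halfSpace c hx) (contDiffWithinAt_familyInChart hF.smooth hF.zero_mem hx)
    (det_gramOf_ne_zero (hF.immersion 0 hF.zero_mem) hx)
  refine h1.congr_deriv ?_
  have h2 : velocityOf ε 0 (familyInChart F c) =ᶠ[𝓝[halfSpace k] x] inChart (velocity F) c := by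
    filter_upwards [target_mem_nhdsWithin hx] with z hz using (hF.inChart_velocity hz).symm
  rw [divDensity_congr h2 (target_subset_halfSpace c hx), chartDiv, ← hF.zero]
  rfl

/-- Differentiation under the integral sign over a compact part of a chart. -/
theorem hasDerivAt_integral_density (hF : IsVariation k φ ε K F) {c : M} {Q : Set (E k)}
    (hQ : IsCompact Q) (hQc : Q ⊆ (extChartAt (𝓡∂ k) c).target) {ρ : E k → ℝ}
    (hρ : ContinuousOn ρ Q) :
    HasDerivAt (fun t => ∫ x in Q, ρ x * density (inChart (F t) c) x)
      (∫ x in Q, ρ x * chartDiv φ (velocity F) c x) 0 := by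
  set D : ℝ × E k → ℝ := fun z => density (inChart (F z.1) c) z.2 with hDdef
  set D' : ℝ × E k → ℝ := fun z => fderivWithin ℝ D (timeDomain k ε) z (1, 0) with hD'def
  have hε := hF.pos
  have hsub : Icc (-(ε / 2)) (ε / 2) ×ˢ Q ⊆ timeDomain k ε := prod_mono
    (Icc_subset_Ioo (by linarith) (by linarith)) (hQc.trans (target_subset_halfSpace c))
  have hDc : ∀ t ∈ Ioo (-ε) ε, ∀ x ∈ Q, ContDiffWithinAt ℝ ∞ D (timeDomain k ε) (t, x) :=
    fun t ht x hx => hF.contDiffWithinAt_density ht (hQc hx)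
  have hslice : ∀ t ∈ Ioo (-ε) ε, ∀ x ∈ Q, HasDerivAt (fun r => D (r, x)) (D' (t, x)) t :=
    fun t ht x hx => hasDerivAt_slice ht (target_subset_halfSpace c (hQc hx))
      ((hDc t ht x hx).differentiableWithinAt (by simp))
  have hD' : ContinuousOn D' (Icc (-(ε / 2)) (ε / 2) ×ˢ Q) := by
    rintro ⟨t, x⟩ ⟨ht, hx⟩
    have ht' : t ∈ Ioo (-ε) ε := Icc_subset_Ioo (by linarith) (by linarith) ht
    exact (contDiffWithinAt_fderivWithin_time ht' (target_subset_halfSpace c (hQc hx))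
      (hDc t ht' x hx) (1, 0)).continuousWithinAt.mono hsub
  have hDcont : ∀ t ∈ Ioo (-ε) ε, ContinuousOn (fun x => D (t, x)) Q := by
    intro t ht x hx
    exact ContinuousWithinAt.comp (f := fun y => (t, y)) (hDc t ht x hx).continuousWithinAt
      (Continuous.prodMk_right t).continuousWithinAt
      (fun y hy => ⟨ht, target_subset_halfSpace c (hQc hy)⟩)
  have hρ1 : ContinuousOn (fun z : ℝ × E k => ρ z.2) (Icc (-(ε / 2)) (ε / 2) ×ˢ Q) :=
    hρ.comp continuousOn_snd fun z hz => hz.2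
  -- The time interval is halved to make it compact; the derivative of the integrand, continuous on
  -- a compact product, is then dominated by a constant.
  obtain ⟨C, hC⟩ := (isCompact_Icc.prod hQ).exists_bound_of_continuousOn (hρ1.mul hD')
  have h0 : (0 : ℝ) ∈ Icc (-(ε / 2)) (ε / 2) := ⟨by linarith, by linarith⟩
  have hmeas := hQ.measurableSet
  have hD'0 : ContinuousOn (fun x => D' (0, x)) Q :=
    hD'.comp (Continuous.prodMk_right (0 : ℝ)).continuousOn fun y hy => ⟨h0, hy⟩
  have key := hasDerivAt_integral_of_dominated_loc_of_deriv_le (μ := volume.restrict Q)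
    (F := fun t x => ρ x * D (t, x)) (F' := fun t x => ρ x * D' (t, x)) (x₀ := (0 : ℝ))
    (s := Icc (-(ε / 2)) (ε / 2)) (bound := fun _ => C)
    (Icc_mem_nhds (by linarith) (by linarith)) ?_ ?_ ?_ ?_ ?_ ?_
  · refine key.2.congr_deriv (setIntegral_congr_fun hmeas fun x hx => ?_)
    rw [(hslice 0 hF.zero_mem x hx).unique (hF.hasDerivAt_density (hQc hx))]
  · filter_upwards [isOpen_Ioo.mem_nhds hF.zero_mem] with t ht
    exact (hρ.mul (hDcont t ht)).aestronglyMeasurable hmeas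
  · exact (hρ.mul (hDcont 0 hF.zero_mem)).integrableOn_compact hQ
  · exact (hρ.mul hD'0).aestronglyMeasurable hmeas
  · refine (ae_restrict_iff' hmeas).2 (ae_of_all _ fun x hx t ht => hC (t, x) ⟨ht, hx⟩)
  · exact integrableOn_const hQ.measure_lt_top.ne
  · refine (ae_restrict_iff' hmeas).2 (ae_of_all _ fun x hx t ht => ?_)
    exact (hslice t (Icc_subset_Ioo (by linarith) (by linarith) ht) x hx).const_mul _

variable [T2Space M] [SigmaCompactSpace M]

/-- The first variation of area. -/
theorem hasDerivAt_area (hF : IsVariation k φ ε K F) {s : Finset M}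
    (hs : ∀ c ∉ s, ∀ q ∈ K, partition k M c q = 0) :
    HasDerivAt (fun t => area k (F t) K) (∑ c ∈ s, ∫ x in (extChartAt (𝓡∂ k) c).target,
      inChart (partition k M c) c x * chartDiv φ (velocity F) c x) 0 := by
  have hmeas : ∀ c, MeasurableSet ((extChartAt (𝓡∂ k) c).target ∩
      (extChartAt (𝓡∂ k) c).symm ⁻¹' K) := by
    intro c
    obtain ⟨u, hu, h⟩ := continuousOn_iff_isClosed.1
      (continuousOn_extChartAt_symm (I := 𝓡∂ k) c) _ hF.compact.isClosed
    rw [inter_comm, h]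
    exact hu.measurableSet.inter (measurableSet_target c)
  -- The index set s depends only on K, so the same finite sum computes the area for every t.
  have harea : ∀ t, area k (F t) K = ∑ c ∈ s, ∫ x in (extChartAt (𝓡∂ k) c).target ∩
      (extChartAt (𝓡∂ k) c).symm ⁻¹' K,
      inChart (partition k M c) c x * density (inChart (F t) c) x := by
    intro t
    refine finsum_eq_sum_of_support_subset _ fun c hc => ?_
    by_contra hcs
    refine hc (setIntegral_eq_zero_of_forall_eq_zero fun x hx => ?_)
    rw [hs c hcs _ hx.2, zero_mul]
  rw [funext harea]
  refine HasDerivAt.fun_sum fun c _ => ?_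
  -- The chart target is not compact, so the integrals are cut down to the image of L. Outside it
  -- the weight is zero or, in the derivative, the point is off K and the velocity vanishes.
  set L := K ∩ tsupport (partition k M c) with hL
  have hLc : IsCompact L := hF.compact.inter_right (isClosed_tsupport _)
  have hLs : L ⊆ (extChartAt (𝓡∂ k) c).source := by
    rw [extChartAt_source]
    exact inter_subset_right.trans (partition_isSubordinate c)
  have hQc := image_chart_subset_target hLs
  have hQ := isCompact_image_chart hLc hLs
  have hmaps : extChartAt (𝓡∂ k) c '' L ⊆ (extChartAt (𝓡∂ k) c).target ∩
      (extChartAt (𝓡∂ k) c).symm ⁻¹' K := by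
    rintro _ ⟨q, hq, rfl⟩
    refine ⟨hQc ⟨q, hq, rfl⟩, ?_⟩
    rw [mem_preimage, (extChartAt (𝓡∂ k) c).left_inv (hLs hq)]
    exact hq.1
  have hρ0 : ∀ x ∈ (extChartAt (𝓡∂ k) c).target, x ∉ extChartAt (𝓡∂ k) c '' L →
      (extChartAt (𝓡∂ k) c).symm x ∈ K → inChart (partition k M c) c x = 0 := by
    intro x hx hxL hxK
    rw [inChart_apply]
    exact image_eq_zero_of_notMem_tsupport fun h =>
      symm_notMem_of_notMem_image hx hxL ⟨hxK, h⟩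
  have e1 : ∀ t, ∫ x in (extChartAt (𝓡∂ k) c).target ∩ (extChartAt (𝓡∂ k) c).symm ⁻¹' K,
      inChart (partition k M c) c x * density (inChart (F t) c) x =
      ∫ x in extChartAt (𝓡∂ k) c '' L,
        inChart (partition k M c) c x * density (inChart (F t) c) x := fun t =>
    setIntegral_eq_of_subset_of_forall_sdiff_eq_zero (hmeas c) hmaps fun x hx => by
      rw [hρ0 x hx.1.1 hx.2 hx.1.2, zero_mul]
  have e2 : ∫ x in (extChartAt (𝓡∂ k) c).target,
      inChart (partition k M c) c x * chartDiv φ (velocity F) c x =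
      ∫ x in extChartAt (𝓡∂ k) c '' L,
        inChart (partition k M c) c x * chartDiv φ (velocity F) c x :=
    setIntegral_eq_of_subset_of_forall_sdiff_eq_zero (measurableSet_target c) hQc fun x hx => by
      by_cases hxK : (extChartAt (𝓡∂ k) c).symm x ∈ K
      · rw [hρ0 x hx.1 hx.2 hxK, zero_mul]
      · rw [chartDiv_eq_zero hF.compact.isClosed hF.velocity_eq_zero hx.1 hxK, mul_zero]
  rw [funext e1, e2]
  exact hF.hasDerivAt_integral_density hQ hQc ((continuousOn_inChart_partition c c).mono hQc)

end IsVariation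

variable [T2Space M] [SigmaCompactSpace M]

/-- A free boundary minimal immersion is a critical point of the area. -/
theorem IsFreeBoundaryMinimal.isCriticalForArea (hφ : IsSmoothImmersion k φ)
    (hsphere : ∀ p ∈ (𝓡∂ k).boundary M, φ p ∈ sphere (0 : E n) 1)
    (h : IsFreeBoundaryMinimal k φ) : IsCriticalForArea k φ := by
  intro ε K F hF
  obtain ⟨s, hs⟩ := exists_finset_partition k hF.compact
  refine (hF.hasDerivAt_area hs).congr_deriv ?_
  rw [sum_integral_chartDiv_eq_sum hφ hF.contMDiff_velocity hF.compact hF.velocity_eq_zero hs]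
  refine Finset.sum_eq_zero fun d _ => ?_
  have hKd : IsCompact (K ∩ tsupport (partition k M d)) :=
    hF.compact.inter_right (isClosed_tsupport _)
  have hsub : K ∩ tsupport (partition k M d) ⊆ (extChartAt (𝓡∂ k) d).source := by
    rw [extChartAt_source]
    exact inter_subset_right.trans (partition_isSubordinate d)
  have hzero : ∀ q ∉ K ∩ tsupport (partition k M d), partition k M d q • velocity F q = 0 := by
    intro q hq
    by_cases hqK : q ∈ K
    · rw [image_eq_zero_of_notMem_tsupport fun h => hq ⟨hqK, h⟩, zero_smul]
    · rw [hF.velocity_eq_zero q hqK, smul_zero]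
  have hY := contMDiff_partition_smul hF.contMDiff_velocity d
  rw [integral_chartDiv hφ hY hKd hsub hzero, integral_divergence_halfSpace_eq_zero
    (contDiffOn_chartFlux hφ hY hKd hsub hzero) (isCompact_image_chart hKd hsub)
    (fun i x _ hx => chartFlux_eq_zero hzero i hx), zero_sub, neg_eq_zero]
  · refine setIntegral_eq_zero_of_forall_eq_zero fun x hx => ?_
    rw [lapDensity_inChart hφ hx, h.minimal, smul_zero, inner_zero_left]
  · intro x hx0
    rw [chartFlux]
    by_cases hx : x ∈ (extChartAt (𝓡∂ k) d).target
    swap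
    · rw [indicator_of_notMem hx]
    rw [indicator_of_mem hx]
    set q := (extChartAt (𝓡∂ k) d).symm x with hq
    have hqb : q ∈ (𝓡∂ k).boundary M := (mem_boundary_iff hx).2 hx0
    have hn : ‖φ q‖ = 1 := mem_sphere_zero_iff_norm.1 (hsphere q hqb)
    have hdet := det_gramOf_ne_zero hφ hx
    have hxS := target_subset_halfSpace d hx
    have hψd := (contDiffWithinAt_inChart hφ.1 hx).differentiableWithinAt (by simp)
    obtain ⟨ν, hν⟩ := exists_isOutwardConormal hφ q
    -- `φ q` is tangent to the immersion
    have htan : φ q ∈ tangentAt (inChart φ d) x := by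
      rw [range_differential hφ.1 hx]
      set c := inner ℝ (differential k φ q ν) (φ q) with hc
      -- This gives c² = 1, whence |φ q - c dφ(ν)|² = 1 - c² = 0; the sign of c plays no role here.
      have ho := h.orthogonal q hqb ν hν (differential k φ q ν - c • φ q) (by
        rw [inner_sub_right, inner_smul_right, real_inner_self_eq_norm_sq, hn, real_inner_comm]
        ring)
      have hu : inner ℝ (differential k φ q ν) (differential k φ q ν) = 1 := hν.unit
      rw [inner_sub_right, inner_smul_right, ← hc, hu] at ho
      have h2 : ‖φ q - c • differential k φ q ν‖ ^ 2 = 0 := by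
        rw [← real_inner_self_eq_norm_sq, inner_sub_left, inner_sub_right, inner_sub_right,
          inner_smul_left, inner_smul_left, inner_smul_right, inner_smul_right, hu,
          real_inner_comm (differential k φ q ν) (φ q), ← hc, real_inner_self_eq_norm_sq, hn]
        simp
        linarith
      rw [sub_eq_zero.1 (norm_eq_zero.1 (pow_eq_zero_iff two_ne_zero |>.1 h2))]
      exact Submodule.smul_mem _ _ ⟨ν, rfl⟩
    -- `φ q` is orthogonal to the boundary directions
    have hort : ∀ l, l ≠ 0 → inner ℝ (φ q) (dirDeriv l (inChart φ d) x) = 0 := by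
      intro l hl
      -- The line in direction e_l, l ≠ 0, stays in the hyperplane x₀ = 0, so |φ| = 1 along it near
      -- x.
      have hline : ∀ r : ℝ, (x + r • EuclideanSpace.single l (1 : ℝ)) 0 = 0 := by
        intro r
        simp [hx0, Ne.symm hl]
      have hlS : ∀ r : ℝ, x + r • EuclideanSpace.single l (1 : ℝ) ∈ halfSpace k := fun r =>
        mem_halfSpace.2 (hline r).ge
      have hγ : HasDerivAt (fun r : ℝ => x + r • EuclideanSpace.single l (1 : ℝ))
          (EuclideanSpace.single l (1 : ℝ)) 0 := by
        simpa using ((hasDerivAt_id (0 : ℝ)).smul_const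
          (EuclideanSpace.single l (1 : ℝ) : E k)).const_add x
      have hγt : Tendsto (fun r : ℝ => x + r • EuclideanSpace.single l (1 : ℝ)) (𝓝 0)
          (𝓝[halfSpace k] x) := by
        refine tendsto_nhdsWithin_iff.2 ⟨?_, Eventually.of_forall hlS⟩
        simpa using hγ.continuousAt.tendsto
      have hcomp : HasDerivAt (fun r : ℝ => inChart φ d (x + r • EuclideanSpace.single l (1 : ℝ)))
          (dirDeriv l (inChart φ d) x) 0 := by
        have hx' : x = x + (0 : ℝ) • EuclideanSpace.single l (1 : ℝ) := by simp
        have h3 : HasFDerivWithinAt (inChart φ d) (fderivWithin ℝ (inChart φ d) (halfSpace k) x)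
            (halfSpace k) (x + (0 : ℝ) • EuclideanSpace.single l (1 : ℝ)) := by
          rw [← hx']; exact hψd.hasFDerivWithinAt
        have h4 := h3.comp_hasDerivWithinAt (s := univ) (0 : ℝ) hγ.hasDerivWithinAt
          (fun r _ => hlS r)
        exact hasDerivWithinAt_univ.1 h4
      have h5 := hcomp.norm_sq
      have h6 : (fun r : ℝ => ‖inChart φ d (x + r • EuclideanSpace.single l (1 : ℝ))‖ ^ 2)
          =ᶠ[𝓝 0] fun _ => 1 := by
        filter_upwards [hγt.eventually (target_mem_nhdsWithin hx)] with r hr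
        rw [inChart_apply, mem_sphere_zero_iff_norm.1
          (hsphere _ ((mem_boundary_iff hr).2 (hline r))), one_pow]
      have h7 := h5.unique ((hasDerivAt_const (0 : ℝ) (1 : ℝ)).congr_of_eventuallyEq h6)
      simp only [zero_smul, add_zero] at h7
      change 2 * inner ℝ (φ q) _ = 0 at h7
      linarith
    -- Hence √(det g) φ(q) = a F⁰, with a ≠ 0 because φ(q) is a unit vector. So F⁰ is parallel to
    -- φ(q), and the velocity, tangent to the sphere, is orthogonal to it.
    have hfl := density_smul_eq_flux hdet htan hort
    set a := inner ℝ (φ q) (dirDeriv 0 (inChart φ d) x) with ha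
    have hinner : inner ℝ (a • flux (inChart φ d) 0 x) (velocity F q) = 0 := by
      rw [← hfl, real_inner_smul_left, real_inner_comm, hF.inner_velocity hqb, mul_zero]
    have ha0 : a ≠ 0 := by
      intro ha0
      rw [ha0, zero_smul, smul_eq_zero] at hfl
      rcases hfl with h8 | h8
      · exact (density_pos hdet).ne' h8
      · rw [h8, norm_zero] at hn
        exact zero_ne_one hn
    rw [real_inner_smul_left] at hinner
    rw [inChart_apply, inner_smul_right, (mul_eq_zero.1 hinner).resolve_left ha0, mul_zero]

end FirstVariation

/-! ### Deformations of the ball and the variations they induce -/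

/-- A smooth deformation `Φ(s, ·)` of `ℝⁿ` which for small `s` preserves the closed unit ball and
the unit sphere, with initial velocity `Y`. -/
structure IsBallDeformation {n : ℕ} (Φ : ℝ × E n → E n) (Y : E n → E n) : Prop where
  smooth : ContDiff ℝ ∞ Φ
  smooth_velocity : ContDiff ℝ ∞ Y
  zero : ∀ x, Φ (0, x) = x
  hasDerivAt : ∀ x, HasDerivAt (fun s => Φ (s, x)) (Y x) 0
  mapsTo : ∃ δ > 0, ∀ s, |s| < δ → (∀ x ∈ closedBall (0 : E n) 1, Φ (s, x) ∈ closedBall 0 1) ∧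
    ∀ x ∈ sphere (0 : E n) 1, Φ (s, x) ∈ sphere 0 1

/-- The factor 1 - |x|² fixes the sphere pointwise, so interior points can be pushed in any
direction w, forwards and backwards in s, without leaving the ball. -/
theorem isBallDeformation_push {n : ℕ} {w : E n} (hw : ‖w‖ ≤ 1) :
    IsBallDeformation (fun z : ℝ × E n => z.2 + (z.1 * (1 - ‖z.2‖ ^ 2)) • w)
      (fun x => (1 - ‖x‖ ^ 2) • w) where
  smooth := contDiff_snd.add ((contDiff_fst.mul
    (contDiff_const.sub (contDiff_snd.norm_sq ℝ))).smul contDiff_const)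
  smooth_velocity := (contDiff_const.sub (contDiff_id.norm_sq ℝ)).smul contDiff_const
  zero x := by simp
  hasDerivAt x := by
    simpa using (((hasDerivAt_id (0 : ℝ)).mul_const (1 - ‖x‖ ^ 2)).smul_const w).const_add x
  mapsTo := by
    refine ⟨1 / 4, by norm_num, fun s hs => ?_⟩
    have hs' := abs_lt.1 hs
    -- The quantity 1 - |Φ|² factors through 1 - |x|². For |s| < 1/4 the other factor is at least 1
    -- - 1/2 - 1/16 > 0.
    have key : ∀ x : E n, ‖x‖ ≤ 1 → ‖x + (s * (1 - ‖x‖ ^ 2)) • w‖ ^ 2 =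
        1 - (1 - ‖x‖ ^ 2) *
          (1 - 2 * s * inner ℝ x w - s ^ 2 * (1 - ‖x‖ ^ 2) * ‖w‖ ^ 2) := by
      intro x _
      rw [norm_add_sq_real, inner_smul_right, norm_smul, mul_pow, Real.norm_eq_abs, sq_abs]
      ring
    refine ⟨fun x hx => ?_, fun x hx => ?_⟩
    · rw [mem_closedBall_zero_iff] at hx ⊢
      have h1 : |s * inner ℝ x w| ≤ 1 / 4 := by
        rw [abs_mul]
        have h2 : |inner ℝ x w| ≤ 1 :=
          (abs_real_inner_le_norm x w).trans (mul_le_one₀ hx (norm_nonneg _) hw)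
        calc |s| * |inner ℝ x w| ≤ (1 / 4) * 1 := by gcongr
          _ = 1 / 4 := by norm_num
      have h3 := (abs_le.1 h1).2
      have h4 : s ^ 2 ≤ 1 / 16 := by nlinarith
      have h5 : 0 ≤ 1 - ‖x‖ ^ 2 := by nlinarith [norm_nonneg x]
      have h6 : s ^ 2 * (1 - ‖x‖ ^ 2) * ‖w‖ ^ 2 ≤ 1 / 16 * 1 * 1 := by
        gcongr
        · nlinarith [norm_nonneg x]
        · nlinarith [norm_nonneg w]
      have h7 := key x hx
      have h8 : ‖x + (s * (1 - ‖x‖ ^ 2)) • w‖ ^ 2 ≤ 1 := by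
        rw [h7]
        have : 0 ≤ (1 - ‖x‖ ^ 2) *
          (1 - 2 * s * inner ℝ x w - s ^ 2 * (1 - ‖x‖ ^ 2) * ‖w‖ ^ 2) :=
          mul_nonneg h5 (by linarith)
        linarith
      exact (sq_le_one_iff₀ (norm_nonneg _)).1 h8
    · rw [mem_sphere_zero_iff_norm] at hx ⊢
      simp [hx]

/-- The infinitesimal rotation in the plane spanned by two orthonormal vectors. -/
theorem isBallDeformation_rotation {n : ℕ} {u w : E n} (hu : ‖u‖ = 1) (hw : ‖w‖ = 1)
    (huw : inner ℝ u w = 0) :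
    IsBallDeformation
      (fun z : ℝ × E n => z.2 +
        (((Real.cos z.1 - 1) * inner ℝ z.2 u - Real.sin z.1 * inner ℝ z.2 w) • u +
        ((Real.cos z.1 - 1) * inner ℝ z.2 w + Real.sin z.1 * inner ℝ z.2 u) • w))
      (fun x => inner ℝ x u • w - inner ℝ x w • u) where
  smooth := by
    have hc : ContDiff ℝ ∞ fun z : ℝ × E n => Real.cos z.1 := Real.contDiff_cos.comp contDiff_fst
    have hs : ContDiff ℝ ∞ fun z : ℝ × E n => Real.sin z.1 := Real.contDiff_sin.comp contDiff_fst
    have hi : ∀ v : E n, ContDiff ℝ ∞ fun z : ℝ × E n => inner ℝ z.2 v := fun v =>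
      contDiff_snd.inner ℝ contDiff_const
    exact contDiff_snd.add (((((hc.sub contDiff_const).mul (hi u)).sub (hs.mul (hi w))).smul
      contDiff_const).add ((((hc.sub contDiff_const).mul (hi w)).add (hs.mul (hi u))).smul
      contDiff_const))
  smooth_velocity := ((contDiff_id.inner ℝ contDiff_const).smul contDiff_const).sub
    ((contDiff_id.inner ℝ contDiff_const).smul contDiff_const)
  zero x := by simp
  hasDerivAt x := by
    have hc := (Real.hasDerivAt_cos 0).sub_const 1
    have hs := Real.hasDerivAt_sin 0
    have h := ((((hc.mul_const (inner ℝ x u)).sub (hs.mul_const (inner ℝ x w))).smul_const u).add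
      (((hc.mul_const (inner ℝ x w)).add (hs.mul_const (inner ℝ x u))).smul_const w)).const_add x
    refine h.congr_deriv ?_
    simp only [Real.sin_zero, Real.cos_zero, neg_zero, zero_mul, one_mul, zero_sub, zero_add,
      neg_smul]
    abel
  mapsTo := by
    -- The map is an exact rotation by the angle s and preserves norms for all s, so the bound 1 is
    -- arbitrary.
    refine ⟨1, one_pos, fun s _ => ?_⟩
    have key : ∀ x : E n, ‖x + (((Real.cos s - 1) * inner ℝ x u - Real.sin s * inner ℝ x w) • u +
        ((Real.cos s - 1) * inner ℝ x w + Real.sin s * inner ℝ x u) • w)‖ = ‖x‖ := by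
      intro x
      rw [← sq_eq_sq₀ (norm_nonneg _) (norm_nonneg _), norm_add_sq_real, norm_add_sq_real,
        inner_add_right, inner_smul_right, inner_smul_right, inner_smul_left, inner_smul_right,
        norm_smul, norm_smul, hu, hw, huw, mul_one, mul_one, Real.norm_eq_abs, Real.norm_eq_abs,
        sq_abs, sq_abs]
      have := Real.sin_sq_add_cos_sq s
      simp only [mul_zero, add_zero]
      linear_combination (inner ℝ x u ^ 2 + inner ℝ x w ^ 2) * this
    refine ⟨fun x hx => ?_, fun x hx => ?_⟩
    · rw [mem_closedBall_zero_iff] at hx ⊢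
      exact (key x).trans_le hx
    · rw [mem_sphere_zero_iff_norm] at hx ⊢
      exact (key x).trans hx

/-- The variation of `φ` induced by a deformation of the ball and a cut-off function. -/
def deform {n : ℕ} {M : Type*} (Φ : ℝ × E n → E n) (η : M → ℝ) (φ : M → E n)
    (t : ℝ) (q : M) : E n :=
  Φ (t * η q, φ q)

theorem velocity_deform {n : ℕ} {M : Type*} {φ : M → E n} {Φ : ℝ × E n → E n} {Y : E n → E n}
    {η : M → ℝ} (hΦ : IsBallDeformation Φ Y) (q : M) :
    velocity (deform Φ η φ) q = η q • Y (φ q) := by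
  have h1 : HasDerivAt (fun t : ℝ => t * η q) (η q) 0 := by
    simpa using (hasDerivAt_id (0 : ℝ)).mul_const (η q)
  have h2 : HasDerivAt (fun s => Φ (s, φ q)) (Y (φ q)) (0 * η q) := by
    rw [zero_mul]; exact hΦ.hasDerivAt _
  exact (h2.scomp (0 : ℝ) h1).deriv

section Variations

variable {k n : ℕ} [NeZero k] {M : Type*} [TopologicalSpace M]
  [ChartedSpace (EuclideanHalfSpace k) M]
  {φ : M → E n} {Φ : ℝ × E n → E n} {Y : E n → E n} {η : M → ℝ} {c : M} {K : Set M}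

theorem contMDiff_deform (hφ : ContMDiff (𝓡∂ k) 𝓘(ℝ, E n) ∞ φ) (hΦ : ContDiff ℝ ∞ Φ)
    (hη : ContMDiff (𝓡∂ k) 𝓘(ℝ, ℝ) ∞ η) :
    ContMDiff (𝓘(ℝ, ℝ).prod (𝓡∂ k)) 𝓘(ℝ, E n) ∞ (Function.uncurry (deform Φ η φ)) := by
  have h1 : ContMDiff (𝓘(ℝ, ℝ).prod (𝓡∂ k)) 𝓘(ℝ, ℝ) ∞ (fun z : ℝ × M => z.1 * η z.2) :=
    contMDiff_fst.smul (hη.comp contMDiff_snd)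
  exact hΦ.contMDiff.comp (h1.prodMk_space (hφ.comp contMDiff_snd))

variable [IsManifold (𝓡∂ k) ∞ M]

/-- Being an immersion is an open condition, and compactness of Q makes the admissible time uniform.
-/
theorem eventually_det_ne_zero (hφ : IsSmoothImmersion k φ) {F : ℝ → M → E n} (hF0 : F 0 = φ)
    (hF : ContMDiff (𝓘(ℝ, ℝ).prod (𝓡∂ k)) 𝓘(ℝ, E n) ∞ (Function.uncurry F)) {Q : Set (E k)}
    (hQ : IsCompact Q) (hQc : Q ⊆ (extChartAt (𝓡∂ k) c).target) :
    ∀ᶠ t in 𝓝 (0 : ℝ), ∀ x ∈ Q, (gramOf (inChart (F t) c) x).det ≠ 0 := by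
  -- The compactness argument uses full neighbourhoods in ℝ × ℝᵏ; the extra implication makes points
  -- off the half-space harmless.
  have h : ∀ᶠ t in 𝓝 (0 : ℝ), ∀ x ∈ Q, x ∈ halfSpace k →
      (gramOf (inChart (F t) c) x).det ≠ 0 := by
    refine hQ.eventually_forall_of_forall_eventually fun x hx => ?_
    have h0 : (0 : ℝ) ∈ Ioo (-1) 1 := by norm_num
    have hxS := target_subset_halfSpace c (hQc hx)
    have h1 := contDiffWithinAt_familyInChart (hF.contMDiffOn (s := Ioo (-1) 1 ×ˢ univ)) h0
      (hQc hx)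
    have h2 : ContDiffWithinAt ℝ ∞ (fun z : ℝ × E k => (gramOf (inChart (F z.1) c) z.2).det)
        (timeDomain k 1) (0, x) :=
      contDiffWithinAt_det fun i j => (contDiffWithinAt_dirDeriv_slice h0 hxS h1 i).inner ℝ
        (contDiffWithinAt_dirDeriv_slice h0 hxS h1 j)
    have h3 := h2.continuousWithinAt.eventually_ne
      (show (gramOf (inChart (F 0) c) x).det ≠ 0 by
        rw [hF0]; exact det_gramOf_ne_zero hφ (hQc hx))
    have h4 : ∀ᶠ z : ℝ × E k in 𝓝 (0, x), z.1 ∈ Ioo (-1 : ℝ) 1 :=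
      continuousAt_fst.eventually (isOpen_Ioo.mem_nhds h0)
    filter_upwards [eventually_nhdsWithin_iff.1 h3, h4] with z hz hz1 hzS
    exact hz ⟨hz1, hzS⟩
  filter_upwards [h] with t ht x hx using ht x hx (target_subset_halfSpace c (hQc hx))

/-- The cut-off rescales time: the point q is moved by Φ at time tη(q), and |tη(q)| ≤ |t| keeps it
in the ball. The immersion property need be checked only on K, inside one chart, since off K the map
agrees locally with φ. -/
theorem exists_isVariation_deform [T2Space M] (hφ : IsSmoothImmersion k φ)
    (hball : ∀ p, φ p ∈ closedBall (0 : E n) 1)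
    (hsphere : ∀ p ∈ (𝓡∂ k).boundary M, φ p ∈ sphere (0 : E n) 1)
    (hΦ : IsBallDeformation Φ Y) (hη : ContMDiff (𝓡∂ k) 𝓘(ℝ, ℝ) ∞ η) (hη1 : ∀ q, |η q| ≤ 1)
    (hK : IsCompact K) (hKc : K ⊆ (extChartAt (𝓡∂ k) c).source) (hηK : ∀ q ∉ K, η q = 0) :
    ∃ ε, IsVariation k φ ε K (deform Φ η φ) := by
  obtain ⟨δ, hδ, hmaps⟩ := hΦ.mapsTo
  have hzero : deform Φ η φ 0 = φ := by
    ext1 q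
    rw [deform, zero_mul, hΦ.zero]
  have hsm := contMDiff_deform hφ.1 hΦ.smooth hη
  have hev := eventually_det_ne_zero hφ hzero hsm (isCompact_image_chart hK hKc)
    (image_chart_subset_target hKc)
  obtain ⟨ε₁, hε₁, hε₁'⟩ := Metric.eventually_nhds_iff.1 hev
  have ht1 : ∀ t ∈ Ioo (-(min δ ε₁)) (min δ ε₁), |t| < δ ∧ dist t 0 < ε₁ := fun t ht => by
    have := abs_lt.2 ht
    rw [Real.dist_0_eq_abs]
    exact lt_min_iff.1 this
  have hts : ∀ t ∈ Ioo (-(min δ ε₁)) (min δ ε₁), ∀ q, |t * η q| < δ := fun t ht q => by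
    rw [abs_mul]
    exact (mul_le_of_le_one_right (abs_nonneg t) (hη1 q)).trans_lt (ht1 t ht).1
  have hout : ∀ t, ∀ q ∉ K, deform Φ η φ t q = φ q := fun t q hq => by
    rw [deform, hηK q hq, mul_zero, hΦ.zero]
  have hslice : ∀ t, ContMDiff (𝓡∂ k) 𝓘(ℝ, E n) ∞ (deform Φ η φ t) := fun t =>
    hsm.comp (contMDiff_const.prodMk contMDiff_id : ContMDiff (𝓡∂ k) (𝓘(ℝ, ℝ).prod (𝓡∂ k)) ∞
      fun q : M => (t, q))
  refine ⟨min δ ε₁, ⟨lt_min hδ hε₁, hK, hsm.contMDiffOn, fun t ht => ⟨hslice t, fun q => ?_⟩,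
    fun t ht p => (hmaps _ (hts t ht p)).1 _ (hball p),
    fun t ht p hp => (hmaps _ (hts t ht p)).2 _ (hsphere p hp), hzero,
    fun t _ => hout t⟩⟩
  by_cases hq : q ∈ K
  · have h1 := injective_differential_of_det_ne_zero (hslice t)
      ((extChartAt (𝓡∂ k) c).map_source (hKc hq)) (hε₁' (ht1 t ht).2 _ ⟨q, hq, rfl⟩)
    rwa [(extChartAt (𝓡∂ k) c).left_inv (hKc hq)] at h1
  · have h1 : deform Φ η φ t =ᶠ[𝓝 q] φ := by
      filter_upwards [hK.isClosed.isOpen_compl.mem_nhds hq] with z hz using hout t z hz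
    have h2 : differential k (deform Φ η φ t) q = differential k φ q := h1.mfderiv_eq
    rw [h2]
    exact hφ.2 q

variable [T2Space M] [SigmaCompactSpace M]

theorem IsCriticalForArea.integral_chartDiv_eq_zero (hcrit : IsCriticalForArea k φ)
    (hφ : IsSmoothImmersion k φ) (hball : ∀ p, φ p ∈ closedBall (0 : E n) 1)
    (hsphere : ∀ p ∈ (𝓡∂ k).boundary M, φ p ∈ sphere (0 : E n) 1)
    (hΦ : IsBallDeformation Φ Y) (hη : ContMDiff (𝓡∂ k) 𝓘(ℝ, ℝ) ∞ η) (hη1 : ∀ q, |η q| ≤ 1)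
    (hK : IsCompact K) (hKc : K ⊆ (extChartAt (𝓡∂ k) c).source) (hηK : ∀ q ∉ K, η q = 0) :
    ∫ x in (extChartAt (𝓡∂ k) c).target, chartDiv φ (fun q => η q • Y (φ q)) c x = 0 := by
  obtain ⟨ε, hF⟩ := exists_isVariation_deform hφ hball hsphere hΦ hη hη1 hK hKc hηK
  obtain ⟨s, hs⟩ := exists_finset_partition k hK
  have h1 := (hF.hasDerivAt_area hs).unique (hcrit ε K _ hF)
  rw [sum_integral_chartDiv hφ hF.contMDiff_velocity hK hKc hF.velocity_eq_zero hs] at h1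
  rwa [funext fun q => velocity_deform (φ := φ) (η := η) hΦ q] at h1

end Variations

/-! ### Cut-off functions supported in a chart -/

section Transplant

variable {k n : ℕ} [NeZero k] {M : Type*} [TopologicalSpace M]
  [ChartedSpace (EuclideanHalfSpace k) M] {c : M} {u : E k → ℝ}

/-- A function on the model space, transplanted to the domain of a chart. -/
def transplant (c : M) (u : E k → ℝ) : M → ℝ :=
  (extChartAt (𝓡∂ k) c).source.indicator (u ∘ extChartAt (𝓡∂ k) c)

/-- The support of the transplanted function. -/
def transplantSupport (c : M) (u : E k → ℝ) : Set M :=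
  (extChartAt (𝓡∂ k) c).symm '' (tsupport u ∩ halfSpace k)

theorem inChart_transplant {x : E k} (hx : x ∈ (extChartAt (𝓡∂ k) c).target) :
    inChart (transplant c u) c x = u x := by
  rw [inChart_apply, transplant, indicator_of_mem ((extChartAt (𝓡∂ k) c).map_target hx),
    Function.comp_apply, (extChartAt (𝓡∂ k) c).right_inv hx]

theorem isCompact_transplantSupport (hu : HasCompactSupport u)
    (huc : tsupport u ∩ halfSpace k ⊆ (extChartAt (𝓡∂ k) c).target) :
    IsCompact (transplantSupport c u) :=
  (hu.isCompact.inter_right isClosed_halfSpace).image_of_continuousOn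
    ((continuousOn_extChartAt_symm c).mono huc)

theorem transplantSupport_subset (huc : tsupport u ∩ halfSpace k ⊆ (extChartAt (𝓡∂ k) c).target) :
    transplantSupport c u ⊆ (extChartAt (𝓡∂ k) c).source :=
  image_subset_iff.2 fun _ hx => (extChartAt (𝓡∂ k) c).map_target (huc hx)

theorem transplant_eq_zero {q : M} (hq : q ∉ transplantSupport c u) : transplant c u q = 0 := by
  by_cases hqs : q ∈ (extChartAt (𝓡∂ k) c).source
  · rw [transplant, indicator_of_mem hqs]
    refine image_eq_zero_of_notMem_tsupport (f := u) fun h => hq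
      ⟨_, ⟨h, mem_range_self _⟩, (extChartAt (𝓡∂ k) c).left_inv hqs⟩
  · rw [transplant, indicator_of_notMem hqs]

theorem abs_transplant_le (hu1 : ∀ x, |u x| ≤ 1) (q : M) : |transplant c u q| ≤ 1 := by
  rw [transplant]
  by_cases hqs : q ∈ (extChartAt (𝓡∂ k) c).source
  · rw [indicator_of_mem hqs]; exact hu1 _
  · rw [indicator_of_notMem hqs, abs_zero]; exact zero_le_one

variable [IsManifold (𝓡∂ k) ∞ M]

/-- The support is compact, hence closed in the Hausdorff manifold, so extension by zero is smooth.
It is allowed to meet ∂Σ, as the boundary condition requires. -/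
theorem contMDiff_transplant [T2Space M] (hu : ContDiff ℝ ∞ u) (huk : HasCompactSupport u)
    (huc : tsupport u ∩ halfSpace k ⊆ (extChartAt (𝓡∂ k) c).target) :
    ContMDiff (𝓡∂ k) 𝓘(ℝ, ℝ) ∞ (transplant c u) := by
  intro q
  by_cases hqs : q ∈ (extChartAt (𝓡∂ k) c).source
  · have h1 : ContMDiffAt (𝓡∂ k) 𝓘(ℝ, E k) ∞ (extChartAt (𝓡∂ k) c) q :=
      contMDiffAt_extChartAt' (by rwa [extChartAt_source] at hqs)
    refine (hu.contMDiff.contMDiffAt.comp q h1).congr_of_eventuallyEq ?_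
    filter_upwards [(isOpen_extChartAt_source (I := 𝓡∂ k) c).mem_nhds hqs] with z hz
    rw [transplant, indicator_of_mem hz]
  · have hqK : q ∉ transplantSupport c u := fun h => hqs (transplantSupport_subset huc h)
    refine (contMDiffAt_const (c := (0 : ℝ))).congr_of_eventuallyEq ?_
    filter_upwards [(isCompact_transplantSupport huk huc).isClosed.isOpen_compl.mem_nhds hqK]
      with z hz using transplant_eq_zero hz

end Transplant

/-! ### The Euler-Lagrange equations -/

section EulerLagrange

variable {k n : ℕ} [NeZero k] {M : Type*} [TopologicalSpace M]
  [ChartedSpace (EuclideanHalfSpace k) M] [IsManifold (𝓡∂ k) ∞ M] [T2Space M]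
  [SigmaCompactSpace M] {φ : M → E n} {Φ : ℝ × E n → E n} {Y : E n → E n} {c : M}

/-- The weak form of the Euler-Lagrange equations in a chart. -/
theorem IsCriticalForArea.weak_form (hcrit : IsCriticalForArea k φ)
    (hφ : IsSmoothImmersion k φ) (hball : ∀ p, φ p ∈ closedBall (0 : E n) 1)
    (hsphere : ∀ p ∈ (𝓡∂ k).boundary M, φ p ∈ sphere (0 : E n) 1)
    (hΦ : IsBallDeformation Φ Y) {u : E k → ℝ} (hu : ContDiff ℝ ∞ u) (hu1 : ∀ x, |u x| ≤ 1)
    (huk : HasCompactSupport u)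
    (huc : tsupport u ∩ halfSpace k ⊆ (extChartAt (𝓡∂ k) c).target) :
    ∃ W : Fin k → E k → ℝ, (∀ i, ContDiffOn ℝ 1 (W i) (halfSpace k)) ∧
      (∃ Q, IsCompact Q ∧ ∀ i, ∀ x ∈ halfSpace k, x ∉ Q → W i x = 0) ∧
      (∀ i, ∀ x ∈ (extChartAt (𝓡∂ k) c).target,
        W i x = u x * inner ℝ (flux (inChart φ c) i x) (Y (inChart φ c x))) ∧
      (∀ i, ∀ x ∉ (extChartAt (𝓡∂ k) c).target, W i x = 0) ∧
      IntegrableOn (fun x => u x * inner ℝ (lapDensity (inChart φ c) x) (Y (inChart φ c x)))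
        (extChartAt (𝓡∂ k) c).target ∧
      ∫ x in halfSpace k, ∑ i, dirDeriv i (W i) x = ∫ x in (extChartAt (𝓡∂ k) c).target,
        u x * inner ℝ (lapDensity (inChart φ c) x) (Y (inChart φ c x)) := by
  set η := transplant c u with hη
  have hηs := contMDiff_transplant hu huk huc
  have hK := isCompact_transplantSupport huk huc
  have hKc := transplantSupport_subset huc
  have hηK : ∀ q ∉ transplantSupport c u, η q = 0 := fun q hq => transplant_eq_zero hq
  have hX : ContMDiff (𝓡∂ k) 𝓘(ℝ, E n) ∞ (fun q => η q • Y (φ q)) :=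
    hηs.smul (hΦ.smooth_velocity.contMDiff.comp hφ.1)
  have hXK : ∀ q ∉ transplantSupport c u, η q • Y (φ q) = 0 := fun q hq => by
    rw [hηK q hq, zero_smul]
  have h1 := hcrit.integral_chartDiv_eq_zero hφ hball hsphere hΦ hηs (abs_transplant_le hu1) hK hKc
    hηK
  rw [integral_chartDiv hφ hX hK hKc hXK, sub_eq_zero] at h1
  have hin : ∀ x ∈ (extChartAt (𝓡∂ k) c).target, ∀ v : E n,
      inner ℝ v (inChart (fun q => η q • Y (φ q)) c x) =
        u x * inner ℝ v (Y (inChart φ c x)) := fun x hx v => by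
    rw [inChart_apply, inner_smul_right, ← inChart_apply η, hη, inChart_transplant hx]
    rfl
  have hint : IntegrableOn (fun x => inner ℝ (lapDensity (inChart φ c) x)
      (inChart (fun q => η q • Y (φ q)) c x)) (extChartAt (𝓡∂ k) c).target := by
    refine integrableOn_target (continuousOn_inner_lapDensity hφ hX) hK hKc fun x hx hxK => ?_
    rw [inChart_apply (fun q => η q • Y (φ q)), hXK _ hxK, inner_zero_right]
  refine ⟨chartFlux φ (fun q => η q • Y (φ q)) c, contDiffOn_chartFlux hφ hX hK hKc hXK,
    ⟨_, isCompact_image_chart hK hKc, fun i x _ hx => chartFlux_eq_zero hXK i hx⟩,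
    fun i x hx => ?_, fun i x hx => ?_, ?_, h1.trans ?_⟩
  · rw [chartFlux, indicator_of_mem hx, hin x hx]
  · rw [chartFlux, indicator_of_notMem hx]
  · exact hint.congr_fun (fun x hx => hin x hx _) (measurableSet_target c)
  · exact setIntegral_congr_fun (measurableSet_target c) fun x hx => hin x hx _

/-- A signed cut-off function around a point of a chart. -/
theorem exists_cutoff {x₁ : E k} {s : Set (E k)} (hs : s ∈ 𝓝[halfSpace k] x₁) (σ : ℝ)
    (hσ : |σ| ≤ 1) : ∃ u : E k → ℝ, ContDiff ℝ ∞ u ∧ (∀ x, |u x| ≤ 1) ∧ HasCompactSupport u ∧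
      tsupport u ∩ halfSpace k ⊆ s ∧ (∃ r > 0, ∀ x ∈ ball x₁ r, u x = σ) ∧
      (∀ x ∈ halfSpace k, x ∉ s → u x = 0) ∧ ∀ x, ∃ a, 0 ≤ a ∧ u x = a * σ := by
  obtain ⟨r, hr, hrs⟩ := Metric.mem_nhdsWithin_iff.1 hs
  -- The outer radius r/2 leaves room for the closed support inside the ball of radius r.
  let f : ContDiffBump x₁ := ⟨r / 4, r / 2, by positivity, by linarith⟩
  have hsub : tsupport (fun x => f x * σ) ⊆ closedBall x₁ (r / 2) :=
    (tsupport_mul_subset_left).trans f.tsupport_eq.subset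
  have hin : tsupport (fun x => f x * σ) ∩ halfSpace k ⊆ s := fun x hx =>
    hrs ⟨closedBall_subset_ball (by linarith) (hsub hx.1), hx.2⟩
  refine ⟨fun x => f x * σ, f.contDiff.mul contDiff_const, fun x => ?_,
    f.hasCompactSupport.mul_right, hin,
    ⟨r / 4, by positivity, fun x hx => ?_⟩, fun x hxS hx => ?_, fun x => ⟨f x, f.nonneg, rfl⟩⟩
  · rw [abs_mul, abs_of_nonneg f.nonneg]
    exact mul_le_one₀ f.le_one (abs_nonneg _) hσ
  · change f x * σ = σ
    rw [f.one_of_mem_closedBall (ball_subset_closedBall hx), one_mul]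
  · exact image_eq_zero_of_notMem_tsupport (f := fun x => f x * σ) fun h => hx (hin ⟨h, hxS⟩)

theorem exists_sign {a : ℝ} (ha : a ≠ 0) : ∃ σ : ℝ, |σ| ≤ 1 ∧ 0 < σ * a := by
  rcases lt_or_gt_of_ne ha with h | h
  · exact ⟨-1, by simp, by linarith⟩
  · exact ⟨1, by simp, by linarith⟩

/-- The fundamental lemma of the calculus of variations. A cut-off supported in {x₀ > 0}, with the
sign of the integrand, has no boundary term, yet would give a positive integral. -/
theorem IsCriticalForArea.inner_lapDensity_of_pos (hcrit : IsCriticalForArea k φ)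
    (hφ : IsSmoothImmersion k φ) (hball : ∀ p, φ p ∈ closedBall (0 : E n) 1)
    (hsphere : ∀ p ∈ (𝓡∂ k).boundary M, φ p ∈ sphere (0 : E n) 1)
    (hΦ : IsBallDeformation Φ Y) {x : E k} (hx : x ∈ (extChartAt (𝓡∂ k) c).target)
    (hx0 : 0 < x 0) : inner ℝ (lapDensity (inChart φ c) x) (Y (inChart φ c x)) = 0 := by
  set h : E k → ℝ := fun z => inner ℝ (lapDensity (inChart φ c) z) (Y (inChart φ c z)) with hh
  by_contra hne
  obtain ⟨σ, hσ, hpos⟩ := exists_sign hne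
  have hcont : ContinuousOn h (extChartAt (𝓡∂ k) c).target :=
    continuousOn_inner_lapDensity hφ (hΦ.smooth_velocity.contMDiff.comp hφ.1)
  have hcw : ContinuousWithinAt h (halfSpace k) x :=
    (hcont x hx).mono_of_mem_nhdsWithin (target_mem_nhdsWithin hx)
  have hs : (extChartAt (𝓡∂ k) c).target ∩ {z | 0 < σ * h z ∧ 0 < z 0} ∈ 𝓝[halfSpace k] x := by
    filter_upwards [target_mem_nhdsWithin hx,
      (hcw.const_mul σ).eventually (lt_mem_nhds hpos),
      mem_nhdsWithin_of_mem_nhds ((isOpen_lt continuous_const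
        (by fun_prop : Continuous fun z : E k => z 0)).mem_nhds hx0)] with z h1 h2 h3
      using ⟨h1, h2, h3⟩
  obtain ⟨u, hu, hu1, huk, hus, ⟨r, hr, hur⟩, hu0, hua⟩ := exists_cutoff hs σ hσ
  obtain ⟨W, hW, ⟨Q, hQ, hWQ⟩, hWin, hWout, hint, heq⟩ := hcrit.weak_form hφ hball hsphere hΦ hu hu1
    huk (hus.trans inter_subset_left)
  rw [integral_divergence_halfSpace_eq_zero hW hQ hWQ] at heq
  · have hnonneg : 0 ≤ᵐ[volume.restrict (extChartAt (𝓡∂ k) c).target] fun z => u z * h z := by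
      refine (ae_restrict_iff' (measurableSet_target c)).2 (ae_of_all _ fun z hz => ?_)
      by_cases hzs : z ∈ (extChartAt (𝓡∂ k) c).target ∩ {z | 0 < σ * h z ∧ 0 < z 0}
      · obtain ⟨a, ha, hau⟩ := hua z
        change 0 ≤ u z * h z
        rw [hau, mul_assoc]
        exact mul_nonneg ha hzs.2.1.le
      · change 0 ≤ u z * h z
        rw [hu0 z (target_subset_halfSpace c hz) hzs, zero_mul]
    have h1 := (setIntegral_pos_iff_support_of_nonneg_ae hnonneg hint).2 ?_
    · exact h1.ne heq
    have hs' : (extChartAt (𝓡∂ k) c).target ∩ {z | 0 < σ * h z ∧ 0 < z 0} ∩ ball x r ∈ 𝓝 x := by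
      refine inter_mem ?_ (ball_mem_nhds x hr)
      rwa [nhdsWithin_eq_nhds.2 (halfSpace_mem_nhds hx0)] at hs
    refine (Measure.measure_pos_of_mem_nhds volume hs').trans_le (measure_mono ?_)
    rintro z ⟨⟨hz, hz1, -⟩, hzr⟩
    refine ⟨?_, hz⟩
    rw [Function.mem_support, hur z hzr]
    exact hz1.ne'
  · intro z hz0
    by_cases hz : z ∈ (extChartAt (𝓡∂ k) c).target
    · rw [hWin 0 z hz, hu0 z (target_subset_halfSpace c hz) fun hzs => hzs.2.2.ne' hz0, zero_mul]
    · exact hWout 0 z hz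

/-- Boundary points are reached by continuity along the ray in direction e₀. -/
theorem IsCriticalForArea.inner_lapDensity (hcrit : IsCriticalForArea k φ)
    (hφ : IsSmoothImmersion k φ) (hball : ∀ p, φ p ∈ closedBall (0 : E n) 1)
    (hsphere : ∀ p ∈ (𝓡∂ k).boundary M, φ p ∈ sphere (0 : E n) 1)
    (hΦ : IsBallDeformation Φ Y) {x : E k} (hx : x ∈ (extChartAt (𝓡∂ k) c).target) :
    inner ℝ (lapDensity (inChart φ c) x) (Y (inChart φ c x)) = 0 := by
  have hxS := mem_halfSpace.1 (target_subset_halfSpace c hx)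
  have hcw : ContinuousWithinAt
      (fun z => inner ℝ (lapDensity (inChart φ c) z) (Y (inChart φ c z))) (halfSpace k) x :=
    ((continuousOn_inner_lapDensity (c := c) hφ
      (hΦ.smooth_velocity.contMDiff.comp hφ.1)) x hx).mono_of_mem_nhdsWithin
      (target_mem_nhdsWithin hx)
  have hline : Tendsto (fun r : ℝ => x + r • (EuclideanSpace.single 0 1 : E k)) (𝓝[>] 0)
      (𝓝[halfSpace k] x) := by
    refine tendsto_nhdsWithin_iff.2 ⟨?_, ?_⟩
    · have : Continuous fun r : ℝ => x + r • (EuclideanSpace.single 0 1 : E k) := by fun_prop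
      have h2 := this.tendsto 0
      rw [zero_smul, add_zero] at h2
      exact h2.mono_left nhdsWithin_le_nhds
    · filter_upwards [self_mem_nhdsWithin] with r hr
      rw [mem_halfSpace]
      have : (0 : ℝ) < r := hr
      simp
      linarith
  refine tendsto_nhds_unique (hcw.tendsto.comp hline)
    (tendsto_const_nhds.congr' ?_)
  filter_upwards [hline.eventually (target_mem_nhdsWithin hx), self_mem_nhdsWithin] with r hr hr0
  refine (hcrit.inner_lapDensity_of_pos hφ hball hsphere hΦ hr ?_).symm
  have : (0 : ℝ) < r := hr0
  simp
  linarith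

/-- Now the cut-off meets the boundary. The interior term is already known to vanish, so a nonzero
value would leave a boundary term of strict sign. -/
theorem IsCriticalForArea.inner_flux (hcrit : IsCriticalForArea k φ)
    (hφ : IsSmoothImmersion k φ) (hball : ∀ p, φ p ∈ closedBall (0 : E n) 1)
    (hsphere : ∀ p ∈ (𝓡∂ k).boundary M, φ p ∈ sphere (0 : E n) 1)
    (hΦ : IsBallDeformation Φ Y) {x : E k} (hx : x ∈ (extChartAt (𝓡∂ k) c).target)
    (hx0 : x 0 = 0) : inner ℝ (flux (inChart φ c) 0 x) (Y (inChart φ c x)) = 0 := by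
  set b : E k → ℝ := fun z => inner ℝ (flux (inChart φ c) 0 z) (Y (inChart φ c z)) with hb
  by_contra hne
  obtain ⟨σ, hσ, hpos⟩ := exists_sign hne
  have hcw : ContinuousWithinAt b (halfSpace k) x :=
    ((contDiffWithinAt_flux (contDiffWithinAt_inChart hφ.1 hx) (target_subset_halfSpace c hx)
      (det_gramOf_ne_zero hφ hx) 0).inner ℝ (contDiffWithinAt_inChart
      (hΦ.smooth_velocity.contMDiff.comp hφ.1) hx)).continuousWithinAt
  have hs : (extChartAt (𝓡∂ k) c).target ∩ {z | 0 < σ * b z} ∈ 𝓝[halfSpace k] x := by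
    filter_upwards [target_mem_nhdsWithin hx,
      (hcw.const_mul σ).eventually (lt_mem_nhds hpos)] with z h1 h2 using ⟨h1, h2⟩
  obtain ⟨u, hu, hu1, huk, hus, ⟨r, hr, hur⟩, hu0, hua⟩ := exists_cutoff hs σ hσ
  obtain ⟨W, hW, ⟨Q, hQ, hWQ⟩, hWin, hWout, -, heq⟩ := hcrit.weak_form hφ hball hsphere hΦ hu hu1
    huk (hus.trans inter_subset_left)
  refine (integral_divergence_halfSpace_neg hW hQ hWQ (fun z hz0 => ?_) hx0 ?_).ne
    (heq.trans (setIntegral_eq_zero_of_forall_eq_zero fun z hz => by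
      rw [hcrit.inner_lapDensity hφ hball hsphere hΦ hz, mul_zero]))
  · by_cases hz : z ∈ (extChartAt (𝓡∂ k) c).target
    · rw [hWin 0 z hz]
      by_cases hzs : z ∈ (extChartAt (𝓡∂ k) c).target ∩ {z | 0 < σ * b z}
      · obtain ⟨a, ha, hau⟩ := hua z
        rw [hau, mul_assoc]
        exact mul_nonneg ha hzs.2.le
      · rw [hu0 z (target_subset_halfSpace c hz) hzs, zero_mul]
    · rw [hWout 0 z hz]
  · rw [hWin 0 x hx, hur x (mem_ball_self hr)]
    exact hpos.ne'

end EulerLagrange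

/-! ### Critical points are free boundary minimal -/

section Spherical

variable {k n : ℕ} [NeZero k] {M : Type*} [TopologicalSpace M]
  [ChartedSpace (EuclideanHalfSpace k) M] {φ : M → E n} {p : M}

theorem eventually_norm_inChart (h : ∀ᶠ q in 𝓝 p, ‖φ q‖ = 1) :
    ∀ᶠ z in 𝓝[halfSpace k] (extChartAt (𝓡∂ k) p p), ‖inChart φ p z‖ = 1 := by
  have hc := continuousAt_extChartAt_symm (I := 𝓡∂ k) p
  rw [ContinuousAt, extChartAt_to_inv] at hc
  exact (hc.mono_left nhdsWithin_le_nhds).eventually h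

variable [IsManifold (𝓡∂ k) ∞ M]

/-- `meanCurvature` uses a different chart at each point; continuity comes from the quotient of
`lapDensity` by `density` in a fixed chart. -/
theorem continuous_meanCurvature (hφ : IsSmoothImmersion k φ) :
    Continuous (meanCurvature k φ) := by
  refine (contMDiff_of_inChart (k := k) fun p => ?_).continuous
  have hx := mem_extChartAt_target (I := 𝓡∂ k) p
  have hxS := target_subset_halfSpace p hx
  have hψ := contDiffWithinAt_inChart hφ.1 hx
  have hdet := det_gramOf_ne_zero hφ hx
  refine (((contDiffWithinAt_density hψ hxS hdet).inv (density_pos hdet).ne').smul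
    (contDiffWithinAt_lapDensity hψ hxS hdet)).congr_of_eventuallyEq_of_mem ?_ hxS
  filter_upwards [target_mem_nhdsWithin hx] with z hz
  rw [inChart_apply, Pi.smul_apply', Pi.inv_apply, lapDensity_inChart hφ hz, smul_smul,
    inv_mul_cancel₀ (density_pos (det_gramOf_ne_zero hφ hz)).ne', one_smul]

theorem inner_dirDeriv_self_eq_zero {ψ : E k → E n} {x : E k}
    (hψ : ContDiffWithinAt ℝ ∞ ψ (halfSpace k) x) (hx : x ∈ halfSpace k)
    (h : ∀ᶠ z in 𝓝[halfSpace k] x, ‖ψ z‖ = 1) (l : Fin k) :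
    inner ℝ (dirDeriv l ψ x) (ψ x) = 0 := by
  have hd := hψ.differentiableWithinAt (by simp)
  have h1 := dirDeriv_inner hd hd hx (i := l)
  have h2 : dirDeriv l (fun z => inner ℝ (ψ z) (ψ z)) x = dirDeriv l (fun _ => (1 : ℝ)) x := by
    refine dirDeriv_congr ?_ hx l
    filter_upwards [h] with z hz
    rw [real_inner_self_eq_norm_sq, hz, one_pow]
  rw [h2, real_inner_comm (dirDeriv l ψ x) (ψ x)] at h1
  have h3 : dirDeriv l (fun _ => (1 : ℝ)) x = 0 := by
    simp [dirDeriv]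
  linarith

theorem inner_flux_self_eq_zero {ψ : E k → E n} {x : E k}
    (hψ : ContDiffWithinAt ℝ ∞ ψ (halfSpace k) x) (hx : x ∈ halfSpace k)
    (h : ∀ᶠ z in 𝓝[halfSpace k] x, ‖ψ z‖ = 1) (i : Fin k) :
    inner ℝ (flux ψ i x) (ψ x) = 0 := by
  rw [flux, real_inner_smul_left, sum_inner]
  simp [real_inner_smul_left, inner_dirDeriv_self_eq_zero hψ hx h]

/-- Where an immersion takes its values in the unit sphere, `⟨H, φ⟩ = -k`. -/
theorem inner_meanCurvature_of_spherical (hφ : IsSmoothImmersion k φ)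
    (h : ∀ᶠ q in 𝓝 p, ‖φ q‖ = 1) : inner ℝ (meanCurvature k φ p) (φ p) = -k := by
  have hx := mem_extChartAt_target (I := 𝓡∂ k) p
  have hxS := target_subset_halfSpace p hx
  have hψ := contDiffWithinAt_inChart hφ.1 hx
  have hdet := det_gramOf_ne_zero hφ hx
  have hpos := density_pos hdet
  have hn := eventually_norm_inChart (k := k) h
  -- The field is the position vector itself: its divergence density is k √(det g), and its flux
  -- components vanish near the point because ψ is orthogonal to all ∂ₗψ.
  have key := divDensity_eq hψ hxS hdet hψ
  rw [Finset.sum_eq_zero, divDensity_self hdet, lapDensity_inChart hφ hx, extChartAt_to_inv,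
    inChart_center, real_inner_smul_left] at key
  · refine mul_left_cancel₀ hpos.ne' ?_
    linarith
  · intro i _
    rw [dirDeriv_congr (g := fun _ => (0 : ℝ)) _ hxS]
    · simp [dirDeriv]
    · filter_upwards [eventually_eventually_nhdsWithin.2 hn, target_mem_nhdsWithin hx] with z hz hzt
      exact inner_flux_self_eq_zero (contDiffWithinAt_inChart hφ.1 hzt)
        (target_subset_halfSpace p hzt) hz i

end Spherical

/-! ### Test fields and the exclusion of spherical pieces -/

section Converse

variable {k n : ℕ} [NeZero k] {M : Type*} [TopologicalSpace M]
  [ChartedSpace (EuclideanHalfSpace k) M] [IsManifold (𝓡∂ k) ∞ M] [T2Space M]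
  [SigmaCompactSpace M] {φ : M → E n} {p : M}

theorem IsCriticalForArea.meanCurvature_eq_zero_of_norm_lt (hcrit : IsCriticalForArea k φ)
    (hφ : IsSmoothImmersion k φ) (hball : ∀ p, φ p ∈ closedBall (0 : E n) 1)
    (hsphere : ∀ p ∈ (𝓡∂ k).boundary M, φ p ∈ sphere (0 : E n) 1) (hp : ‖φ p‖ < 1) :
    meanCurvature k φ p = 0 := by
  have hx := mem_extChartAt_target (I := 𝓡∂ k) p
  have hpos := density_pos (det_gramOf_ne_zero hφ hx)
  set H := meanCurvature k φ p with hH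
  -- The push is made in the direction of H, rescaled to length at most 1 in a way that also makes
  -- sense for H = 0.
  have hw : ‖(1 + ‖H‖)⁻¹ • H‖ ≤ 1 := by
    rw [norm_smul, norm_inv, Real.norm_of_nonneg (by positivity), inv_mul_le_one₀ (by positivity)]
    linarith
  have h := hcrit.inner_lapDensity hφ hball hsphere (isBallDeformation_push hw) hx
  rw [lapDensity_inChart hφ hx, extChartAt_to_inv, inChart_center, ← hH, real_inner_smul_left,
    inner_smul_right, inner_smul_right, real_inner_self_eq_norm_sq] at h
  have h1 : 1 - ‖φ p‖ ^ 2 ≠ 0 := by nlinarith [norm_nonneg (φ p)]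
  have h2 : (1 + ‖H‖)⁻¹ ≠ 0 := by positivity
  simpa only [mul_eq_zero, hpos.ne', h1, h2, false_or, pow_eq_zero_iff two_ne_zero, norm_eq_zero]
    using h

/-- At the boundary the flux is normal to the unit sphere. -/
theorem IsCriticalForArea.inner_flux_eq_zero (hcrit : IsCriticalForArea k φ)
    (hφ : IsSmoothImmersion k φ) (hball : ∀ p, φ p ∈ closedBall (0 : E n) 1)
    (hsphere : ∀ p ∈ (𝓡∂ k).boundary M, φ p ∈ sphere (0 : E n) 1)
    (hp : p ∈ (𝓡∂ k).boundary M) {w : E n} (hw : inner ℝ (φ p) w = 0) :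
    inner ℝ (flux (inChart φ p) 0 (extChartAt (𝓡∂ k) p p)) w = 0 := by
  rcases eq_or_ne w 0 with rfl | hw0
  · exact inner_zero_right _
  have hu : ‖φ p‖ = 1 := mem_sphere_zero_iff_norm.1 (hsphere p hp)
  have hwn : ‖w‖ ≠ 0 := norm_ne_zero_iff.2 hw0
  -- Rotation in the plane of φ(p) and w has velocity w/|w| at φ(p).
  have h := hcrit.inner_flux hφ hball hsphere (isBallDeformation_rotation hu
    (norm_smul_inv_norm (𝕜 := ℝ) hw0) (by rw [inner_smul_right, hw, mul_zero]))
    (mem_extChartAt_target p) (center_zero_of_mem_boundary hp)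
  rw [inChart_center, real_inner_self_eq_norm_sq, hu, inner_smul_right (φ p), hw, mul_zero,
    zero_smul, sub_zero, one_pow, one_smul, inner_smul_right] at h
  simpa [hwn] using h

/-- Pushes give nothing where |φ| = 1, so the spherical set is excluded by topology: ⟨H, φ⟩ is -k on
its interior and 0 on the closure of {|φ| < 1}. -/
theorem IsCriticalForArea.meanCurvature_eq_zero (hcrit : IsCriticalForArea k φ)
    (hφ : IsSmoothImmersion k φ) (hball : ∀ p, φ p ∈ closedBall (0 : E n) 1)
    (hsphere : ∀ p ∈ (𝓡∂ k).boundary M, φ p ∈ sphere (0 : E n) 1)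
    (hclosed : ∀ p : M, Disjoint (connectedComponent p) ((𝓡∂ k).boundary M) →
      ∃ q ∈ connectedComponent p, φ q ∉ sphere (0 : E n) 1) (p : M) :
    meanCurvature k φ p = 0 := by
  by_contra hne
  have hφc : Continuous φ := hφ.1.continuous
  have hHc := continuous_meanCurvature hφ
  set A : Set M := closure {q | ‖φ q‖ < 1} with hA
  have hHA : ∀ q ∈ A, meanCurvature k φ q = 0 := fun q hq =>
    closure_minimal (s := {q | ‖φ q‖ < 1}) (fun q hq =>
      hcrit.meanCurvature_eq_zero_of_norm_lt hφ hball hsphere hq)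
      (isClosed_eq hHc continuous_const) hq
  have hU : IsOpen Aᶜ := isClosed_closure.isOpen_compl
  have hUn : ∀ q ∈ Aᶜ, ‖φ q‖ = 1 := fun q hq =>
    le_antisymm (mem_closedBall_zero_iff.1 (hball q)) (not_lt.1 fun h => hq (subset_closure h))
  have hUev : ∀ q ∈ Aᶜ, ∀ᶠ q' in 𝓝 q, ‖φ q'‖ = 1 := fun q hq => by
    filter_upwards [hU.mem_nhds hq] with q' hq' using hUn q' hq'
  have hUH : closure Aᶜ ⊆ {q | inner ℝ (meanCurvature k φ q) (φ q) = -(k : ℝ)} :=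
    closure_minimal (fun q hq => inner_meanCurvature_of_spherical hφ (hUev q hq))
      (isClosed_eq (hHc.inner hφc) continuous_const)
  -- A limit point lying in A would satisfy both H = 0 and ⟨H, φ⟩ = -k, impossible for k ≥ 1.
  have hUc : IsClosed Aᶜ := by
    refine isClosed_of_closure_subset fun q hq hqA => ?_
    have h := hUH hq
    rw [mem_ofPred_eq, hHA q hqA, inner_zero_left] at h
    have : (k : ℝ) ≠ 0 := Nat.cast_ne_zero.2 (NeZero.ne k)
    exact this (by linarith)
  have hsub : connectedComponent p ⊆ Aᶜ :=
    IsClopen.connectedComponent_subset ⟨hUc, hU⟩ fun hp => hne (hHA p hp)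
  by_cases hdisj : Disjoint (connectedComponent p) ((𝓡∂ k).boundary M)
  · obtain ⟨q, hq, hqs⟩ := hclosed p hdisj
    exact hqs (mem_sphere_zero_iff_norm.2 (hUn q (hsub hq)))
  · obtain ⟨q, hq, hqb⟩ := not_disjoint_iff.1 hdisj
    have hx := mem_extChartAt_target (I := 𝓡∂ k) q
    have hdet := det_gramOf_ne_zero hφ hx
    have h1 := inner_flux_self_eq_zero (contDiffWithinAt_inChart hφ.1 hx)
      (target_subset_halfSpace q hx) (eventually_norm_inChart (k := k) (hUev q (hsub hq))) 0
    rw [inChart_center, real_inner_comm] at h1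
    -- Near q the map is spherical, so F⁰ is orthogonal to φ(q) and may itself serve as the test
    -- vector. It is then orthogonal to itself, contradicting ⟨F⁰, ∂₀φ⟩ = √(det g) > 0.
    have h2 := hcrit.inner_flux_eq_zero hφ hball hsphere hqb h1
    have h3 := inner_flux_dirDeriv hdet 0 0
    rw [inner_self_eq_zero.1 h2, inner_zero_left, if_pos rfl] at h3
    exact (density_pos hdet).ne h3

theorem IsCriticalForArea.isFreeBoundaryMinimal (hcrit : IsCriticalForArea k φ)
    (hφ : IsSmoothImmersion k φ) (hball : ∀ p, φ p ∈ closedBall (0 : E n) 1)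
    (hsphere : ∀ p ∈ (𝓡∂ k).boundary M, φ p ∈ sphere (0 : E n) 1)
    (hclosed : ∀ p : M, Disjoint (connectedComponent p) ((𝓡∂ k).boundary M) →
      ∃ q ∈ connectedComponent p, φ q ∉ sphere (0 : E n) 1) :
    IsFreeBoundaryMinimal k φ where
  minimal := hcrit.meanCurvature_eq_zero hφ hball hsphere hclosed
  orthogonal p hp ν hν w hw := by
    obtain ⟨a, ha⟩ := hν.exists_eq_smul_flux hφ
    rw [ha, real_inner_smul_left, hcrit.inner_flux_eq_zero hφ hball hsphere hp hw, mul_zero]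

end Converse

end FreeBoundary

end

/-! ### The equivalence of the three conditions -/

theorem mainTheorem1 {k n : ℕ} [NeZero k] {M : Type*} [TopologicalSpace M]
    [ChartedSpace (EuclideanHalfSpace k) M] [IsManifold (𝓡∂ k) ∞ M] [T2Space M]
    [SigmaCompactSpace M] (φ : M → FreeBoundary.E n)
    (hφ : FreeBoundary.IsSmoothImmersion k φ)
    (hball : ∀ p, φ p ∈ closedBall (0 : FreeBoundary.E n) 1)
    (hsphere : ∀ p ∈ (𝓡∂ k).boundary M, φ p ∈ sphere (0 : FreeBoundary.E n) 1)
    (hclosed : ∀ p : M, Disjoint (connectedComponent p) ((𝓡∂ k).boundary M) →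
      ∃ q ∈ connectedComponent p, φ q ∉ sphere (0 : FreeBoundary.E n) 1) :
    List.TFAE [FreeBoundary.IsFreeBoundaryMinimal k φ,
      FreeBoundary.IsCriticalForArea k φ,
      FreeBoundary.CoordinatesHarmonicRobin k φ] := by
  tfae_have 1 ↔ 3 :=
    FreeBoundary.isFreeBoundaryMinimal_iff_coordinatesHarmonicRobin hφ hball hsphere
  tfae_have 1 → 2 := fun h => h.isCriticalForArea hφ hsphere
  tfae_have 2 → 1 := fun h => h.isFreeBoundaryMinimal hφ hball hsphere hclosed
  tfae_finish
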